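/- Let $\mathfrak g$ be a complex Lie algebra with a nondegenerate symmetric invariant bilinear form $(\,,)$. For $Y\subset\mathbb P=\mathbb P^1(\mathbb C)$ let $\mathfrak g^Y$ be the Lie algebra of rational maps $\mathbb P\to\mathfrak g$ that are regular on $Y$, and let $\mathcal V^Y=U\mathfrak g^Y/\langle U^+\mathfrak g\rangle=U\mathfrak g^Y\otimes_{U\mathfrak g}\mathbb C$, where $\langle U^+\mathfrak g\rangle$ is the left ideal generated by the constants $\mathfrak g$. Write $\mathcal V=\mathcal V^{\emptyset}$ and $\mathcal V^z=\mathcal V^{\{z\}}$; for $Y'\subset Y$ there is a natural map $\mathcal V^Y\to\mathcal V^{Y'}$. For $P\in Y$ let $\mathfrak g^Y_{P,-}\subset\mathfrak g^Y$ be the subalgebra of maps vanishing at $P$. Let $K_z$ be the cotangent line at $z$. A coordinate with pole $P$ is a rational function $u$ whose only pole is a simple pole at $P$. For a coordinate $u$ with pole $P$, $v\in\mathfrak g$ and $z\ne P$, let $\epsilon^v(z)$ be left multiplication by $\frac{v}{u-u(z)}\otimes du_z$ (defined on $U\mathfrak g^Y_{P,-}$ if $P\in Y\not\ni z$, and on $\mathcal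 V^Y$ if $z\notin Y$), and let $\iota^v(z)$ (defined on $U\mathfrak g^Y_{P,-}$ if $P,z\in Y$, and on $\mathcal V^Y$ if $z\in Y$) be determined by $\iota^v(z)\mathbf 1=0$ and $$[\iota^v(z),\alpha]=-[\epsilon^v(z),\alpha]-(v,d\alpha(z))+\iota^{[v,\alpha(z)]}(z)+\epsilon^{[v,\alpha(z)]}(z)$$ for $\alpha\in\mathfrak g^Y_{P,-}$ (respectively $\alpha\in\mathfrak g^Y$). Let $j^v(z)=\epsilon^v(z)+\iota^v(z)$, from the space of $Y\ni z$ to the space of $Y'\subset Y$, $z\notin Y'$, tensored with $K_z$. **Theorem.** (0) If $P\in Y$, the natural map $U\mathfrak g^Y_{P,-}\to\mathcal V^Y$ is bijective. Under these identifications the operators $\epsilon,\iota$ on $U\mathfrak g^Y_{P,-}$ agree with those on $\mathcal V^Y$. (1) Let $\tilde P\ne P$, let $u$ be a coordinate with pole $P$ and $u(\tilde P)=0$, let $\tilde u=1/u$, and let $\tilde\epsilon,\tilde\iota,\tilde\jmath$ be the operators defined by $(\tilde P,\tilde u)$. For $z\ne P,\tilde P$ and every rational map $\nu$ to $\mathfrak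 g$ regular at $z$, under the identifications of (0), on $\mathcal V^Y$ with $P,\tilde P\in Y$ (with $z\notin Y$ for $\epsilon$, and $z\in Y$ for $\iota$), $$\tilde\epsilon^{\nu(z)}(z)=\epsilon^{\nu(z)}(z)-\nu(z)\frac{d\tilde u_z}{\tilde u(z)},\qquad \tilde\iota^{\nu(z)}(z)=\iota^{\nu(z)}(z)+\nu(z)\frac{d\tilde u_z}{\tilde u(z)},$$ and $\tilde\jmath^{\,\nu(z)}(z)=j^{\nu(z)}(z):\mathcal V^Y\to\mathcal V^{Y'}\otimes K_z$ for $P,\tilde P\in Y'\subset Y$, $z\in Y\setminus Y'$. (2) There is exactly one family of operators $j^v(z):\mathcal V^Y\to\mathcal V^{Y'}\otimes K_z$ (all $z\in\mathbb P$, $Y'\subset Y$, $z\in Y\setminus Y'$, $v\in\mathfrak g$, linear in $v$), compatible with the natural maps $\mathcal V^Y\to\mathcal V^{Y_1}$ for $Y_1\subset Y$, that agrees with $\epsilon^v(z)+\iota^v(z)$ under the identifications (0) for every $P\in Y'$ and every coordinate $u$ with pole $P$. In particular there are operators $j^v(z):\mathcal V^z\to\mathcal V\otimes K_z$ for all $z\in\mathbb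 P$. Moreover: - $j^v(z)=\epsilon^v(z)+\iota^v(z)$ on $\mathcal V^Y$ for every $P\ne z$ and every coordinate $u$ with pole $P$. - $j$ is covariant under every automorphism $\varphi$ of $\mathbb P$: the pullbacks $\mathcal V^Y\to\mathcal V^{\varphi^{-1}(Y)}$ and $K_{\varphi(z)}\to K_z$ intertwine $j^v(\varphi(z))$ with $j^v(z)$. - $j$ is a field: for $U$ Zariski open (cofinite), $P\notin U$, $m\in\mathcal V^U$ and $\nu\in\mathfrak g^U$, the vector $j^{\nu(z)}(z)m\in\mathcal V\otimes K_z$ varies algebraically with $z\in U$. Given $z\neq P$, every $m\in\mathcal V^z$ comes from $\mathcal V^U$ for some Zariski open $U$ with $z\in U\not\ni P$. - $j$ satisfies the OPE: for every $P$, every coordinate $u$ with pole $P$, every Zariski open $U\not\ni P$, $m\in\mathcal V^U$ and $v_1,v_2\in\mathfrak g$, applied to $m$ and as $z_2\to z_1$ in $U$, $$j^{v_2}(z_2)j^{v_1}(z_1)-\frac{(v_1,v_2)\,du_{z_1}du_{z_2}}{(u(z_1)-u(z_2))^2}-\frac{du_{z_2}\,j^{[v_2,v_1]}(z_1)}{u(z_2)-u(z_1)}$$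 $$\longrightarrow\ \iota^{v_2}(z_1)\iota^{v_1}(z_1)+\epsilon^{v_2}(z_1)\epsilon^{v_1}(z_1)+\epsilon^{v_2}(z_1)\iota^{v_1}(z_1)+\epsilon^{v_1}(z_1)\iota^{v_2}(z_1)+\frac{d\hat\iota^{[v_2,v_1]}}{du}(z_1)\,du_{z_1}^2,$$ where $\iota(z)=\hat\iota(z)\,du_z$. The limit means that the left side, a section over $\{z_2\ne z_1\}\subset U\times U$, extends algebraically across the diagonal with the right side as restriction. Algebraic dependence of vectors of $\mathcal V$ on parameters $t$ in $T=U$ or $T=U\times U$ means being a finite sum of products of elements $F_t\otimes x$ ($x\in\mathfrak g$), applied to $\mathbf 1$, where $F_t(y)$ is a regular function of $(y,t)\in U\times T$ with poles allowed along $y=z$ (respectively $y=z_1$, $y=z_2$). -/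

import Mathlib

open scoped TensorProduct OnePoint Polynomial
noncomputable section
namespace CurrentAlgebra

/-- The rational function `f` is regular at the point `z` of the Riemann sphere `ℂ ∪ {∞}`. -/
def IsRegularAt (z : OnePoint ℂ) (f : RatFunc ℂ) : Prop :=
  z.elim (f.intDegree ≤ 0) (fun a => f.denom.eval a ≠ 0)

/-- The value of the rational function `f` at a point `z` at which it is regular. -/
def value (z : OnePoint ℂ) (f : RatFunc ℂ) : ℂ :=
  z.elim (f.num.coeff f.denom.natDegree) (fun a => f.eval (RingHom.id ℂ) a)

lemma isRegularAt_coe_iff (a : ℂ) (f : RatFunc ℂ) : IsRegularAt a f ↔ f.denom.eval a ≠ 0 := Iff.rfl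

lemma isRegularAt_infty_iff (f : RatFunc ℂ) :
    IsRegularAt ∞ f ↔ f.num.natDegree ≤ f.denom.natDegree := by
  change f.intDegree ≤ 0 ↔ _
  unfold RatFunc.intDegree; omega

lemma isRegularAt_coe_of_div (a : ℂ) (p q : ℂ[X]) (hq : q.eval a ≠ 0) :
    IsRegularAt a (algebraMap ℂ[X] (RatFunc ℂ) p / algebraMap ℂ[X] (RatFunc ℂ) q) := by
  have hq0 : q ≠ 0 := by rintro rfl; simp at hq
  rw [isRegularAt_coe_iff]
  intro h
  exact hq (Polynomial.eval_eq_zero_of_dvd_of_eval_eq_zero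
    ((RatFunc.denom_dvd hq0).2 ⟨p, rfl⟩) h)

lemma isRegularAt_infty_of_div (p q : ℂ[X]) (hq : q ≠ 0) (h : p.natDegree ≤ q.natDegree) :
    IsRegularAt ∞ (algebraMap ℂ[X] (RatFunc ℂ) p / algebraMap ℂ[X] (RatFunc ℂ) q) := by
  by_cases hp : p = 0
  · subst hp; rw [isRegularAt_infty_iff]; simp
  change RatFunc.intDegree _ ≤ 0
  rw [RatFunc.intDegree_div (by simpa using hp) (by simpa using hq)]
  simp; omega

lemma value_infty_of_div (p q : ℂ[X]) (hq : q ≠ 0) (h : p.natDegree ≤ q.natDegree) :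
    value ∞ (algebraMap ℂ[X] (RatFunc ℂ) p / algebraMap ℂ[X] (RatFunc ℂ) q) =
      p.coeff q.natDegree / q.coeff q.natDegree := by
  set f := algebraMap ℂ[X] (RatFunc ℂ) p / algebraMap ℂ[X] (RatFunc ℂ) q with hf
  have hr : f.num.natDegree ≤ f.denom.natDegree :=
    (isRegularAt_infty_iff f).1 (isRegularAt_infty_of_div p q hq h)
  have e : f.num * q = p * f.denom := (RatFunc.num_mul_eq_mul_denom_iff hq).2 hf
  have e1 := congrArg (fun r => Polynomial.coeff r (f.denom.natDegree + q.natDegree)) e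
  rw [Polynomial.coeff_mul_add_eq_of_natDegree_le hr le_rfl, add_comm,
    Polynomial.coeff_mul_add_eq_of_natDegree_le h le_rfl] at e1
  have hm : f.denom.coeff f.denom.natDegree = 1 := (RatFunc.monic_denom f)
  rw [hm, mul_one] at e1
  have hq' : q.coeff q.natDegree ≠ 0 := by simpa using hq
  rw [eq_div_iff hq']
  exact e1

lemma isRegularAt_mul {z : OnePoint ℂ} {f g : RatFunc ℂ} (hf : IsRegularAt z f)
    (hg : IsRegularAt z g) : IsRegularAt z (f * g) := by
  rw [← f.num_div_denom, ← g.num_div_denom, div_mul_div_comm, ← map_mul, ← map_mul]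
  induction z using OnePoint.rec with
  | infty =>
    rw [isRegularAt_infty_iff] at hf hg
    refine isRegularAt_infty_of_div _ _ (mul_ne_zero f.denom_ne_zero g.denom_ne_zero) ?_
    rw [Polynomial.natDegree_mul f.denom_ne_zero g.denom_ne_zero]
    exact Polynomial.natDegree_mul_le.trans (by omega)
  | coe a =>
    rw [isRegularAt_coe_iff] at hf hg
    exact isRegularAt_coe_of_div _ _ _ (by simp [hf, hg])

lemma value_mul {z : OnePoint ℂ} {f g : RatFunc ℂ} (hf : IsRegularAt z f)
    (hg : IsRegularAt z g) : value z (f * g) = value z f * value z g := by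
  induction z using OnePoint.rec with
  | infty =>
    rw [isRegularAt_infty_iff] at hf hg
    have hd := mul_ne_zero f.denom_ne_zero g.denom_ne_zero
    conv_lhs => rw [← f.num_div_denom, ← g.num_div_denom, div_mul_div_comm, ← map_mul, ← map_mul]
    rw [value_infty_of_div _ _ hd, Polynomial.natDegree_mul f.denom_ne_zero g.denom_ne_zero,
      Polynomial.coeff_mul_add_eq_of_natDegree_le hf hg,
      Polynomial.coeff_mul_add_eq_of_natDegree_le le_rfl le_rfl]
    · have h1 : f.denom.coeff f.denom.natDegree = 1 := RatFunc.monic_denom f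
      have h2 : g.denom.coeff g.denom.natDegree = 1 := RatFunc.monic_denom g
      rw [h1, h2]; simp [value]
    · rw [Polynomial.natDegree_mul f.denom_ne_zero g.denom_ne_zero]
      exact Polynomial.natDegree_mul_le.trans (by omega)
  | coe a => exact RatFunc.eval_mul (f := RingHom.id ℂ) (a := a) hf hg

lemma isRegularAt_add {z : OnePoint ℂ} {f g : RatFunc ℂ} (hf : IsRegularAt z f)
    (hg : IsRegularAt z g) : IsRegularAt z (f + g) := by
  have hd := mul_ne_zero f.denom_ne_zero g.denom_ne_zero
  rw [← f.num_div_denom, ← g.num_div_denom,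
    div_add_div _ _ (by simpa using f.denom_ne_zero) (by simpa using g.denom_ne_zero)]
  simp only [← map_mul, ← map_add]
  induction z using OnePoint.rec with
  | infty =>
    rw [isRegularAt_infty_iff] at hf hg
    refine isRegularAt_infty_of_div _ _ hd ?_
    rw [Polynomial.natDegree_mul f.denom_ne_zero g.denom_ne_zero]
    exact Polynomial.natDegree_add_le_of_degree_le
      (Polynomial.natDegree_mul_le.trans (by omega)) (Polynomial.natDegree_mul_le.trans (by omega))
  | coe a =>
    rw [isRegularAt_coe_iff] at hf hg
    exact isRegularAt_coe_of_div _ _ _ (by simp [hf, hg])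

lemma value_add {z : OnePoint ℂ} {f g : RatFunc ℂ} (hf : IsRegularAt z f)
    (hg : IsRegularAt z g) : value z (f + g) = value z f + value z g := by
  induction z using OnePoint.rec with
  | infty =>
    rw [isRegularAt_infty_iff] at hf hg
    have hd := mul_ne_zero f.denom_ne_zero g.denom_ne_zero
    conv_lhs => rw [← f.num_div_denom, ← g.num_div_denom,
      div_add_div _ _ (by simpa using f.denom_ne_zero) (by simpa using g.denom_ne_zero)]
    simp only [← map_mul, ← map_add]
    rw [value_infty_of_div _ _ hd, Polynomial.natDegree_mul f.denom_ne_zero g.denom_ne_zero,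
      Polynomial.coeff_add, Polynomial.coeff_mul_add_eq_of_natDegree_le hf le_rfl,
      Polynomial.coeff_mul_add_eq_of_natDegree_le le_rfl hg,
      Polynomial.coeff_mul_add_eq_of_natDegree_le le_rfl le_rfl]
    · have h1 : f.denom.coeff f.denom.natDegree = 1 := RatFunc.monic_denom f
      have h2 : g.denom.coeff g.denom.natDegree = 1 := RatFunc.monic_denom g
      rw [h1, h2]; simp [value]
    · rw [Polynomial.natDegree_mul f.denom_ne_zero g.denom_ne_zero]
      exact Polynomial.natDegree_add_le_of_degree_le
        (Polynomial.natDegree_mul_le.trans (by omega)) (Polynomial.natDegree_mul_le.trans (by omega))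
  | coe a => exact RatFunc.eval_add (f := RingHom.id ℂ) (a := a) hf hg

lemma isRegularAt_C (z : OnePoint ℂ) (c : ℂ) : IsRegularAt z (RatFunc.C c) := by
  induction z using OnePoint.rec with
  | infty => exact (RatFunc.intDegree_C c).le
  | coe a => simp [isRegularAt_coe_iff]

lemma value_C (z : OnePoint ℂ) (c : ℂ) : value z (RatFunc.C c) = c := by
  induction z using OnePoint.rec with
  | infty => simp [value]
  | coe a => simp [value]

lemma eq_C_of_forall_isRegularAt {f : RatFunc ℂ} (h : ∀ z, IsRegularAt z f) :
    ∃ c, f = RatFunc.C c := by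
  have h1 : f.denom.natDegree = 0 := by
    by_contra h0
    obtain ⟨a, ha⟩ := Complex.exists_root (f := f.denom)
      (Polynomial.natDegree_pos_iff_degree_pos.1 (Nat.pos_of_ne_zero h0))
    exact h a ha
  have h2 := (isRegularAt_infty_iff f).1 (h ∞)
  have hd : f.denom = 1 := (Polynomial.Monic.natDegree_eq_zero (RatFunc.monic_denom f)).1 h1
  have hn := Polynomial.eq_C_of_natDegree_le_zero (h1 ▸ h2)
  refine ⟨f.num.coeff 0, ?_⟩
  conv_lhs => rw [← f.num_div_denom, hd, hn]
  simp

/-- `u` is a coordinate with pole `P`: it is regular away from `P` and has a simple pole at `P`. -/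
structure IsCoord (P : OnePoint ℂ) (u : RatFunc ℂ) : Prop where
  regular : ∀ z, z ≠ P → IsRegularAt z u
  pole : ¬ IsRegularAt P u
  simple : ∀ f, IsRegularAt P f → value P f = 0 → IsRegularAt P (u * f)

lemma IsCoord.affine {P : OnePoint ℂ} {u : RatFunc ℂ} (hu : IsCoord P u) {b : ℂ} (hb : b ≠ 0)
    (c : ℂ) : IsCoord P (RatFunc.C b * u + RatFunc.C c) where
  regular z hz := isRegularAt_add (isRegularAt_mul (isRegularAt_C _ _) (hu.regular z hz))
    (isRegularAt_C _ _)
  pole h := by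
    apply hu.pole
    have h1 := isRegularAt_mul (isRegularAt_C P b⁻¹) (isRegularAt_add h (isRegularAt_C P (-c)))
    convert h1 using 1
    have : RatFunc.C b ≠ 0 := by simpa using hb
    simp only [map_inv₀, map_neg]
    field_simp
    ring
  simple f hf h0 := by
    rw [add_mul, mul_assoc]
    exact isRegularAt_add (isRegularAt_mul (isRegularAt_C _ _) (hu.simple f hf h0))
      (isRegularAt_mul (isRegularAt_C _ _) hf)

/-- A coordinate with pole `P`: `X` if `P = ∞`, and `1 / (X - a)` if `P = a`. -/
def stdCoord (P : OnePoint ℂ) : RatFunc ℂ :=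
  P.elim RatFunc.X (fun a => (RatFunc.X - RatFunc.C a)⁻¹)

lemma X_sub_C_eq (a : ℂ) : (RatFunc.X - RatFunc.C a : RatFunc ℂ) =
    algebraMap ℂ[X] (RatFunc ℂ) (Polynomial.X - Polynomial.C a) := by simp

lemma X_sub_C_ne_zero (a : ℂ) : (RatFunc.X - RatFunc.C a : RatFunc ℂ) ≠ 0 := by
  rw [X_sub_C_eq]
  exact RatFunc.algebraMap_ne_zero (Polynomial.X_sub_C_ne_zero a)

lemma stdCoord_coe (a : ℂ) : stdCoord (a : OnePoint ℂ) =
    algebraMap ℂ[X] (RatFunc ℂ) 1 / algebraMap ℂ[X] (RatFunc ℂ) (Polynomial.X - Polynomial.C a) := by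
  rw [← X_sub_C_eq, map_one, one_div]; rfl

lemma stdCoord_infty : stdCoord ∞ =
    algebraMap ℂ[X] (RatFunc ℂ) Polynomial.X / algebraMap ℂ[X] (RatFunc ℂ) 1 := by
  simp [stdCoord]

lemma isCoord_stdCoord (P : OnePoint ℂ) : IsCoord P (stdCoord P) := by
  induction P using OnePoint.rec with
  | infty =>
    refine ⟨fun z hz => ?_, ?_, fun f hf h0 => ?_⟩
    · induction z using OnePoint.rec with
      | infty => exact absurd rfl hz
      | coe a => rw [stdCoord_infty]; exact isRegularAt_coe_of_div _ _ _ (by simp)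
    · intro h
      change RatFunc.intDegree (RatFunc.X) ≤ 0 at h
      simp at h
    · rw [isRegularAt_infty_iff] at hf
      change f.num.coeff f.denom.natDegree = 0 at h0
      rw [← f.num_div_denom, stdCoord_infty, div_mul_div_comm, ← map_mul, ← map_mul, one_mul]
      refine isRegularAt_infty_of_div _ _ f.denom_ne_zero ?_
      by_cases hn : f.num = 0
      · simp [hn]
      · have : f.num.natDegree ≠ f.denom.natDegree := by
          intro h; rw [← h] at h0; exact hn (Polynomial.leadingCoeff_eq_zero.1 h0)
        rw [Polynomial.natDegree_X_mul hn]; omega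
  | coe a =>
    refine ⟨fun z hz => ?_, ?_, fun f hf h0 => ?_⟩
    · rw [stdCoord_coe]
      induction z using OnePoint.rec with
      | infty => exact isRegularAt_infty_of_div _ _ (Polynomial.X_sub_C_ne_zero a) (by simp)
      | coe b =>
        refine isRegularAt_coe_of_div _ _ _ ?_
        simpa [sub_eq_zero] using fun h : b = a => hz (by rw [h])
    · intro h
      have h1 : IsRegularAt a (RatFunc.X - RatFunc.C a) := by
        rw [X_sub_C_eq, isRegularAt_coe_iff, RatFunc.denom_algebraMap]; simp
      have h2 : value a (RatFunc.X - RatFunc.C a) = 0 := by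
        rw [X_sub_C_eq]; simp only [value, OnePoint.elim_some, RatFunc.eval_algebraMap]; simp
      have h3 := value_mul h h1
      have h4 : stdCoord (a : OnePoint ℂ) * (RatFunc.X - RatFunc.C a) = RatFunc.C 1 := by
        change (RatFunc.X - RatFunc.C a)⁻¹ * _ = _
        rw [inv_mul_cancel₀ (X_sub_C_ne_zero a), map_one]
      rw [h4, h2, value_C] at h3
      simp at h3
    · rw [isRegularAt_coe_iff] at hf
      have h1 : f.num.eval a = 0 := by
        change RatFunc.eval _ _ _ = 0 at h0
        simpa [RatFunc.eval, Polynomial.eval₂_id, hf] using h0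
      obtain ⟨p, hp⟩ := Polynomial.dvd_iff_isRoot.2 h1
      have : stdCoord (a : OnePoint ℂ) * f =
          algebraMap ℂ[X] (RatFunc ℂ) p / algebraMap ℂ[X] (RatFunc ℂ) f.denom := by
        conv_lhs => rw [← f.num_div_denom, hp]
        change (RatFunc.X - RatFunc.C a)⁻¹ * _ = _
        rw [map_mul, ← X_sub_C_eq]
        have := X_sub_C_ne_zero a
        field_simp
      rw [this]
      exact isRegularAt_coe_of_div _ _ _ hf

lemma IsCoord.eq_affine {P : OnePoint ℂ} {u s : RatFunc ℂ} (hu : IsCoord P u) (hs : IsCoord P s)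
    (hs' : IsRegularAt P s⁻¹) (h0 : value P s⁻¹ = 0) :
    ∃ b c : ℂ, b ≠ 0 ∧ u = RatFunc.C b * s + RatFunc.C c := by
  have hs0 : s ≠ 0 := by
    rintro rfl
    exact hs.pole (by simpa using isRegularAt_C P 0)
  have h1 := hu.simple _ hs' h0
  set b := value P (u * s⁻¹) with hb
  have h2 : IsRegularAt P (u * s⁻¹ + RatFunc.C (-b)) := isRegularAt_add h1 (isRegularAt_C _ _)
  have h3 : value P (u * s⁻¹ + RatFunc.C (-b)) = 0 := by
    rw [value_add h1 (isRegularAt_C _ _), value_C, ← hb]; ring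
  have h4 := hs.simple _ h2 h3
  have h5 : s * (u * s⁻¹ + RatFunc.C (-b)) = u + RatFunc.C (-b) * s := by field_simp
  rw [h5] at h4
  obtain ⟨c, hc⟩ := eq_C_of_forall_isRegularAt (f := u + RatFunc.C (-b) * s) fun z => by
    by_cases hz : z = P
    · exact hz ▸ h4
    · exact isRegularAt_add (hu.regular z hz)
        (isRegularAt_mul (isRegularAt_C _ _) (hs.regular z hz))
  have e : u = RatFunc.C b * s + RatFunc.C c := by rw [← hc, map_neg]; ring
  refine ⟨b, c, fun h => hu.pole ?_, e⟩
  rw [e, h, map_zero, zero_mul, zero_add]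
  exact isRegularAt_C _ _

lemma stdCoord_inv (P : OnePoint ℂ) :
    IsRegularAt P (stdCoord P)⁻¹ ∧ value P (stdCoord P)⁻¹ = 0 := by
  induction P using OnePoint.rec with
  | infty =>
    have : (stdCoord ∞)⁻¹ = algebraMap ℂ[X] (RatFunc ℂ) 1 /
        algebraMap ℂ[X] (RatFunc ℂ) Polynomial.X := by
      rw [stdCoord_infty, inv_div]
    rw [this]
    refine ⟨isRegularAt_infty_of_div _ _ Polynomial.X_ne_zero (by simp), ?_⟩
    rw [value_infty_of_div _ _ Polynomial.X_ne_zero (by simp)]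
    simp [Polynomial.coeff_one]
  | coe a =>
    have : (stdCoord (a : OnePoint ℂ))⁻¹ =
        algebraMap ℂ[X] (RatFunc ℂ) (Polynomial.X - Polynomial.C a) := by
      rw [stdCoord_coe, inv_div, map_one, div_one]
    rw [this]
    refine ⟨by rw [isRegularAt_coe_iff, RatFunc.denom_algebraMap]; simp, ?_⟩
    simp only [value, OnePoint.elim_some, RatFunc.eval_algebraMap]; simp

lemma value_stdCoord_infty (a : ℂ) : value a (stdCoord ∞) = a := by
  simp [value, stdCoord]

lemma value_stdCoord_coe (a b : ℂ) (h : b ≠ a) :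
    value b (stdCoord (a : OnePoint ℂ)) = (b - a)⁻¹ := by
  have h0 : (b - a) ≠ 0 := sub_ne_zero.2 h
  have h1 : IsRegularAt b (stdCoord (a : OnePoint ℂ)) :=
    (isCoord_stdCoord a).regular _ (by simpa using h)
  have h2 : IsRegularAt b (RatFunc.X - RatFunc.C a) := by
    rw [X_sub_C_eq, isRegularAt_coe_iff, RatFunc.denom_algebraMap]; simp
  have h3 : value b (RatFunc.X - RatFunc.C a) = b - a := by
    rw [X_sub_C_eq]; simp only [value, OnePoint.elim_some, RatFunc.eval_algebraMap]; simp
  have h4 : stdCoord (a : OnePoint ℂ) * (RatFunc.X - RatFunc.C a) = RatFunc.C 1 := by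
    change (RatFunc.X - RatFunc.C a)⁻¹ * _ = _
    rw [inv_mul_cancel₀ (X_sub_C_ne_zero a), map_one]
  have h5 := value_mul h1 h2
  rw [h4, value_C, h3] at h5
  exact eq_inv_of_mul_eq_one_left h5.symm

lemma value_infty_stdCoord_coe (a : ℂ) : value ∞ (stdCoord (a : OnePoint ℂ)) = 0 := by
  rw [stdCoord_coe, value_infty_of_div _ _ (Polynomial.X_sub_C_ne_zero a) (by simp)]
  simp [Polynomial.coeff_one]

/-- If `u` is a coordinate with pole `P` and `z ≠ P`, then `1 / (u - u(z))` is a coordinate with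
pole `z`, and it vanishes at `P`. -/
lemma IsCoord.kernel {P z : OnePoint ℂ} {u : RatFunc ℂ} (hu : IsCoord P u) (hz : z ≠ P) :
    IsCoord z (u - RatFunc.C (value z u))⁻¹ ∧ value P (u - RatFunc.C (value z u))⁻¹ = 0 := by
  have hs := isCoord_stdCoord P
  obtain ⟨b, c, hb, e⟩ := hu.eq_affine hs (stdCoord_inv P).1 (stdCoord_inv P).2
  suffices H : IsCoord z (stdCoord P - RatFunc.C (value z (stdCoord P)))⁻¹ ∧
      value P (stdCoord P - RatFunc.C (value z (stdCoord P)))⁻¹ = 0 by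
    have e1 : (u - RatFunc.C (value z u))⁻¹ =
        RatFunc.C b⁻¹ * (stdCoord P - RatFunc.C (value z (stdCoord P)))⁻¹ + RatFunc.C 0 := by
      have r := hs.regular z hz
      rw [e, value_add (isRegularAt_mul (isRegularAt_C _ _) r) (isRegularAt_C _ _),
        value_mul (isRegularAt_C _ _) r, value_C, value_C, map_zero, add_zero, map_inv₀,
        ← mul_inv, map_add, map_mul]
      congr 1; ring
    rw [e1]
    refine ⟨H.1.affine (inv_ne_zero hb) 0, ?_⟩
    have r := H.1.regular P hz.symm
    rw [value_add (isRegularAt_mul (isRegularAt_C _ _) r) (isRegularAt_C _ _),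
      value_mul (isRegularAt_C _ _) r, H.2, value_C, mul_zero, value_C, add_zero]
  induction P using OnePoint.rec with
  | infty =>
    induction z using OnePoint.rec with
    | infty => exact absurd rfl hz
    | coe a =>
      rw [value_stdCoord_infty]
      exact ⟨isCoord_stdCoord a, value_infty_stdCoord_coe a⟩
  | coe a =>
    induction z using OnePoint.rec with
    | infty =>
      rw [value_infty_stdCoord_coe, map_zero, sub_zero]
      have : (stdCoord (a : OnePoint ℂ))⁻¹ = RatFunc.C 1 * stdCoord ∞ + RatFunc.C (-a) := by
        simp [stdCoord, sub_eq_add_neg]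
      refine ⟨?_, (stdCoord_inv _).2⟩
      rw [this]
      exact (isCoord_stdCoord ∞).affine one_ne_zero _
    | coe b =>
      have hba : b ≠ a := fun h => hz (by rw [h])
      have h0 : b - a ≠ 0 := sub_ne_zero.2 hba
      have hC : (RatFunc.C b - RatFunc.C a : RatFunc ℂ) ≠ 0 := by
        rw [← map_sub]; exact (map_ne_zero RatFunc.C).2 h0
      have hXa := X_sub_C_ne_zero a
      have hXb := X_sub_C_ne_zero b
      have e1 : (stdCoord (a : OnePoint ℂ) - RatFunc.C (value b (stdCoord (a : OnePoint ℂ))))⁻¹ =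
          RatFunc.C (-(b - a) ^ 2) * stdCoord (b : OnePoint ℂ) + RatFunc.C (-(b - a)) := by
        rw [value_stdCoord_coe a b hba]
        change ((RatFunc.X - RatFunc.C a)⁻¹ - _)⁻¹ = _ * (RatFunc.X - RatFunc.C b)⁻¹ + _
        simp only [map_inv₀, map_sub, map_neg, map_pow]
        have : (RatFunc.X - RatFunc.C a : RatFunc ℂ)⁻¹ - (RatFunc.C b - RatFunc.C a)⁻¹ =
            -(RatFunc.X - RatFunc.C b) / ((RatFunc.X - RatFunc.C a) * (RatFunc.C b - RatFunc.C a)) := by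
          field_simp; ring
        rw [this, inv_div]
        field_simp; ring
      rw [e1]
      have hne : (a : OnePoint ℂ) ≠ b := hz.symm
      have r := (isCoord_stdCoord (b : OnePoint ℂ)).regular a hne
      refine ⟨(isCoord_stdCoord b).affine (neg_ne_zero.2 (pow_ne_zero 2 h0)) _, ?_⟩
      rw [value_add (isRegularAt_mul (isRegularAt_C _ _) r) (isRegularAt_C _ _),
        value_mul (isRegularAt_C _ _) r, value_C, value_C, value_stdCoord_coe b a hba.symm]
      have h1 : a - b ≠ 0 := sub_ne_zero.2 hba.symm
      field_simp; ring


/-- The algebra of rational functions that are regular at every point of `Y`. -/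
def regFun (Y : Set (OnePoint ℂ)) : Subalgebra ℂ (RatFunc ℂ) where
  carrier := {f | ∀ z ∈ Y, IsRegularAt z f}
  mul_mem' hf hg z hz := isRegularAt_mul (hf z hz) (hg z hz)
  add_mem' hf hg z hz := isRegularAt_add (hf z hz) (hg z hz)
  algebraMap_mem' c z _ := by
    have := isRegularAt_C z c
    rwa [← RatFunc.algebraMap_eq_C] at this

variable {Y Y' : Set (OnePoint ℂ)} {P z : OnePoint ℂ}

/-- Evaluation at a point `z ∈ Y`. -/
def evalFun (hz : z ∈ Y) : regFun Y →ₐ[ℂ] ℂ where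
  toFun f := value z f.1
  map_one' := by simpa using value_C z 1
  map_mul' f g := value_mul (f.2 z hz) (g.2 z hz)
  map_zero' := by simpa using value_C z 0
  map_add' f g := value_add (f.2 z hz) (g.2 z hz)
  commutes' c := by
    have := value_C z c
    rwa [← RatFunc.algebraMap_eq_C] at this

/-- A function regular on `Y` is regular on any `Y' ⊆ Y`. -/
def resFun (h : Y' ⊆ Y) : regFun Y →ₐ[ℂ] regFun Y' :=
  Subalgebra.inclusion fun _ hf z hz => hf z (h hz)

/-- The maximal ideal of the local ring at `z`. -/
def maxIdeal (z : OnePoint ℂ) : Ideal (regFun {z}) :=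
  RingHom.ker (evalFun (Set.mem_singleton z))

/-- The cotangent line `K_z` at `z`: the maximal ideal of the local ring modulo its square. -/
abbrev Cotan (z : OnePoint ℂ) : Type := (maxIdeal z).Cotangent

/-- The differential `f ↦ df_z`. -/
def dFun (hz : z ∈ Y) : regFun Y →ₗ[ℂ] Cotan z where
  toFun f := (maxIdeal z).toCotangent
    ⟨resFun (Set.singleton_subset_iff.2 hz) f - algebraMap ℂ _ (evalFun hz f), by
      rw [maxIdeal, RingHom.mem_ker, map_sub, AlgHom.commutes]
      exact sub_self (value z f.1)⟩
  map_add' f g := by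
    rw [← map_add]; congr 1; ext1
    simp only [map_add, Submodule.coe_add]; abel_nf
  map_smul' c f := by
    rw [RingHom.id_apply]
    have : ∀ m : maxIdeal z, c • (maxIdeal z).toCotangent m = (maxIdeal z).toCotangent (c • m) :=
      fun m => rfl
    rw [this]; congr 1; ext1
    simp only [Submodule.coe_smul_of_tower, map_mul, Algebra.smul_def, AlgHom.commutes, mul_sub]
    rfl

lemma dFun_mul (hz : z ∈ Y) (f g : regFun Y) :
    dFun hz (f * g) = evalFun hz f • dFun hz g + evalFun hz g • dFun hz f := by
  have : ∀ (c : ℂ) (m : maxIdeal z),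
      c • (maxIdeal z).toCotangent m = (maxIdeal z).toCotangent (c • m) := fun c m => rfl
  simp only [dFun, LinearMap.coe_mk, AddHom.coe_mk, this]
  rw [← map_add, Ideal.toCotangent_eq]
  simp only [map_mul, Submodule.coe_add, Submodule.coe_smul_of_tower, Algebra.smul_def]
  set F := resFun (Set.singleton_subset_iff.2 hz) f
  set G := resFun (Set.singleton_subset_iff.2 hz) g
  set a := algebraMap ℂ (regFun {z}) (evalFun hz f)
  set b := algebraMap ℂ (regFun {z}) (evalFun hz g)
  have h1 : F - a ∈ maxIdeal z := by
    rw [maxIdeal, RingHom.mem_ker, map_sub, AlgHom.commutes]; exact sub_self (value z f.1)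
  have h2 : G - b ∈ maxIdeal z := by
    rw [maxIdeal, RingHom.mem_ker, map_sub, AlgHom.commutes]; exact sub_self (value z g.1)
  have h3 := Ideal.mul_mem_mul h1 h2
  rw [← pow_two] at h3
  convert h3 using 1
  ring

/-- Coordinates with pole `P`. -/
structure Coord (P : OnePoint ℂ) where
  fn : RatFunc ℂ
  isCoord : IsCoord P fn

namespace Coord
variable (u : Coord P)

/-- The value `u(z)`. -/
def val (z : OnePoint ℂ) : ℂ := value z u.fn

/-- The cotangent vector `du_z`. -/
def d (hz : z ≠ P) : Cotan z :=
  dFun (Set.mem_singleton z) ⟨u.fn, fun w hw => u.isCoord.regular w (by rwa [hw])⟩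

/-- The function `1 / (u - u(z))`. -/
def ker (hz : z ≠ P) (hY : z ∉ Y) : regFun Y :=
  ⟨(u.fn - RatFunc.C (u.val z))⁻¹,
    fun w hw => (u.isCoord.kernel hz).1.regular w (by rintro rfl; exact hY hw)⟩

/-- The difference quotient `f ↦ (f - f(z)) / (u - u(z))`. -/
def diffQuot (hz : z ∈ Y) (hzP : z ≠ P) : regFun Y →ₗ[ℂ] regFun Y where
  toFun f := ⟨(u.fn - RatFunc.C (u.val z))⁻¹ * (f.1 - RatFunc.C (value z f.1)), fun w hw => by
    have h1 : IsRegularAt w (f.1 - RatFunc.C (value z f.1)) := by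
      rw [sub_eq_add_neg, ← map_neg]; exact isRegularAt_add (f.2 w hw) (isRegularAt_C _ _)
    have hk := (u.isCoord.kernel hzP).1
    by_cases hwz : w = z
    · subst hwz
      refine hk.simple _ h1 ?_
      rw [sub_eq_add_neg, ← map_neg, value_add (f.2 w hw) (isRegularAt_C _ _), value_C,
        add_neg_cancel]
    · exact isRegularAt_mul (hk.regular w hwz) h1⟩
  map_add' f g := by
    ext1
    have : value z (f.1 + g.1) = value z f.1 + value z g.1 := value_add (f.2 z hz) (g.2 z hz)
    simp only [Subalgebra.coe_add, this, map_add]; ring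
  map_smul' c f := by
    ext1
    have : value z (RatFunc.C c * f.1) = c * value z f.1 := by
      rw [value_mul (isRegularAt_C _ _) (f.2 z hz), value_C]
    simp only [Subalgebra.coe_smul, RingHom.id_apply, RatFunc.smul_eq_C_mul, this, map_mul]; ring

lemma diffQuot_mul (hz : z ∈ Y) (hzP : z ≠ P) (f g : regFun Y) :
    u.diffQuot hz hzP (f * g) = u.diffQuot hz hzP f * g + evalFun hz f • u.diffQuot hz hzP g := by
  ext1
  have : value z (f.1 * g.1) = value z f.1 * value z g.1 := value_mul (f.2 z hz) (g.2 z hz)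
  simp only [diffQuot, evalFun, LinearMap.coe_mk, AddHom.coe_mk, Subalgebra.coe_add,
    Subalgebra.coe_mul, Subalgebra.coe_smul, this, RatFunc.smul_eq_C_mul, AlgHom.coe_mk,
    RingHom.coe_mk, MonoidHom.coe_mk, OneHom.coe_mk, map_mul]
  ring

lemma evalFun_diffQuot (hz : z ∈ Y) (hzP : z ≠ P) (hP : P ∈ Y) (f : regFun Y) :
    evalFun hP (u.diffQuot hz hzP f) = 0 := by
  change value P ((u.fn - RatFunc.C (u.val z))⁻¹ * (f.1 - RatFunc.C (value z f.1))) = 0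
  have h1 : IsRegularAt P (f.1 - RatFunc.C (value z f.1)) := by
    rw [sub_eq_add_neg, ← map_neg]; exact isRegularAt_add (f.2 P hP) (isRegularAt_C _ _)
  have hk := u.isCoord.kernel hzP
  change value P ((u.fn - RatFunc.C (value z u.fn))⁻¹ * _) = 0
  rw [value_mul (hk.1.regular P hzP.symm) h1]
  rw [hk.2, zero_mul]

end Coord

section Lie
variable (𝔤 : Type*) [LieRing 𝔤] [LieAlgebra ℂ 𝔤]

/-- The Lie algebra of rational maps to `𝔤` that are regular on `Y`, with the pointwise bracket. -/
def Cur (Y : Set (OnePoint ℂ)) := regFun Y ⊗[ℂ] 𝔤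

instance : LieRing (Cur 𝔤 Y) := inferInstanceAs (LieRing (regFun Y ⊗[ℂ] 𝔤))
instance : LieAlgebra ℂ (Cur 𝔤 Y) := inferInstanceAs (LieAlgebra ℂ (regFun Y ⊗[ℂ] 𝔤))

variable {𝔤}
namespace Cur

/-- The map `f x`, for a scalar function `f` and `x : 𝔤`. -/
def tmul (f : regFun Y) (x : 𝔤) : Cur 𝔤 Y := f ⊗ₜ[ℂ] x

/-- A linear map out of `Cur 𝔤 Y` from a bilinear one. -/
def lift {N : Type*} [AddCommGroup N] [Module ℂ N] (b : regFun Y →ₗ[ℂ] 𝔤 →ₗ[ℂ] N) :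
    Cur 𝔤 Y →ₗ[ℂ] N :=
  TensorProduct.lift b

@[simp] lemma lift_tmul {N : Type*} [AddCommGroup N] [Module ℂ N]
    (b : regFun Y →ₗ[ℂ] 𝔤 →ₗ[ℂ] N) (f : regFun Y) (x : 𝔤) : lift b (tmul f x) = b f x := rfl

lemma lie_tmul (f g : regFun Y) (x y : 𝔤) :
    ⁅tmul f x, tmul g y⁆ = tmul (f * g) ⁅x, y⁆ := rfl

/-- `tmul` as a bilinear map. -/
def mk : regFun Y →ₗ[ℂ] 𝔤 →ₗ[ℂ] Cur 𝔤 Y := TensorProduct.mk ℂ (regFun Y) 𝔤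

lemma mk_apply (f : regFun Y) (x : 𝔤) : mk f x = tmul f x := rfl

@[elab_as_elim]
lemma induction {p : Cur 𝔤 Y → Prop} (α : Cur 𝔤 Y) (zero : p 0) (tmul : ∀ f x, p (tmul f x))
    (add : ∀ a b, p a → p b → p (a + b)) : p α :=
  TensorProduct.induction_on α zero tmul add

/-- The value `α(z)` for `z ∈ Y`. -/
def eval (hz : z ∈ Y) : Cur 𝔤 Y →ₗ⁅ℂ⁆ 𝔤 :=
  { lift ((LinearMap.lsmul ℂ 𝔤).comp (evalFun hz).toLinearMap) with
    map_lie' := by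
      intro α β
      simp only [AddHom.toFun_eq_coe, LinearMap.coe_toAddHom]
      induction α using induction with
      | zero => simp
      | add a b ha hb => simp [ha, hb]
      | tmul f x =>
        induction β using induction with
        | zero => simp
        | add a b ha hb => simp [ha, hb]
        | tmul g y => simp [lie_tmul, mul_smul, smul_comm (evalFun hz g)] }

lemma eval_tmul (hz : z ∈ Y) (f : regFun Y) (x : 𝔤) :
    eval hz (tmul f x) = evalFun hz f • x := rfl

/-- Change of functions. -/
def map (φ : regFun Y →ₐ[ℂ] regFun Y') : Cur 𝔤 Y →ₗ⁅ℂ⁆ Cur 𝔤 Y' :=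
  { lift (mk.comp φ.toLinearMap) with
    map_lie' := by
      intro α β
      simp only [AddHom.toFun_eq_coe, LinearMap.coe_toAddHom]
      induction α using induction with
      | zero => simp
      | add a b ha hb => simp [ha, hb]
      | tmul f x =>
        induction β using induction with
        | zero => simp
        | add a b ha hb => simp [ha, hb]
        | tmul g y => simp [lie_tmul, mk_apply] }

/-- The constant maps. -/
def const (Y : Set (OnePoint ℂ)) : 𝔤 →ₗ⁅ℂ⁆ Cur 𝔤 Y :=
  { mk 1 with
    map_lie' := by
      intro x y
      change tmul 1 ⁅x, y⁆ = ⁅tmul 1 x, tmul 1 y⁆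
      rw [lie_tmul, one_mul] }

end Cur

/-- The coefficient of `du_z` in `-[ε^v(z), α] + ε^[v, α(z)](z)`, where `ε^v(z) = v du_z / (u - u(z))`.
It equals `-[v, (α - α(z)) / (u - u(z))]`, so it is again regular at `z`. -/
def kerComm (u : Coord P) (hz : z ∈ Y) (hzP : z ≠ P) : 𝔤 →ₗ[ℂ] Cur 𝔤 Y →ₗ[ℂ] Cur 𝔤 Y :=
  LinearMap.mk₂ ℂ
    (fun v α => -Cur.lift (((Cur.mk (Y := Y) (𝔤 := 𝔤)).compl₂ (LieModule.toEnd ℂ 𝔤 𝔤 v)).comp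
      (u.diffQuot hz hzP)) α)
    (fun v w α => by
      induction α using Cur.induction with
      | zero => simp
      | add a b ha hb => simp only [map_add, neg_add] at *; rw [ha, hb]; abel
      | tmul f x => simp; abel)
    (fun c v α => by
      induction α using Cur.induction with
      | zero => simp
      | add a b ha hb => simp only [map_add, neg_add] at *; rw [ha, hb, smul_add]
      | tmul f x => simp)
    (fun v α β => by rw [map_add, neg_add])
    (fun c v α => by rw [map_smul, smul_neg])

lemma kerComm_tmul (u : Coord P) (hz : z ∈ Y) (hzP : z ≠ P) (v x : 𝔤) (f : regFun Y) :
    kerComm u hz hzP v (Cur.tmul f x) = -(Cur.tmul (u.diffQuot hz hzP f) ⁅v, x⁆) := rfl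

lemma kerComm_lie (u : Coord P) (hz : z ∈ Y) (hzP : z ≠ P) (v : 𝔤) (α β : Cur 𝔤 Y) :
    kerComm u hz hzP v ⁅α, β⁆ = ⁅α, kerComm u hz hzP v β⁆ + ⁅kerComm u hz hzP v α, β⁆ +
      kerComm u hz hzP ⁅v, Cur.eval hz α⁆ β - kerComm u hz hzP ⁅v, Cur.eval hz β⁆ α := by
  induction α using Cur.induction with
  | zero => simp
  | add a b ha hb => simp only [map_add, add_lie, lie_add, ha, hb, LinearMap.add_apply]; abel
  | tmul f x =>
    induction β using Cur.induction with
    | zero => simp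
    | add a b ha hb => simp only [map_add, lie_add, ha, hb, LinearMap.add_apply]; abel
    | tmul g y =>
      have h1 := u.diffQuot_mul hz hzP f g
      have h2 := u.diffQuot_mul hz hzP g f
      rw [mul_comm g f] at h2
      have h3 : ⁅v, ⁅x, y⁆⁆ = ⁅⁅v, x⁆, y⁆ + ⁅x, ⁅v, y⁆⁆ := leibniz_lie v x y
      have h4 : ⁅⁅v, y⁆, x⁆ = -⁅x, ⁅v, y⁆⁆ := (lie_skew _ _).symm
      simp only [Cur.lie_tmul, kerComm_tmul, Cur.eval_tmul, lie_smul, lie_neg, neg_lie, h3, h4,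
        map_smul, LinearMap.smul_apply]
      simp only [← Cur.mk_apply, map_add, map_neg]
      nth_rewrite 1 [h1]
      rw [h2]
      simp only [map_add, map_smul, LinearMap.add_apply, LinearMap.smul_apply, mul_comm f]
      module

/-- The pairing `(v, dα(z))` with values in `K_z`. -/
def pairD (κ : LinearMap.BilinForm ℂ 𝔤) (hz : z ∈ Y) : 𝔤 →ₗ[ℂ] Cur 𝔤 Y →ₗ[ℂ] Cotan z :=
  LinearMap.mk₂ ℂ
    (fun v α => Cur.lift (((LinearMap.lsmul ℂ (Cotan z)).flip.comp (dFun hz)).compl₂ (κ v)) α)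
    (fun v w α => by
      induction α using Cur.induction with
      | zero => simp
      | add a b ha hb => simp only [map_add] at *; rw [ha, hb]; abel
      | tmul f x => simp [add_smul])
    (fun c v α => by
      induction α using Cur.induction with
      | zero => simp
      | add a b ha hb => simp only [map_add] at *; rw [ha, hb, smul_add]
      | tmul f x => simp [mul_smul])
    (fun v α β => by rw [map_add])
    (fun c v α => by rw [map_smul])

lemma pairD_tmul (κ : LinearMap.BilinForm ℂ 𝔤) (hz : z ∈ Y) (v x : 𝔤) (f : regFun Y) :
    pairD κ hz v (Cur.tmul f x) = κ v x • dFun hz f := rfl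

lemma pairD_lie {κ : LinearMap.BilinForm ℂ 𝔤} (hκ : κ.lieInvariant 𝔤) (hz : z ∈ Y) (v : 𝔤)
    (α β : Cur 𝔤 Y) : pairD κ hz v ⁅α, β⁆ =
      pairD κ hz ⁅v, Cur.eval hz α⁆ β - pairD κ hz ⁅v, Cur.eval hz β⁆ α := by
  induction α using Cur.induction with
  | zero => simp
  | add a b ha hb => simp only [map_add, add_lie, lie_add, ha, hb, LinearMap.add_apply]; abel
  | tmul f x =>
    induction β using Cur.induction with
    | zero => simp
    | add a b ha hb => simp only [map_add, lie_add, ha, hb, LinearMap.add_apply]; abel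
    | tmul g y =>
      have h1 : κ ⁅v, x⁆ y = κ v ⁅x, y⁆ := by
        rw [← lie_skew, map_neg, LinearMap.neg_apply, hκ x v y, neg_neg]
      have h2 : κ ⁅v, y⁆ x = - κ v ⁅x, y⁆ := by
        rw [← lie_skew, map_neg, LinearMap.neg_apply, hκ y v x, neg_neg, ← lie_skew, map_neg]
      simp only [Cur.lie_tmul, pairD_tmul, Cur.eval_tmul, lie_smul,
        map_smul, LinearMap.smul_apply, h1, h2, dFun_mul]
      module

section Env
variable {L L' : Type*} [LieRing L] [LieAlgebra ℂ L] [LieRing L'] [LieAlgebra ℂ L']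

/-- The universal enveloping algebra. -/
abbrev Env (L : Type*) [LieRing L] [LieAlgebra ℂ L] := UniversalEnvelopingAlgebra ℂ L

namespace Env

attribute [local instance] LieRing.ofAssociativeRing

/-- The inclusion of the Lie algebra. -/
def of (x : L) : Env L := UniversalEnvelopingAlgebra.ι ℂ x

lemma of_add (x y : L) : of (x + y) = of x + of y := map_add (UniversalEnvelopingAlgebra.ι ℂ) x y
lemma of_sub (x y : L) : of (x - y) = of x - of y := map_sub (UniversalEnvelopingAlgebra.ι ℂ) x y
lemma of_smul (c : ℂ) (x : L) : of (c • x) = c • of x :=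
  map_smul (UniversalEnvelopingAlgebra.ι ℂ) c x
lemma of_lie (x y : L) : of ⁅x, y⁆ = of x * of y - of y * of x :=
  LieHom.map_lie (UniversalEnvelopingAlgebra.ι ℂ) x y

/-- Functoriality of the enveloping algebra. -/
def map (φ : L →ₗ⁅ℂ⁆ L') : Env L →ₐ[ℂ] Env L' :=
  UniversalEnvelopingAlgebra.lift ℂ ((UniversalEnvelopingAlgebra.ι ℂ).comp φ)

lemma map_of (φ : L →ₗ⁅ℂ⁆ L') (x : L) : map φ (of x) = of (φ x) :=
  UniversalEnvelopingAlgebra.lift_ι_apply ℂ _ x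

lemma induction {p : Env L → Prop} (x : Env L) (one : p 1) (add : ∀ a b, p a → p b → p (a + b))
    (smul : ∀ (c : ℂ) a, p a → p (c • a)) (mul : ∀ (l : L) a, p a → p (of l * a)) : p x := by
  obtain ⟨t, rfl⟩ : ∃ t, UniversalEnvelopingAlgebra.mkAlgHom ℂ L t = x := by
    exact RingCon.mkₐ_surjective (α := ℂ) _ x
  suffices H : ∀ (t : TensorAlgebra ℂ L) (a : Env L), p a →
      p (UniversalEnvelopingAlgebra.mkAlgHom ℂ L t * a) by
    simpa using H t 1 one
  intro t
  induction t using TensorAlgebra.induction with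
  | algebraMap r => intro a ha; rw [AlgHom.commutes, ← Algebra.smul_def]; exact smul r a ha
  | ι l => intro a ha; exact mul l a ha
  | mul s t hs ht => intro a ha; rw [map_mul, mul_assoc]; exact hs _ (ht _ ha)
  | add s t hs ht => intro a ha; rw [map_add, add_mul]; exact add _ _ (hs _ ha) (ht _ ha)

end Env
end Env

section Recursion

attribute [local instance] LieRing.ofAssociativeRing

variable {L M K : Type*} [LieRing L] [LieAlgebra ℂ L] [AddCommGroup M] [Module ℂ M]
  [Module (Env L) M] [IsScalarTower ℂ (Env L) M] [AddCommGroup K] [Module ℂ K]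

variable (M) in
/-- The action of an element of the enveloping algebra on a module, as a linear map. -/
def act (a : Env L) : M →ₗ[ℂ] M := Algebra.lsmul ℂ ℂ M a

lemma act_apply (a : Env L) (m : M) : act M a m = a • m := rfl

lemma act_add (a b : Env L) : act M (a + b) = act M a + act M b := map_add (Algebra.lsmul ℂ ℂ M) a b
lemma act_sub (a b : Env L) : act M (a - b) = act M a - act M b := map_sub (Algebra.lsmul ℂ ℂ M) a b
lemma act_smul (c : ℂ) (a : Env L) : act M (c • a) = c • act M a :=
  map_smul (Algebra.lsmul ℂ ℂ M) c a
lemma act_mul (a b : Env L) : act M (a * b) = act M a ∘ₗ act M b :=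
  map_mul (Algebra.lsmul ℂ ℂ M) a b

/-- One step of the recursion: from `m` and the `i_v(m)`, `v : 𝔤`, it forms `l m` and
`i_v(l m) = l i_v(m) + i_[v, ev l](m) + δ_v(l) m ⊗ k - m ⊗ c_v(l)`. -/
def recStep (ev : L →ₗ⁅ℂ⁆ 𝔤) (δ : 𝔤 →ₗ[ℂ] L →ₗ[ℂ] L) (c : 𝔤 →ₗ[ℂ] L →ₗ[ℂ] K) (k : K) (l : L) :
    (M × (𝔤 →ₗ[ℂ] M ⊗[ℂ] K)) →ₗ[ℂ] (M × (𝔤 →ₗ[ℂ] M ⊗[ℂ] K)) where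
  toFun n := (Env.of l • n.1,
    { toFun := fun v => (act M (Env.of l)).rTensor K (n.2 v) + n.2 ⁅v, ev l⁆ +
        ((Env.of (δ v l) • n.1) ⊗ₜ k - n.1 ⊗ₜ c v l)
      map_add' := fun v w => by
        simp only [map_add, add_lie, LinearMap.add_apply, Env.of_add, add_smul,
          TensorProduct.add_tmul, TensorProduct.tmul_add]
        abel
      map_smul' := fun a v => by
        simp only [map_smul, smul_lie, LinearMap.smul_apply, Env.of_smul, smul_assoc,
          TensorProduct.smul_tmul', TensorProduct.tmul_smul, RingHom.id_apply, smul_add, smul_sub] })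
  map_add' m n := by
    ext v
    · simp
    · simp only [Prod.fst_add, Prod.snd_add, LinearMap.add_apply, map_add, smul_add,
        TensorProduct.add_tmul, LinearMap.coe_mk, AddHom.coe_mk]
      abel
  map_smul' a m := by
    ext v
    · simp only [Prod.smul_fst, RingHom.id_apply]; exact smul_comm _ _ _
    · simp only [Prod.smul_fst, Prod.smul_snd, LinearMap.smul_apply, map_smul,
        RingHom.id_apply, LinearMap.coe_mk, AddHom.coe_mk, smul_comm (Env.of _) a,
        TensorProduct.smul_tmul', smul_add, smul_sub]

lemma recStep_fst (ev : L →ₗ⁅ℂ⁆ 𝔤) (δ : 𝔤 →ₗ[ℂ] L →ₗ[ℂ] L) (c : 𝔤 →ₗ[ℂ] L →ₗ[ℂ] K) (k : K) (l : L)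
    (n : M × (𝔤 →ₗ[ℂ] M ⊗[ℂ] K)) : (recStep ev δ c k l n).1 = Env.of l • n.1 := rfl

lemma recStep_snd (ev : L →ₗ⁅ℂ⁆ 𝔤) (δ : 𝔤 →ₗ[ℂ] L →ₗ[ℂ] L) (c : 𝔤 →ₗ[ℂ] L →ₗ[ℂ] K) (k : K) (l : L)
    (n : M × (𝔤 →ₗ[ℂ] M ⊗[ℂ] K)) (v : 𝔤) : (recStep ev δ c k l n).2 v =
      (act M (Env.of l)).rTensor K (n.2 v) + n.2 ⁅v, ev l⁆ +
        ((Env.of (δ v l) • n.1) ⊗ₜ k - n.1 ⊗ₜ c v l) := rfl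

lemma exists_rec (ev : L →ₗ⁅ℂ⁆ 𝔤) (δ : 𝔤 →ₗ[ℂ] L →ₗ[ℂ] L) (c : 𝔤 →ₗ[ℂ] L →ₗ[ℂ] K) (k : K)
    (hδ : ∀ v α β, δ v ⁅α, β⁆ = ⁅α, δ v β⁆ + ⁅δ v α, β⁆ + δ ⁅v, ev α⁆ β - δ ⁅v, ev β⁆ α)
    (hc : ∀ v α β, c v ⁅α, β⁆ = c ⁅v, ev α⁆ β - c ⁅v, ev β⁆ α) :
    ∃ F : Env L →ₐ[ℂ] Module.End ℂ (M × (𝔤 →ₗ[ℂ] M ⊗[ℂ] K)),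
      ∀ l n, F (Env.of l) n = recStep ev δ c k l n := by
  let R : L →ₗ⁅ℂ⁆ Module.End ℂ (M × (𝔤 →ₗ[ℂ] M ⊗[ℂ] K)) :=
    { toFun := recStep ev δ c k
      map_add' := fun α β => by
        refine LinearMap.ext fun n => Prod.ext ?_ (LinearMap.ext fun v => ?_)
        · simp only [recStep_fst, LinearMap.add_apply, Prod.fst_add, Env.of_add, add_smul]
        · simp only [recStep_snd, LinearMap.add_apply, Prod.snd_add, Env.of_add, add_smul, act_add,
            LinearMap.rTensor_add, map_add, lie_add, TensorProduct.add_tmul, TensorProduct.tmul_add]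
          abel
      map_smul' := fun a α => by
        refine LinearMap.ext fun n => Prod.ext ?_ (LinearMap.ext fun v => ?_)
        · simp only [recStep_fst, LinearMap.smul_apply, Prod.smul_fst, Env.of_smul, smul_assoc,
            RingHom.id_apply]
        · simp only [recStep_snd, LinearMap.smul_apply, Prod.smul_snd, Env.of_smul, smul_assoc,
            act_smul, LinearMap.rTensor_smul, map_smul, lie_smul, TensorProduct.smul_tmul',
            TensorProduct.tmul_smul, RingHom.id_apply, smul_add, smul_sub]
      map_lie' := by
        intro α β
        refine LinearMap.ext fun n => Prod.ext ?_ (LinearMap.ext fun v => ?_)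
        · change _ = (recStep ev δ c k α (recStep ev δ c k β n) -
            recStep ev δ c k β (recStep ev δ c k α n)).1
          simp only [recStep_fst, Prod.fst_sub, Env.of_lie, sub_smul, mul_smul]
        · change _ = (recStep ev δ c k α (recStep ev δ c k β n) -
            recStep ev δ c k β (recStep ev δ c k α n)).2 v
          have h1 : ⁅v, ev ⁅α, β⁆⁆ = ⁅⁅v, ev α⁆, ev β⁆ - ⁅⁅v, ev β⁆, ev α⁆ := by
            rw [LieHom.map_lie, leibniz_lie, ← lie_skew ⁅v, ev β⁆ (ev α), sub_neg_eq_add]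
          simp only [recStep_fst, recStep_snd, Prod.snd_sub,
            LinearMap.sub_apply, h1, map_sub, map_add, Env.of_lie, Env.of_add, Env.of_sub, sub_smul,
            add_smul, mul_smul, act_sub, act_mul, LinearMap.rTensor_sub, LinearMap.rTensor_comp,
            LinearMap.comp_apply, LinearMap.rTensor_tmul, act_apply, hδ, hc,
            TensorProduct.add_tmul, TensorProduct.sub_tmul, TensorProduct.tmul_sub]
          abel }
  exact ⟨UniversalEnvelopingAlgebra.lift ℂ R, fun l n => by
    rw [Env.of, UniversalEnvelopingAlgebra.lift_ι_apply]; rfl⟩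

end Recursion

/-- The left ideal of `U(𝔤^Y)` generated by the constants `𝔤` (equivalently, by `U⁺𝔤`). -/
def vacIdeal (𝔤 : Type*) [LieRing 𝔤] [LieAlgebra ℂ 𝔤] (Y : Set (OnePoint ℂ)) :
    Ideal (Env (Cur 𝔤 Y)) :=
  Ideal.span (Set.range fun x : 𝔤 => Env.of (Cur.const Y x))

/-- The left module `U(𝔤^Y) ⊗_{U𝔤} ℂ = U(𝔤^Y) / ⟨U⁺𝔤⟩`, where `𝔤^Y` is the Lie algebra of rational maps
regular on `Y`. It is denoted `𝒱^Y`; in particular `𝒱 = Vac 𝔤 ∅` and `𝒱^z = Vac 𝔤 {z}`. -/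
def Vac (𝔤 : Type*) [LieRing 𝔤] [LieAlgebra ℂ 𝔤] (Y : Set (OnePoint ℂ)) :=
  Env (Cur 𝔤 Y) ⧸ vacIdeal 𝔤 Y

namespace Vac

instance : AddCommGroup (Vac 𝔤 Y) := inferInstanceAs (AddCommGroup (_ ⧸ vacIdeal 𝔤 Y))
instance : Module (Env (Cur 𝔤 Y)) (Vac 𝔤 Y) :=
  inferInstanceAs (Module (Env (Cur 𝔤 Y)) (_ ⧸ vacIdeal 𝔤 Y))
instance : Module ℂ (Vac 𝔤 Y) := inferInstanceAs (Module ℂ (_ ⧸ vacIdeal 𝔤 Y))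
instance : IsScalarTower ℂ (Env (Cur 𝔤 Y)) (Vac 𝔤 Y) :=
  inferInstanceAs (IsScalarTower ℂ (Env (Cur 𝔤 Y)) (_ ⧸ vacIdeal 𝔤 Y))

/-- The quotient map. -/
def mk : Env (Cur 𝔤 Y) →ₗ[ℂ] Vac 𝔤 Y := (Submodule.mkQ (vacIdeal 𝔤 Y)).restrictScalars ℂ

lemma smul_mk (a b : Env (Cur 𝔤 Y)) : a • (mk b : Vac 𝔤 Y) = mk (a * b) := rfl

/-- The vacuum vector, the class of `1`. -/
def vac : Vac 𝔤 Y := mk 1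

lemma mk_eq_zero {a : Env (Cur 𝔤 Y)} (h : a ∈ vacIdeal 𝔤 Y) : (mk a : Vac 𝔤 Y) = 0 :=
  (Submodule.Quotient.mk_eq_zero _).2 h

lemma const_smul_vac (x : 𝔤) : Env.of (Cur.const Y x) • (vac : Vac 𝔤 Y) = 0 := by
  rw [vac, smul_mk, mul_one]
  exact mk_eq_zero (Ideal.subset_span ⟨x, rfl⟩)

lemma exists_lift {N : Type*} [AddCommGroup N] [Module ℂ N] (g : Env (Cur 𝔤 Y) →ₗ[ℂ] N)
    (h : ∀ a ∈ vacIdeal 𝔤 Y, g a = 0) : ∃ G : Vac 𝔤 Y →ₗ[ℂ] N, ∀ a, G (mk a) = g a :=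
  ⟨{ toFun := QuotientAddGroup.lift (vacIdeal 𝔤 Y).toAddSubgroup g.toAddMonoidHom h
     map_add' := map_add _
     map_smul' := fun c m => by
      obtain ⟨a, rfl⟩ := Submodule.Quotient.mk_surjective _ m
      exact g.map_smul c a }, fun _ => rfl⟩

/-- Functoriality in the algebra of functions. -/
def map (φ : regFun Y →ₐ[ℂ] regFun Y') : Vac 𝔤 Y →ₗ[ℂ] Vac 𝔤 Y' where
  toFun := QuotientAddGroup.map (vacIdeal 𝔤 Y).toAddSubgroup (vacIdeal 𝔤 Y').toAddSubgroup
    (Env.map (Cur.map φ)).toRingHom.toAddMonoidHom (by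
      have h : vacIdeal 𝔤 Y ≤ (vacIdeal 𝔤 Y').comap (Env.map (Cur.map φ)).toRingHom := by
        refine Ideal.span_le.2 ?_
        rintro _ ⟨x, rfl⟩
        change Env.map (Cur.map φ) (Env.of _) ∈ vacIdeal 𝔤 Y'
        rw [Env.map_of]
        have : Cur.map φ (Cur.const Y x) = Cur.const Y' x := by
          change Cur.tmul (φ 1) x = Cur.tmul 1 x
          rw [map_one]
        rw [this]
        exact Ideal.subset_span ⟨x, rfl⟩
      exact h)
  map_add' := map_add _
  map_smul' c m := by
    obtain ⟨a, rfl⟩ := Submodule.Quotient.mk_surjective _ m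
    change mk (Env.map (Cur.map φ) (c • a)) = c • mk (Env.map (Cur.map φ) a)
    rw [map_smul, map_smul]

lemma map_mk (φ : regFun Y →ₐ[ℂ] regFun Y') (a : Env (Cur 𝔤 Y)) :
    map φ (mk a) = mk (Env.map (Cur.map φ) a) := rfl

/-- The natural map `𝒱^Y → 𝒱^Y'` for `Y' ⊆ Y`. -/
def res (h : Y' ⊆ Y) : Vac 𝔤 Y →ₗ[ℂ] Vac 𝔤 Y' := map (resFun h)

end Vac

/-- The maps that are regular on `Y` and vanish at the base point `P ∈ Y`. -/
def CurMinus (𝔤 : Type*) [LieRing 𝔤] [LieAlgebra ℂ 𝔤] (hP : P ∈ Y) : LieSubalgebra ℂ (Cur 𝔤 Y) where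
  carrier := {α | Cur.eval hP α = 0}
  add_mem' {α β} ha hb := by
    change Cur.eval hP (α + β) = 0
    rw [map_add, show Cur.eval hP α = 0 from ha, show Cur.eval hP β = 0 from hb, add_zero]
  zero_mem' := map_zero _
  smul_mem' c α ha := by
    change Cur.eval hP (c • α) = 0
    rw [map_smul, show Cur.eval hP α = 0 from ha, smul_zero]
  lie_mem' {α β} ha hb := by
    change Cur.eval hP ⁅α, β⁆ = 0
    rw [LieHom.map_lie, show Cur.eval hP α = 0 from ha, zero_lie]

lemma kerComm_mem (u : Coord P) (hz : z ∈ Y) (hzP : z ≠ P) (hP : P ∈ Y) (v : 𝔤) (α : Cur 𝔤 Y) :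
    kerComm u hz hzP v α ∈ CurMinus 𝔤 hP := by
  induction α using Cur.induction with
  | zero => rw [map_zero]; exact zero_mem _
  | add a b ha hb => rw [map_add]; exact add_mem ha hb
  | tmul f x =>
    rw [kerComm_tmul]
    refine neg_mem ?_
    change Cur.eval hP (Cur.tmul _ _) = 0
    rw [Cur.eval_tmul, u.evalFun_diffQuot, zero_smul]

/-- `kerComm` on maps vanishing at `P`. -/
def kerCommMinus (u : Coord P) (hz : z ∈ Y) (hzP : z ≠ P) (hP : P ∈ Y) :
    𝔤 →ₗ[ℂ] CurMinus 𝔤 hP →ₗ[ℂ] CurMinus 𝔤 hP :=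
  LinearMap.mk₂ ℂ (fun v α => ⟨kerComm u hz hzP v α.1, kerComm_mem u hz hzP hP v α.1⟩)
    (fun _ _ _ => Subtype.ext (by simp)) (fun _ _ _ => Subtype.ext (by simp))
    (fun _ _ _ => Subtype.ext (by simp)) (fun _ _ _ => Subtype.ext (by simp))

/-- The identification of `U(𝔤^Y_{P,-})` with `U(𝔤^Y) / ⟨U⁺𝔤⟩`, induced by the inclusion. -/
def ident (hP : P ∈ Y) : Env (CurMinus 𝔤 hP) →ₗ[ℂ] Vac 𝔤 Y :=
  Vac.mk ∘ₗ (Env.map (CurMinus 𝔤 hP).incl).toLinearMap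

/-- The recursion defining `ι` on `U(𝔤^Y_{P,-})`: it kills `1` and
`[ι^v(z), α] = -[ε^v(z), α] - (v, dα(z)) + ι^[v, α(z)](z) + ε^[v, α(z)](z)`. -/
structure IsIota (κ : LinearMap.BilinForm ℂ 𝔤) (u : Coord P) (hP : P ∈ Y) (hz : z ∈ Y)
    (hzP : z ≠ P)
    (i : 𝔤 →ₗ[ℂ] Env (CurMinus 𝔤 hP) →ₗ[ℂ] Env (CurMinus 𝔤 hP) ⊗[ℂ] Cotan z) : Prop where
  vac : ∀ v, i v 1 = 0
  comm : ∀ (v : 𝔤) (α : CurMinus 𝔤 hP) (β : Env (CurMinus 𝔤 hP)),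
    i v (Env.of α * β) - (LinearMap.mulLeft ℂ (Env.of α)).rTensor (Cotan z) (i v β) =
      (Env.of (kerCommMinus u hz hzP hP v α) * β) ⊗ₜ u.d hzP - β ⊗ₜ pairD κ hz v α.1 +
        i ⁅v, Cur.eval hz α.1⁆ β

lemma exists_isIota {κ : LinearMap.BilinForm ℂ 𝔤} (hκ : κ.lieInvariant 𝔤) (u : Coord P)
    (hP : P ∈ Y) (hz : z ∈ Y) (hzP : z ≠ P) : ∃ i, IsIota (𝔤 := 𝔤) κ u hP hz hzP i := by
  obtain ⟨F, hF⟩ := exists_rec (M := Env (CurMinus 𝔤 hP))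
    ((Cur.eval hz).comp (CurMinus 𝔤 hP).incl) (kerCommMinus u hz hzP hP)
    ((pairD κ hz).compl₂ (CurMinus 𝔤 hP).incl.toLinearMap) (u.d hzP)
    (fun v α β => Subtype.ext (kerComm_lie u hz hzP v α.1 β.1))
    (fun v α β => pairD_lie hκ hz v α.1 β.1)
  have h1 : ∀ x n, (F x n).1 = x * n.1 := fun x n => by
    induction x using Env.induction with
    | one => simp
    | add a b ha hb => simp [ha, hb, add_mul]
    | smul c a ha => simp [ha]
    | mul l a ha => simp only [map_mul, Module.End.mul_apply, hF, recStep_fst, ha, mul_assoc,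
        smul_eq_mul]
  refine ⟨LinearMap.mk₂ ℂ (fun v x => (F x (1, 0)).2 v) (fun v w x => map_add _ _ _)
    (fun c v x => map_smul _ _ _) (fun v x y => by simp) (fun c v x => by simp), ?_, ?_⟩
  · intro v; simp
  · intro v α β
    have e : LinearMap.mulLeft ℂ (Env.of α) = act (Env (CurMinus 𝔤 hP)) (Env.of α) := rfl
    have e2 : Cur.eval hz ((CurMinus 𝔤 hP).incl α) = Cur.eval hz α.1 := rfl
    have e3 : (CurMinus 𝔤 hP).incl.toLinearMap α = α.1 := rfl
    simp only [LinearMap.mk₂_apply, map_mul, Module.End.mul_apply, hF, recStep_snd, h1, mul_one, e,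
      smul_eq_mul, LieHom.comp_apply, e2, LinearMap.compl₂_apply, e3]
    abel

/-- The same recursion on `𝒱^Y`, with `α` any map regular on `Y`. -/
structure IsIotaVac (κ : LinearMap.BilinForm ℂ 𝔤) (u : Coord P) (hz : z ∈ Y) (hzP : z ≠ P)
    (i : 𝔤 →ₗ[ℂ] Vac 𝔤 Y →ₗ[ℂ] Vac 𝔤 Y ⊗[ℂ] Cotan z) : Prop where
  vac : ∀ v, i v Vac.vac = 0
  comm : ∀ (v : 𝔤) (α : Cur 𝔤 Y) (m : Vac 𝔤 Y),
    i v (Env.of α • m) - (act (Vac 𝔤 Y) (Env.of α)).rTensor (Cotan z) (i v m) =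
      (Env.of (kerComm u hz hzP v α) • m) ⊗ₜ u.d hzP - m ⊗ₜ pairD κ hz v α +
        i ⁅v, Cur.eval hz α⁆ m

lemma dFun_one (hz : z ∈ Y) : dFun hz 1 = 0 := by
  have := dFun_mul hz 1 1
  simpa using this

lemma exists_isIotaVac {κ : LinearMap.BilinForm ℂ 𝔤} (hκ : κ.lieInvariant 𝔤) (u : Coord P)
    (hz : z ∈ Y) (hzP : z ≠ P) : ∃ i, IsIotaVac (𝔤 := 𝔤) κ u hz hzP i := by
  obtain ⟨F, hF⟩ := exists_rec (M := Vac 𝔤 Y)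
    (Cur.eval hz) (kerComm u hz hzP) (pairD κ hz) (u.d hzP)
    (fun v α β => kerComm_lie u hz hzP v α β) (fun v α β => pairD_lie hκ hz v α β)
  have h1 : ∀ x n, (F x n).1 = x • n.1 := fun x n => by
    induction x using Env.induction with
    | one => simp
    | add a b ha hb => simp [ha, hb, add_smul]
    | smul c a ha => simp [ha]
    | mul l a ha => simp only [map_mul, Module.End.mul_apply, hF, recStep_fst, ha, mul_smul]
  have h2 : ∀ a ∈ vacIdeal 𝔤 Y, F a (Vac.vac, 0) = 0 := fun a ha => by
    refine Submodule.span_induction ?_ ?_ ?_ ?_ ha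
    · rintro _ ⟨x, rfl⟩
      rw [hF]
      refine Prod.ext ?_ (LinearMap.ext fun v => ?_)
      · exact Vac.const_smul_vac x
      · rw [recStep_snd]
        have e1 : kerComm u hz hzP v (Cur.const Y x) = 0 := by
          change kerComm u hz hzP v (Cur.tmul 1 x) = 0
          have : u.diffQuot hz hzP 1 = 0 := by
            have := u.diffQuot_mul hz hzP 1 1
            simpa using this
          rw [kerComm_tmul, this, ← Cur.mk_apply, map_zero, LinearMap.zero_apply, neg_zero]
        have e2 : pairD κ hz v (Cur.const Y x) = 0 := by
          change pairD κ hz v (Cur.tmul 1 x) = 0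
          rw [pairD_tmul, dFun_one, smul_zero]
        have e3 : Env.of (0 : Cur 𝔤 Y) = 0 := map_zero (UniversalEnvelopingAlgebra.ι ℂ)
        rw [e1, e2, e3]
        simp
    · simp
    · intro a b _ _ ha hb; rw [map_add, LinearMap.add_apply, ha, hb, add_zero]
    · intro a b _ hb; rw [smul_eq_mul, map_mul, Module.End.mul_apply, hb, map_zero]
  let g : Env (Cur 𝔤 Y) →ₗ[ℂ] (𝔤 →ₗ[ℂ] Vac 𝔤 Y ⊗[ℂ] Cotan z) :=
    { toFun := fun x => (F x (Vac.vac, 0)).2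
      map_add' := fun x y => by simp
      map_smul' := fun c x => by simp }
  obtain ⟨G, hG⟩ := Vac.exists_lift g fun a ha => by
    change (F a (Vac.vac, 0)).2 = 0
    rw [h2 a ha]; rfl
  have hG' : ∀ a v, G (Vac.mk a) v = (F a (Vac.vac, 0)).2 v := fun a v => by rw [hG]; rfl
  refine ⟨G.flip, ?_, ?_⟩
  · intro v
    rw [LinearMap.flip_apply, Vac.vac, hG']
    simp
  · intro v α m
    obtain ⟨b, rfl⟩ : ∃ b, Vac.mk b = m := Submodule.Quotient.mk_surjective _ m
    have e : b • (Vac.vac : Vac 𝔤 Y) = Vac.mk b := by rw [Vac.vac, Vac.smul_mk, mul_one]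
    simp only [LinearMap.flip_apply, Vac.smul_mk, hG', map_mul, Module.End.mul_apply, hF,
      recStep_snd, h1, e]
    abel

/-- The operator `ι^v(z)` on `U(𝔤^Y_{P,-})`, for `z ∈ Y`. -/
def iota {κ : LinearMap.BilinForm ℂ 𝔤} (hκ : κ.lieInvariant 𝔤) (u : Coord P)
    (hP : P ∈ Y) (hz : z ∈ Y) (hzP : z ≠ P) :
    𝔤 →ₗ[ℂ] Env (CurMinus 𝔤 hP) →ₗ[ℂ] Env (CurMinus 𝔤 hP) ⊗[ℂ] Cotan z :=
  (exists_isIota hκ u hP hz hzP).choose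

lemma isIota_iota {κ : LinearMap.BilinForm ℂ 𝔤} (hκ : κ.lieInvariant 𝔤) (u : Coord P)
    (hP : P ∈ Y) (hz : z ∈ Y) (hzP : z ≠ P) : IsIota κ u hP hz hzP (iota hκ u hP hz hzP) :=
  (exists_isIota hκ u hP hz hzP).choose_spec

lemma ne_of_mem_left (hP : P ∈ Y) (hz : z ∉ Y) : z ≠ P := fun h => hz (h ▸ hP)

lemma ne_of_mem_right (hz : z ∈ Y) (hP : P ∉ Y) : z ≠ P := fun h => hP (h ▸ hz)

/-- The operator `ι^v(z)` on `𝒱^Y`, for `z ∈ Y`; here vectors may have a pole at `P`. -/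
def iotaVac {κ : LinearMap.BilinForm ℂ 𝔤} (hκ : κ.lieInvariant 𝔤) (u : Coord P)
    (hz : z ∈ Y) (hzP : z ≠ P) : 𝔤 →ₗ[ℂ] Vac 𝔤 Y →ₗ[ℂ] Vac 𝔤 Y ⊗[ℂ] Cotan z :=
  (exists_isIotaVac hκ u hz hzP).choose

lemma isIotaVac_iotaVac {κ : LinearMap.BilinForm ℂ 𝔤} (hκ : κ.lieInvariant 𝔤) (u : Coord P)
    (hz : z ∈ Y) (hzP : z ≠ P) : IsIotaVac κ u hz hzP (iotaVac hκ u hz hzP) :=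
  (exists_isIotaVac hκ u hz hzP).choose_spec

/-- The operator `ε^v(z)` on `𝒱^Y`, for `z ∉ Y`: left multiplication by `v / (u - u(z)) ⊗ du_z`. -/
def epsVac (u : Coord P) (hzP : z ≠ P) (hz : z ∉ Y) :
    𝔤 →ₗ[ℂ] Vac 𝔤 Y →ₗ[ℂ] Vac 𝔤 Y ⊗[ℂ] Cotan z :=
  LinearMap.mk₂ ℂ (fun v m => (Env.of (Cur.tmul (u.ker hzP hz) v) • m) ⊗ₜ u.d hzP)
    (fun v w m => by
      rw [← Cur.mk_apply, map_add, Env.of_add, add_smul, TensorProduct.add_tmul]; rfl)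
    (fun c v m => by
      rw [← Cur.mk_apply, map_smul, Env.of_smul, smul_assoc, TensorProduct.smul_tmul']; rfl)
    (fun v m n => by rw [smul_add, TensorProduct.add_tmul])
    (fun c v m => by rw [smul_comm, TensorProduct.smul_tmul'])

/-- `v / (u - u(z))` as a map vanishing at `P`. -/
def kerMinus (u : Coord P) (hP : P ∈ Y) (hz : z ∉ Y) : 𝔤 →ₗ[ℂ] CurMinus 𝔤 hP where
  toFun v := ⟨Cur.tmul (u.ker (ne_of_mem_left hP hz) hz) v, by
    change Cur.eval hP (Cur.tmul _ _) = 0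
    rw [Cur.eval_tmul]
    have : evalFun hP (u.ker (ne_of_mem_left hP hz) hz) = 0 :=
      (u.isCoord.kernel (ne_of_mem_left hP hz)).2
    rw [this, zero_smul]⟩
  map_add' v w := Subtype.ext (map_add (Cur.mk _) v w)
  map_smul' c v := Subtype.ext (map_smul (Cur.mk _) c v)

/-- The operator `ε^v(z)` on `U(𝔤^Y_{P,-})`, for `z ∉ Y`: left multiplication by
`v / (u - u(z)) ⊗ du_z`. -/
def eps (u : Coord P) (hP : P ∈ Y) (hz : z ∉ Y) :
    𝔤 →ₗ[ℂ] Env (CurMinus 𝔤 hP) →ₗ[ℂ] Env (CurMinus 𝔤 hP) ⊗[ℂ] Cotan z :=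
  LinearMap.mk₂ ℂ (fun v x => (Env.of (kerMinus u hP hz v) * x) ⊗ₜ u.d (ne_of_mem_left hP hz))
    (fun v w m => by
      rw [map_add, Env.of_add, add_mul, TensorProduct.add_tmul])
    (fun c v m => by
      rw [map_smul, Env.of_smul, smul_mul_assoc, TensorProduct.smul_tmul'])
    (fun v m n => by rw [mul_add, TensorProduct.add_tmul])
    (fun c v m => by rw [mul_smul_comm, TensorProduct.smul_tmul'])

/-- A map regular on `Y` is regular on `Y' ⊆ Y`. -/
def resMinus (h : Y' ⊆ Y) (hP : P ∈ Y') :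
    CurMinus 𝔤 (h hP) →ₗ⁅ℂ⁆ CurMinus 𝔤 hP where
  toFun α := ⟨Cur.map (resFun h) α.1, by
    have h1 : ∀ α : Cur 𝔤 Y, Cur.eval hP (Cur.map (resFun h) α) = Cur.eval (h hP) α := fun α => by
      induction α using Cur.induction with
      | zero => simp
      | add a b ha hb => simp only [map_add, ha, hb]
      | tmul f x => rfl
    exact (h1 α.1).trans α.2⟩
  map_add' α β := Subtype.ext (map_add (Cur.map (resFun h)) α.1 β.1)
  map_smul' c α := Subtype.ext (map_smul (Cur.map (resFun h)) c α.1)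
  map_lie' := fun {α β} => Subtype.ext (LieHom.map_lie (Cur.map (resFun h)) α.1 β.1)

/-- The current `j^v(z) = ε^v(z) + ι^v(z)` defined by the base point `P`, from `U(𝔤^Y_{P,-})` to
`U(𝔤^Y'_{P,-}) ⊗ K_z`, for `z ∈ Y` and `Y' ⊆ Y` with `z ∉ Y'`. -/
def jMinus {κ : LinearMap.BilinForm ℂ 𝔤} (hκ : κ.lieInvariant 𝔤) (u : Coord P) (h : Y' ⊆ Y)
    (hP : P ∈ Y') (hz : z ∈ Y) (hz' : z ∉ Y') :
    𝔤 →ₗ[ℂ] Env (CurMinus 𝔤 (h hP)) →ₗ[ℂ] Env (CurMinus 𝔤 hP) ⊗[ℂ] Cotan z :=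
  (eps u hP hz').compl₂ (Env.map (resMinus h hP)).toLinearMap +
    (iota hκ u (h hP) hz (ne_of_mem_left hP hz')).compr₂
      ((Env.map (resMinus h hP)).toLinearMap.rTensor (Cotan z))

/-- Families of operators `j^v(z) : 𝒱^Y → 𝒱^Y' ⊗ K_z`, for `Y' ⊆ Y` and `z ∈ Y`, `z ∉ Y'`. The case
`Y = {z}`, `Y' = ∅` is `𝒱^z → 𝒱 ⊗ K_z`; the other cases serve to compose operators. -/
abbrev CurrentOp (𝔤 : Type*) [LieRing 𝔤] [LieAlgebra ℂ 𝔤] :=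
  ∀ ⦃z : OnePoint ℂ⦄ ⦃Y Y' : Set (OnePoint ℂ)⦄, Y' ⊆ Y → z ∈ Y → z ∉ Y' →
    𝔤 →ₗ[ℂ] Vac 𝔤 Y →ₗ[ℂ] Vac 𝔤 Y' ⊗[ℂ] Cotan z

/-- Automorphisms of the projective line: a bijection on points with a compatible pullback of rational
functions. -/
structure AutP1 where
  toEquiv : OnePoint ℂ ≃ OnePoint ℂ
  pullback : RatFunc ℂ ≃ₐ[ℂ] RatFunc ℂ
  isRegularAt_pullback : ∀ z f, IsRegularAt z (pullback f) ↔ IsRegularAt (toEquiv z) f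
  value_pullback : ∀ z f, IsRegularAt (toEquiv z) f → value z (pullback f) = value (toEquiv z) f

namespace AutP1
variable (φ : AutP1)

/-- Pullback of functions `f ↦ f ∘ φ`. -/
def pullFun (h : Set.MapsTo φ.toEquiv Y' Y) : regFun Y →ₐ[ℂ] regFun Y' :=
  ((φ.pullback : RatFunc ℂ →ₐ[ℂ] RatFunc ℂ).comp (regFun Y).val).codRestrict _
    fun f z hz => (φ.isRegularAt_pullback z f.1).2 (f.2 _ (h hz))

lemma mapsTo_singleton (z : OnePoint ℂ) : Set.MapsTo φ.toEquiv {z} {φ.toEquiv z} := by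
  rintro _ rfl; rfl

/-- Pullback of cotangent vectors. -/
def pullCotan (z : OnePoint ℂ) : Cotan (φ.toEquiv z) →ₗ[ℂ] Cotan z :=
  Ideal.mapCotangent _ _ (φ.pullFun (φ.mapsTo_singleton z)) fun f hf =>
    (φ.value_pullback z f.1 (f.2 _ rfl)).trans hf

/-- Pullback `𝒱^Y → 𝒱^{φ⁻¹(Y)}`. -/
def pullVac (Y : Set (OnePoint ℂ)) : Vac 𝔤 Y →ₗ[ℂ] Vac 𝔤 (φ.toEquiv ⁻¹' Y) :=
  Vac.map (φ.pullFun (Set.mapsTo_preimage _ _))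

end AutP1

section Families
variable {U : Set (OnePoint ℂ)} {T : Type*}

/-- For maps `q : T → U` in `pts`, the algebra of functions on `T` generated by the `a ∘ q`, with `a` a
regular function on `U`. For `T = U` or `T = U × U` with the projections, and `U` a nonempty
affine Zariski-open set, these are the regular functions on `T`. -/
def scalarFam (U : Set (OnePoint ℂ)) (pts : Set (T → U)) : Subalgebra ℂ (T → ℂ) :=
  Algebra.adjoin ℂ {s | ∃ q ∈ pts, ∃ a : regFun U, s = fun t => value (q t) a.1}

/-- Families `F_t(x)` of rational functions of `x`, algebraic in the parameter `t`: generated by regular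
functions of `x ∈ U`, regular functions of `t`, and the `1 / (u(x) - u(q(t)))`. In other words,
regular functions on `U × T` with poles allowed along the diagonals `x = q(t)`. -/
def funFam (U : Set (OnePoint ℂ)) (pts : Set (T → U)) : Subalgebra ℂ (T → RatFunc ℂ) :=
  Algebra.adjoin ℂ ({F | ∃ f : regFun U, F = fun _ => f.1} ∪
    {F | ∃ s ∈ scalarFam U pts, F = fun t => RatFunc.C (s t)} ∪
    {F | ∃ (P : OnePoint ℂ) (u : Coord P), P ∉ U ∧ ∃ q ∈ pts,
      F = fun t => (u.fn - RatFunc.C (value (q t) u.fn))⁻¹})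

/-- Any rational function, as a function with no regularity condition. -/
def toReg (f : RatFunc ℂ) : regFun ∅ := ⟨f, fun _ hz => absurd hz (Set.notMem_empty _)⟩

/-- Vectors of `𝒱` depending algebraically on `t : T`: sums of products of elements of the current
algebra with algebraic coefficients, applied to the vacuum. -/
inductive IsAlgFam (U : Set (OnePoint ℂ)) (pts : Set (T → U)) : (T → Vac 𝔤 ∅) → Prop
  | vac : IsAlgFam U pts fun _ => Vac.vac
  | add {w w' : T → Vac 𝔤 ∅} : IsAlgFam U pts w → IsAlgFam U pts w' →
      IsAlgFam U pts fun t => w t + w' t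
  | smul {s : T → ℂ} {w : T → Vac 𝔤 ∅} : s ∈ scalarFam U pts → IsAlgFam U pts w →
      IsAlgFam U pts fun t => s t • w t
  | act {F : T → RatFunc ℂ} (x : 𝔤) {w : T → Vac 𝔤 ∅} : F ∈ funFam U pts → IsAlgFam U pts w →
      IsAlgFam U pts fun t => Env.of (Cur.tmul (toReg (F t)) x) • w t

/-- Algebraic dependence on one point of `U`. -/
abbrev IsAlgFam₁ (w : U → Vac 𝔤 ∅) : Prop := IsAlgFam U {id} w
/-- Algebraic dependence on two points of `U`, with no poles along the diagonal `z₂ = z₁`. -/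
abbrev IsAlgFam₂ (w : U × U → Vac 𝔤 ∅) : Prop := IsAlgFam U {Prod.fst, Prod.snd} w

/-- `s(z) ∈ 𝒱 ⊗ K_z` depends algebraically on `z ∈ U`. -/
def IsAlgSection (u : Coord P) (hP : P ∉ U) (s : ∀ z : U, Vac 𝔤 ∅ ⊗[ℂ] Cotan z.1) : Prop :=
  ∃ w : U → Vac 𝔤 ∅, IsAlgFam₁ w ∧
    ∀ z : U, s z = w z ⊗ₜ u.d (ne_of_mem_right z.2 hP)

/-- `F(z₂, z₁) → G(z₁)` as `z₂ → z₁`: the section `F`, given off the diagonal, extends algebraically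
across the diagonal of `U × U`, and the extension restricts to `G` on the diagonal. -/
def IsDiagLimit (u : Coord P) (hP : P ∉ U)
    (F : ∀ z₂ z₁ : U, z₂ ≠ z₁ → (Vac 𝔤 ∅ ⊗[ℂ] Cotan z₂.1) ⊗[ℂ] Cotan z₁.1)
    (G : ∀ z : U, (Vac 𝔤 ∅ ⊗[ℂ] Cotan z.1) ⊗[ℂ] Cotan z.1) : Prop :=
  ∃ w : U × U → Vac 𝔤 ∅, IsAlgFam₂ w ∧
    (∀ (z₂ z₁ : U) (h : z₂ ≠ z₁), F z₂ z₁ h =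
      (w (z₂, z₁) ⊗ₜ u.d (ne_of_mem_right z₂.2 hP)) ⊗ₜ u.d (ne_of_mem_right z₁.2 hP)) ∧
    ∀ z : U, G z =
      (w (z, z) ⊗ₜ u.d (ne_of_mem_right z.2 hP)) ⊗ₜ u.d (ne_of_mem_right z.2 hP)

/-- `D(z) = (dŝ/du)(z) du_z²`, where `s(z) = ŝ(z) du_z`: the difference quotient of `ŝ` extends
algebraically across the diagonal, with value `D` there. -/
def IsDeriv (u : Coord P) (hP : P ∉ U) (s : ∀ z : U, Vac 𝔤 ∅ ⊗[ℂ] Cotan z.1)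
    (D : ∀ z : U, (Vac 𝔤 ∅ ⊗[ℂ] Cotan z.1) ⊗[ℂ] Cotan z.1) : Prop :=
  ∃ w : U → Vac 𝔤 ∅, IsAlgFam₁ w ∧
    (∀ z : U, s z = w z ⊗ₜ u.d (ne_of_mem_right z.2 hP)) ∧
    ∃ q : U × U → Vac 𝔤 ∅, IsAlgFam₂ q ∧
      (∀ z₂ z₁ : U, w z₂ - w z₁ = (u.val z₂ - u.val z₁) • q (z₂, z₁)) ∧
      ∀ z : U, D z =
        (q (z, z) ⊗ₜ u.d (ne_of_mem_right z.2 hP)) ⊗ₜ u.d (ne_of_mem_right z.2 hP)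

end Families

/-- `j` is given by `ε + ι` for every choice of base point `P` and coordinate (under the identification of
`𝒱^Y` with `U(𝔤^Y_{P,-})` for `P ∈ Y`), and is compatible with the natural maps `𝒱^Y → 𝒱^Y₁`,
`Y₁ ⊆ Y`. -/
structure IsCurrent {κ : LinearMap.BilinForm ℂ 𝔤} (hκ : κ.lieInvariant 𝔤) (j : CurrentOp 𝔤) :
    Prop where
  eq_jMinus : ∀ {P z : OnePoint ℂ} {Y Y' : Set (OnePoint ℂ)} (u : Coord P) (h : Y' ⊆ Y)
    (hP : P ∈ Y') (hz : z ∈ Y) (hz' : z ∉ Y') (v : 𝔤) (x : Env (CurMinus 𝔤 (h hP))),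
    j h hz hz' v (ident (h hP) x) =
      (ident hP).rTensor (Cotan z) (jMinus hκ u h hP hz hz' v x)
  res_res : ∀ {z : OnePoint ℂ} {Y Y' Y₁ Y₁' : Set (OnePoint ℂ)} (h : Y' ⊆ Y) (h₁ : Y₁' ⊆ Y₁)
    (hY : Y₁ ⊆ Y) (hY' : Y₁' ⊆ Y') (hz : z ∈ Y₁) (hz' : z ∉ Y') (v : 𝔤) (m : Vac 𝔤 Y),
    j h₁ hz (fun h => hz' (hY' h)) v (Vac.res hY m) =
      (Vac.res hY').rTensor (Cotan z) (j h (hY hz) hz' v m)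

/-- Covariance under all automorphisms of the projective line: pullback intertwines `j(φ(z))` and `j(z)`. -/
def IsCovariant (j : CurrentOp 𝔤) : Prop :=
  ∀ (φ : AutP1) {z : OnePoint ℂ} {Y Y' : Set (OnePoint ℂ)} (h : Y' ⊆ Y) (hz : φ.toEquiv z ∈ Y)
    (hz' : φ.toEquiv z ∉ Y') (v : 𝔤) (m : Vac 𝔤 Y),
    j (z := z) (Set.preimage_mono h) hz hz' v (φ.pullVac Y m) =
      TensorProduct.map (φ.pullVac Y') (φ.pullCotan z) (j h hz hz' v m)

section OPE
variable {U : Set (OnePoint ℂ)}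

/-- `j^{v₂}(z₂) j^{v₁}(z₁) - (v₁, v₂) du_{z₁} du_{z₂} / (u(z₁) - u(z₂))²
- du_{z₂} j^{[v₂, v₁]}(z₁) / (u(z₂) - u(z₁))`, applied to `m ∈ 𝒱^U`. -/
def opeLeft (κ : LinearMap.BilinForm ℂ 𝔤) (j : CurrentOp 𝔤) (u : Coord P) (hP : P ∉ U) (v₂ v₁ : 𝔤)
    (m : Vac 𝔤 U) (z₂ z₁ : U) (h : z₂ ≠ z₁) : (Vac 𝔤 ∅ ⊗[ℂ] Cotan z₂.1) ⊗[ℂ] Cotan z₁.1 :=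
  (j (Set.empty_subset {z₂.1}) (Set.mem_singleton _) (Set.notMem_empty _) v₂).rTensor (Cotan z₁.1)
      (j (Set.singleton_subset_iff.2 z₂.2) z₁.2 (fun e => h (Subtype.ext e.symm)) v₁ m) -
    (κ v₁ v₂ / (u.val z₁ - u.val z₂) ^ 2) •
      ((Vac.res (Set.empty_subset U) m ⊗ₜ u.d (ne_of_mem_right z₂.2 hP)) ⊗ₜ
        u.d (ne_of_mem_right z₁.2 hP)) -
    (1 / (u.val z₂ - u.val z₁)) •
      ((TensorProduct.mk ℂ (Vac 𝔤 ∅) (Cotan z₂.1)).flip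
        (u.d (ne_of_mem_right z₂.2 hP))).rTensor (Cotan z₁.1)
          (j (Set.empty_subset U) z₁.2 (Set.notMem_empty _) ⁅v₂, v₁⁆ m)

/-- `ι^v(z) m ∈ 𝒱 ⊗ K_z`, for `m ∈ 𝒱^U` and `z ∈ U`. -/
def iotaField {κ : LinearMap.BilinForm ℂ 𝔤} (hκ : κ.lieInvariant 𝔤) (u : Coord P) (hP : P ∉ U)
    (v : 𝔤) (m : Vac 𝔤 U) (z : U) : Vac 𝔤 ∅ ⊗[ℂ] Cotan z.1 :=
  (Vac.res (Set.empty_subset U)).rTensor (Cotan z.1)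
    (iotaVac hκ u z.2 (ne_of_mem_right z.2 hP) v m)

/-- `ε^v(z)` on `𝒱`, for `z ∈ U`. -/
def epsField (u : Coord P) (hP : P ∉ U) (v : 𝔤) (z : U) :
    Vac 𝔤 ∅ →ₗ[ℂ] Vac 𝔤 ∅ ⊗[ℂ] Cotan z.1 :=
  epsVac u (ne_of_mem_right z.2 hP) (Set.notMem_empty z.1) v

/-- `ι^{v₂}(z) ι^{v₁}(z) + ε^{v₂}(z) ε^{v₁}(z) + ε^{v₂}(z) ι^{v₁}(z) + ε^{v₁}(z) ι^{v₂}(z)`, applied to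
`m ∈ 𝒱^U`. -/
def opeRegular {κ : LinearMap.BilinForm ℂ 𝔤} (hκ : κ.lieInvariant 𝔤) (u : Coord P) (hP : P ∉ U)
    (v₂ v₁ : 𝔤) (m : Vac 𝔤 U) (z : U) : (Vac 𝔤 ∅ ⊗[ℂ] Cotan z.1) ⊗[ℂ] Cotan z.1 :=
  ((Vac.res (Set.empty_subset U)).rTensor (Cotan z.1)).rTensor (Cotan z.1)
      ((iotaVac hκ u z.2 (ne_of_mem_right z.2 hP) v₂).rTensor (Cotan z.1)
        (iotaVac hκ u z.2 (ne_of_mem_right z.2 hP) v₁ m)) +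
    (epsField u hP v₂ z).rTensor (Cotan z.1)
      (epsField u hP v₁ z (Vac.res (Set.empty_subset U) m)) +
    (epsField u hP v₂ z).rTensor (Cotan z.1) (iotaField hκ u hP v₁ m z) +
    (epsField u hP v₁ z).rTensor (Cotan z.1) (iotaField hκ u hP v₂ m z)

/-- The operator product expansion of the current, for every choice of the point `P` at infinity and of
a coordinate `u` with pole `P`; `U` is a Zariski-open set adapted to the vector `m`. -/
def SatisfiesOPE {κ : LinearMap.BilinForm ℂ 𝔤} (hκ : κ.lieInvariant 𝔤) (j : CurrentOp 𝔤) : Prop :=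
  ∀ {P : OnePoint ℂ} {U : Set (OnePoint ℂ)} (u : Coord P) (hP : P ∉ U), Uᶜ.Finite →
    ∀ (m : Vac 𝔤 U) (v₁ v₂ : 𝔤),
      ∃ D : ∀ z : U, (Vac 𝔤 ∅ ⊗[ℂ] Cotan z.1) ⊗[ℂ] Cotan z.1,
        IsDeriv u hP (iotaField hκ u hP ⁅v₂, v₁⁆ m) D ∧
        IsDiagLimit u hP (opeLeft κ j u hP v₂ v₁ m) fun z => opeRegular hκ u hP v₂ v₁ m z + D z

end OPE

end Lie
end CurrentAlgebra
end

open CurrentAlgebra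

noncomputable section
namespace CurrentAlgebra

/-! For two coordinates `u`, `u'` with poles away from z, the functions 1/(u - u(z)) and 1/(u' -
u'(z)) both have a single simple pole at z, so 1/(u' - u'(z)) = b/(u - u(z)) + c with constants b ≠
0 and c, and du_z = b du'_z. Hence ε' = ε + c v ⊗ du'_z, where v acts as a constant map. The
recursion for ι involves `u` only through the difference quotient (f - f(z))/(u - u(z)) and du_z,
and it determines ι, since the vacuum generates the module; comparing recursions gives ι' = ι - c v
⊗ du'_z. So ε + ι is independent of all choices (`epsVac_of_ker_eq`, `iotaVac_of_ker_eq`,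
`jVac_eq`). Part (1) is the case u' = 1/u, where c = -1/u'(z).

For (0), `Cur 𝔤 Y` is the sum of the constants and of the maps vanishing at P. No PBW theorem is
needed: U(𝔤^Y_{P,-}) is made a U(𝔤^Y)-module on which maps vanishing at P act by left multiplication
and constants by derivations. Acting on 1 kills `vacIdeal` and inverts `ident` (`exists_envAction`,
`ident_bijective`).

In (2), ε + ι makes sense on `Vac 𝔤 Y` without a base point in Y', which gives existence. For
uniqueness, a vector involves finitely many poles, so Y and Y' can be enlarged by a point Q at which
everything is regular; compatibility and the formula at Q then determine j (`IsCurrent.eq_jVac`).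
Covariance holds because a coordinate pulls back to a coordinate and the recursion is natural
(`iotaVac_map`).

Algebraicity follows from separation of variables: (f(x) - f(z))/(u(x) - u(z)) is a finite sum ∑
aᵢ(z) bᵢ(x) with aᵢ, bᵢ regular on U (`Coord.exists_diffQuot_eq`). For the OPE, moving ι(z₂) past
v₁/(u - u(z₁)) produces exactly the double pole, a simple pole times ε(z₁) and a simple pole times
ι(z₂), the last two for [v₂,v₁]. Subtracting the simple pole times j(z₁) leaves a difference
quotient of ι̂, whose diagonal value is the derivative term (`jHat_jHat`, `exists_diffQuot_regFam`).
-/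

/-! ### Coordinates as bijections onto ℂ and as generators of the function field. -/

lemma finite_not_isRegularAt (f : RatFunc ℂ) : {z | ¬ IsRegularAt z f}.Finite := by
  have h : (f.denom.roots.toFinset : Set ℂ).Finite := Finset.finite_toSet _
  refine ((h.image (fun a : ℂ => (a : OnePoint ℂ))).union (Set.finite_singleton ∞)).subset ?_
  intro z hz
  induction z using OnePoint.rec with
  | infty => exact Or.inr rfl
  | coe a =>
    refine Or.inl ⟨a, ?_, rfl⟩
    have : f.denom.eval a = 0 := by simpa [isRegularAt_coe_iff] using hz
    simpa [f.denom_ne_zero] using this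

lemma isRegularAt_sub_C {z : OnePoint ℂ} {f : RatFunc ℂ} (hf : IsRegularAt z f) (c : ℂ) :
    IsRegularAt z (f - RatFunc.C c) := by
  rw [sub_eq_add_neg, ← map_neg]; exact isRegularAt_add hf (isRegularAt_C _ _)

lemma value_sub_C {z : OnePoint ℂ} {f : RatFunc ℂ} (hf : IsRegularAt z f) (c : ℂ) :
    value z (f - RatFunc.C c) = value z f - c := by
  rw [sub_eq_add_neg, ← map_neg, value_add hf (isRegularAt_C _ _), value_C, sub_eq_add_neg]

lemma IsCoord.sub_C_ne_zero {P : OnePoint ℂ} {u : RatFunc ℂ} (hu : IsCoord P u) (c : ℂ) :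
    u - RatFunc.C c ≠ 0 := fun h => hu.pole (by
  rw [sub_eq_zero.1 h]; exact isRegularAt_C _ _)

lemma IsCoord.ne_zero {P : OnePoint ℂ} {u : RatFunc ℂ} (hu : IsCoord P u) : u ≠ 0 := by
  simpa using hu.sub_C_ne_zero 0

/-- An affine change reduces this to `stdCoord P`, where the equation is solved explicitly; if P is
finite, the value 0 is taken at ∞. -/
lemma IsCoord.exists_value_eq {P : OnePoint ℂ} {u : RatFunc ℂ} (hu : IsCoord P u) (c : ℂ) :
    ∃ z, z ≠ P ∧ value z u = c := by
  obtain ⟨b, d, hb, e⟩ := hu.eq_affine (isCoord_stdCoord P) (stdCoord_inv P).1 (stdCoord_inv P).2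
  suffices H : ∃ z, z ≠ P ∧ value z (stdCoord P) = (c - d) / b by
    obtain ⟨z, hz, h⟩ := H
    have r := (isCoord_stdCoord P).regular z hz
    refine ⟨z, hz, ?_⟩
    rw [e, value_add (isRegularAt_mul (isRegularAt_C _ _) r) (isRegularAt_C _ _),
      value_mul (isRegularAt_C _ _) r, value_C, value_C, h]
    field_simp; ring
  generalize (c - d) / b = t
  induction P using OnePoint.rec with
  | infty => exact ⟨(t : ℂ), OnePoint.coe_ne_infty _, value_stdCoord_infty t⟩
  | coe a =>
    by_cases ht : t = 0
    · exact ⟨∞, (OnePoint.coe_ne_infty a).symm, by rw [ht, value_infty_stdCoord_coe]⟩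
    · have h : a + t⁻¹ ≠ a := by simpa using ht
      refine ⟨((a + t⁻¹ : ℂ) : OnePoint ℂ), fun h' => h (OnePoint.coe_injective h'), ?_⟩
      rw [value_stdCoord_coe _ _ h]; simp

/-- `u` is affine in `stdCoord P`, which is X or 1/(X - a), so X lies in ℂ(u). -/
lemma IsCoord.adjoin_eq_top {P : OnePoint ℂ} {u : RatFunc ℂ} (hu : IsCoord P u) :
    IntermediateField.adjoin ℂ {u} = ⊤ := by
  set K := IntermediateField.adjoin ℂ {u}
  have huK : u ∈ K := IntermediateField.mem_adjoin_simple_self ℂ u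
  have hC : ∀ c, RatFunc.C c ∈ K := fun c => by
    rw [← RatFunc.algebraMap_eq_C]; exact K.algebraMap_mem c
  obtain ⟨b, d, hb, e⟩ := hu.eq_affine (isCoord_stdCoord P) (stdCoord_inv P).1 (stdCoord_inv P).2
  have hb' : RatFunc.C b ≠ 0 := by simpa using hb
  have hs : stdCoord P ∈ K := by
    have : stdCoord P = (u - RatFunc.C d) / RatFunc.C b := by rw [e]; field_simp; ring
    rw [this]
    exact K.div_mem (K.sub_mem huK (hC d)) (hC b)
  have hX : RatFunc.X ∈ K := by
    induction P using OnePoint.rec with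
    | infty => exact hs
    | coe a =>
      have : (RatFunc.X : RatFunc ℂ) = (stdCoord (a : OnePoint ℂ))⁻¹ + RatFunc.C a := by
        simp [stdCoord]
      rw [this]
      exact K.add_mem (K.inv_mem hs) (hC a)
  have hp : ∀ p : ℂ[X], algebraMap ℂ[X] (RatFunc ℂ) p ∈ K := fun p => by
    induction p using Polynomial.induction_on' with
    | add p q hp hq => rw [map_add]; exact K.add_mem hp hq
    | monomial n c =>
      rw [← Polynomial.C_mul_X_pow_eq_monomial, map_mul, map_pow, RatFunc.algebraMap_X,
        RatFunc.algebraMap_C]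
      exact K.mul_mem (hC c) (pow_mem hX n)
  refine eq_top_iff.2 fun f _ => ?_
  rw [← f.num_div_denom]
  exact K.div_mem (hp _) (hp _)

/-! ### Differentials, derivatives and the cotangent line. -/

variable {Y Y' U : Set (OnePoint ℂ)} {P P' z w : OnePoint ℂ}

lemma coe_algebraMap (c : ℂ) : ((algebraMap ℂ (regFun Y) c : regFun Y) : RatFunc ℂ) = RatFunc.C c :=
  RatFunc.algebraMap_eq_C (K := ℂ) ▸ rfl

lemma dFun_algebraMap (hz : z ∈ Y) (c : ℂ) : dFun hz (algebraMap ℂ (regFun Y) c) = 0 := by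
  rw [Algebra.algebraMap_eq_smul_one, map_smul, dFun_one, smul_zero]

/-- A function regular on a larger set has the same differential. -/
lemma dFun_resFun (h : Y' ⊆ Y) (hz : z ∈ Y') (f : regFun Y) :
    dFun hz (resFun h f) = dFun (h hz) f := rfl

namespace Coord
variable (u : Coord P) (u' : Coord P')

/-- The coordinate as a regular function on a set that does not contain its pole. -/
def reg (hP : P ∉ Y) : regFun Y :=
  ⟨u.fn, fun w hw => u.isCoord.regular w (ne_of_mem_of_not_mem hw hP)⟩

lemma isRegularAt (hz : z ≠ P) : IsRegularAt z u.fn := u.isCoord.regular z hz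

/-- If w ≠ z, then 1/(u - u(z)) is regular at w, and its product with u - u(z) is 1, so u - u(z)
cannot vanish at w. -/
lemma val_injective {w : OnePoint ℂ} (hw : w ≠ P) (hz : z ≠ P) (h : u.val w = u.val z) : w = z := by
  by_contra hne
  have hk := (u.isCoord.kernel hz).1.regular w hne
  have h1 := value_mul hk (isRegularAt_sub_C (u.isRegularAt hw) (value z u.fn))
  rw [inv_mul_cancel₀ (u.isCoord.sub_C_ne_zero _), value_sub_C (u.isRegularAt hw)] at h1
  have h2 := value_C w 1
  rw [map_one, h1] at h2
  change _ * (u.val w - u.val z) = 1 at h2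
  simp [h] at h2

/-- Both kernels are coordinates with pole z, and coordinates with a common pole are affinely
related. Every independence statement below comes from this relation. -/
lemma exists_ker_eq (hz : z ≠ P) (hz' : z ≠ P') : ∃ b c : ℂ, b ≠ 0 ∧
    (u'.fn - RatFunc.C (u'.val z))⁻¹ =
      RatFunc.C b * (u.fn - RatFunc.C (u.val z))⁻¹ + RatFunc.C c := by
  refine (u'.isCoord.kernel hz').1.eq_affine (u.isCoord.kernel hz).1 ?_ ?_
  · rw [inv_inv]; exact isRegularAt_sub_C (u.isRegularAt hz) _
  · rw [inv_inv, value_sub_C (u.isRegularAt hz)]; exact sub_self (u.val z)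

variable {u u'} in
lemma d_eq_of_ker_eq {b c : ℂ} (hz : z ≠ P) (hz' : z ≠ P')
    (h : (u'.fn - RatFunc.C (u'.val z))⁻¹ =
      RatFunc.C b * (u.fn - RatFunc.C (u.val z))⁻¹ + RatFunc.C c) : u.d hz = b • u'.d hz' := by
  have n := u.isCoord.sub_C_ne_zero (u.val z)
  have n' := u'.isCoord.sub_C_ne_zero (u'.val z)
  set A : regFun {z} := u.reg (Y := {z}) (fun h => hz (Set.mem_singleton_iff.1 h).symm) -
    algebraMap ℂ _ (u.val z) with hA
  set B : regFun {z} := u'.reg (Y := {z}) (fun h => hz' (Set.mem_singleton_iff.1 h).symm) -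
    algebraMap ℂ _ (u'.val z) with hB
  have hA1 : (A : RatFunc ℂ) = u.fn - RatFunc.C (u.val z) := by rw [hA]; simp; rfl
  have hB1 : (B : RatFunc ℂ) = u'.fn - RatFunc.C (u'.val z) := by rw [hB]; simp; rfl
  -- This is 1/B = b/A + c multiplied by AB. The product AB lies in the square of the maximal ideal
  -- and has zero differential.
  have e : A = b • B + c • (A * B) := by
    ext1
    simp only [Subalgebra.coe_add, Subalgebra.coe_smul, Subalgebra.coe_mul, hA1, hB1,
      RatFunc.smul_eq_C_mul]
    field_simp at h
    linear_combination h
  have hz0 := Set.mem_singleton z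
  have eA : evalFun hz0 A = 0 := by rw [hA, map_sub, AlgHom.commutes]; exact sub_self (u.val z)
  have eB : evalFun hz0 B = 0 := by rw [hB, map_sub, AlgHom.commutes]; exact sub_self (u'.val z)
  have dA : dFun hz0 A = u.d hz := by rw [hA, map_sub, dFun_algebraMap, sub_zero]; rfl
  have dB : dFun hz0 B = u'.d hz' := by rw [hB, map_sub, dFun_algebraMap, sub_zero]; rfl
  rw [← dA, ← dB]
  conv_lhs => rw [e]
  rw [map_add, map_smul, map_smul, dFun_mul, eA, eB, zero_smul, zero_smul, add_zero, smul_zero,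
    add_zero]

/-- The derivative `df/du` at `z`. -/
def deriv (hz : z ∈ Y) (hzP : z ≠ P) : regFun Y →ₗ[ℂ] ℂ :=
  (evalFun hz).toLinearMap ∘ₗ u.diffQuot hz hzP

lemma deriv_apply (hz : z ∈ Y) (hzP : z ≠ P) (f : regFun Y) :
    u.deriv hz hzP f = evalFun hz (u.diffQuot hz hzP f) := rfl

lemma deriv_mul (hz : z ∈ Y) (hzP : z ≠ P) (f g : regFun Y) :
    u.deriv hz hzP (f * g) = evalFun hz f * u.deriv hz hzP g + evalFun hz g * u.deriv hz hzP f := by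
  simp only [deriv_apply, diffQuot_mul, map_add, map_mul, map_smul, smul_eq_mul]; ring

/-- First-order Taylor expansion: f = f(z) + (u - u(z)) q with q regular at z, so the Leibniz rule
leaves q(z) du_z. -/
lemma dFun_eq_deriv_smul (hz : z ∈ Y) (hzP : z ≠ P) (f : regFun Y) :
    dFun hz f = u.deriv hz hzP f • u.d hzP := by
  have hs := Set.singleton_subset_iff.2 hz
  have hz0 := Set.mem_singleton z
  have n := u.isCoord.sub_C_ne_zero (u.val z)
  set A : regFun {z} := u.reg (Y := {z}) (fun h => hzP (Set.mem_singleton_iff.1 h).symm) -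
    algebraMap ℂ _ (u.val z) with hA
  have hA1 : (A : RatFunc ℂ) = u.fn - RatFunc.C (u.val z) := by rw [hA]; simp; rfl
  have eA : evalFun hz0 A = 0 := by rw [hA, map_sub, AlgHom.commutes]; exact sub_self (u.val z)
  have dA : dFun hz0 A = u.d hzP := by rw [hA, map_sub, dFun_algebraMap, sub_zero]; rfl
  have e : resFun hs f = A * u.diffQuot hz0 hzP (resFun hs f) + algebraMap ℂ _ (evalFun hz f) := by
    ext1
    rw [Subalgebra.coe_add, Subalgebra.coe_mul, hA1, coe_algebraMap]
    change f.1 = _ * ((u.fn - RatFunc.C (u.val z))⁻¹ * (f.1 - RatFunc.C (evalFun hz f))) + _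
    field_simp
    ring
  rw [← dFun_resFun hs hz0, e, map_add, dFun_mul, dFun_algebraMap, eA, dA, zero_smul, zero_add,
    add_zero]
  rfl

/-- The functional `deriv` kills the square of the maximal ideal by the Leibniz rule, but takes the
value 1 on u - u(z). -/
lemma d_ne_zero (hzP : z ≠ P) : u.d hzP ≠ 0 := by
  intro h
  have hz0 := Set.mem_singleton z
  have h1 := (Ideal.toCotangent_eq_zero _ _).1 h
  have h2 : ∀ f ∈ maxIdeal z ^ 2, u.deriv hz0 hzP f = 0 := by
    intro f hf
    rw [pow_two] at hf
    refine Submodule.mul_induction_on hf (fun f hf g hg => ?_) (fun f g hf hg => ?_)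
    · rw [deriv_mul, show evalFun hz0 f = 0 from hf, show evalFun hz0 g = 0 from hg]; simp
    · rw [map_add, hf, hg, add_zero]
  have h3 := h2 _ h1
  have n := u.isCoord.sub_C_ne_zero (u.val z)
  rw [map_sub] at h3
  have h4 : ∀ c, u.deriv hz0 hzP (algebraMap ℂ _ c) = 0 := fun c => by
    rw [Algebra.algebraMap_eq_smul_one, map_smul]
    have := u.deriv_mul hz0 hzP 1 1
    have h5 : u.deriv hz0 hzP 1 = 0 := by simpa using this
    rw [h5, smul_zero]
  rw [h4, sub_zero] at h3
  have h6 : u.diffQuot hz0 hzP (resFun (Set.singleton_subset_iff.2 hz0)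
      (u.reg (Y := {z}) (fun h => hzP (Set.mem_singleton_iff.1 h).symm))) = 1 := by
    ext1
    exact inv_mul_cancel₀ n
  rw [deriv_apply] at h3
  erw [h6] at h3
  simp at h3

lemma exists_dual (hzP : z ≠ P) : ∃ φ : Cotan z →ₗ[ℂ] ℂ, φ (u.d hzP) = 1 ∧
    ∀ ξ, φ ξ • u.d hzP = ξ := by
  have hz0 := Set.mem_singleton z
  obtain ⟨φ, hφ⟩ := Module.Projective.exists_dual_eq_one ℂ (u.d_ne_zero hzP)
  refine ⟨φ, hφ, fun ξ => ?_⟩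
  obtain ⟨⟨f, hf⟩, rfl⟩ := (maxIdeal z).toCotangent_surjective ξ
  have : (maxIdeal z).toCotangent ⟨f, hf⟩ = dFun hz0 f := by
    change _ = (maxIdeal z).toCotangent _
    congr 1; ext1
    change f = f - algebraMap ℂ _ (evalFun hz0 f)
    rw [show evalFun hz0 f = 0 from hf, map_zero, sub_zero]
  rw [this, u.dFun_eq_deriv_smul hz0 hzP, map_smul, hφ, smul_eq_mul, mul_one]

end Coord

/-! ### Partial fractions and separation of variables in difference quotients. -/

namespace Coord
variable (u : Coord P)

/-- Over ℂ the polynomial splits, so its inverse is a constant times a product of factors 1/(x - c).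
-/
lemma inv_aeval_mem {F : Type*} [Field F] [Algebra ℂ F] {A : Subalgebra ℂ F} {x : F} {q : ℂ[X]}
    (hq : ∀ c ∈ q.roots, (x - algebraMap ℂ F c)⁻¹ ∈ A) : (Polynomial.aeval x q)⁻¹ ∈ A := by
  have hs := (IsAlgClosed.splits q).eq_prod_roots
  rw [hs, map_mul, Polynomial.aeval_C, mul_inv, ← map_inv₀, map_multiset_prod, Multiset.map_map,
    ← Multiset.prod_map_inv]
  refine A.mul_mem (A.algebraMap_mem _) (A.multiset_prod_mem fun y hy => ?_)
  obtain ⟨c, hc, rfl⟩ := Multiset.mem_map.1 hy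
  simpa using hq c hc

lemma isRegularAt_aeval (hz : z ≠ P) (p : ℂ[X]) :
    IsRegularAt z (Polynomial.aeval u.fn p) ∧
      value z (Polynomial.aeval u.fn p) = p.eval (u.val z) := by
  have hP : P ∉ ({z} : Set (OnePoint ℂ)) := fun h => hz (Set.mem_singleton_iff.1 h).symm
  have e : Polynomial.aeval u.fn p = ((Polynomial.aeval (u.reg hP) p : regFun {z}) : RatFunc ℂ) :=
    Polynomial.aeval_algHom_apply (regFun {z}).val (u.reg hP) p
  rw [e]
  refine ⟨(Polynomial.aeval (u.reg hP) p).2 z rfl, ?_⟩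
  change evalFun (Set.mem_singleton z) (Polynomial.aeval (u.reg hP) p) = _
  rw [← Polynomial.aeval_algHom_apply, ← Polynomial.coe_aeval_eq_eval]
  rfl

/-- The functions regular away from the pole of `u` are generated by `u` and the
`1 / (u - u(a))`. -/
lemma mem_adjoin {f : RatFunc ℂ} (hf : f ∈ regFun U) :
    f ∈ Algebra.adjoin ℂ ({u.fn} ∪ {g | ∃ a, a ∉ U ∧ a ≠ P ∧
      g = (u.fn - RatFunc.C (u.val a))⁻¹}) := by
  have htop : f ∈ IntermediateField.adjoin ℂ {u.fn} := by
    rw [u.isCoord.adjoin_eq_top]; trivial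
  obtain ⟨p₀, q₀, e₀⟩ := (IntermediateField.mem_adjoin_simple_iff ℂ f).1 htop
  -- The membership criterion does not exclude a zero denominator; the quotient is then 0 by
  -- convention.
  by_cases hq₀ : q₀ = 0
  · have : f = 0 := by rw [e₀, hq₀]; simp
    rw [this]; exact Subalgebra.zero_mem _
  -- `u` takes every complex value, so q(u) = 0 would make q vanish everywhere.
  have hinj : ∀ q : ℂ[X], q ≠ 0 → Polynomial.aeval u.fn q ≠ 0 := fun q hq h => by
    obtain ⟨c, hc⟩ : ∃ c, q.eval c ≠ 0 := by
      by_contra! H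
      exact hq (Polynomial.funext (by simpa using H))
    obtain ⟨w, hw, rfl⟩ := u.isCoord.exists_value_eq c
    have := (u.isRegularAt_aeval hw q).2
    rw [h] at this
    exact hc (this.symm.trans (by simpa using value_C w 0))
  obtain ⟨p, q, hpq, hq, e⟩ : ∃ p q : ℂ[X], IsCoprime p q ∧ q ≠ 0 ∧
      f * Polynomial.aeval u.fn q = Polynomial.aeval u.fn p := by
    obtain ⟨p, hp⟩ := EuclideanDomain.gcd_dvd_left p₀ q₀
    obtain ⟨q, hq⟩ := EuclideanDomain.gcd_dvd_right p₀ q₀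
    have hg : EuclideanDomain.gcd p₀ q₀ ≠ 0 := fun h => hq₀ (EuclideanDomain.gcd_eq_zero_iff.1 h).2
    have hq0 : q ≠ 0 := by rintro rfl; exact hq₀ (by simpa using hq)
    refine ⟨p, q, ?_, hq0, ?_⟩
    · obtain ⟨a, b, hab⟩ : ∃ a b, EuclideanDomain.gcd p₀ q₀ = p₀ * a + q₀ * b :=
        ⟨_, _, EuclideanDomain.gcd_eq_gcd_ab p₀ q₀⟩
      refine ⟨a, b, mul_left_cancel₀ hg ?_⟩
      linear_combination (-a) * hp - b * hq - hab
    · have h1 := hinj _ hg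
      have h2 := hinj _ hq0
      have h3 := congrArg (Polynomial.aeval u.fn) hp
      have h4 := congrArg (Polynomial.aeval u.fn) hq
      rw [map_mul] at h3 h4
      rw [e₀, h3, h4]
      field_simp
  have ef : f = Polynomial.aeval u.fn p * (Polynomial.aeval u.fn q)⁻¹ := by
    rw [eq_mul_inv_iff_mul_eq₀ (hinj q hq), e]
  rw [ef]
  refine Subalgebra.mul_mem _ ?_ (inv_aeval_mem fun c hc => Algebra.subset_adjoin (Or.inr ?_))
  · exact Algebra.adjoin_mono Set.subset_union_left (Polynomial.aeval_mem_adjoin_singleton ℂ u.fn)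
  · obtain ⟨a, ha, rfl⟩ := u.isCoord.exists_value_eq c
    refine ⟨a, fun haU => ?_, ha, by rw [RatFunc.algebraMap_eq_C]; rfl⟩
    have hq1 : q.eval (u.val a) = 0 := (Polynomial.mem_roots'.1 hc).2
    have h1 := value_mul (hf a haU) (u.isRegularAt_aeval ha q).1
    rw [e, (u.isRegularAt_aeval ha q).2, (u.isRegularAt_aeval ha p).2, hq1, mul_zero] at h1
    obtain ⟨s, t, hst⟩ := hpq
    have h2 := congrArg (Polynomial.eval (u.val a)) hst
    simp [h1, hq1] at h2

end Coord

/-- Evaluation of the first factor at `z`: `a ⊗ b ↦ a(z) b`. -/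
def evalLeft (hz : z ∈ Y) : regFun Y ⊗[ℂ] regFun Y →ₐ[ℂ] regFun Y :=
  Algebra.TensorProduct.lift ((Algebra.ofId ℂ (regFun Y)).comp (evalFun hz)) (AlgHom.id ℂ _)
    fun _ _ => Commute.all _ _

lemma evalLeft_tmul (hz : z ∈ Y) (a b : regFun Y) :
    evalLeft hz (a ⊗ₜ b) = evalFun hz a • b := by
  simp [evalLeft, Algebra.ofId_apply, Algebra.smul_def]

lemma Coord.evalFun_ker (u : Coord P) {a : OnePoint ℂ} (haP : a ≠ P) (haY : a ∉ Y) (hz : z ∈ Y)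
    (hzP : z ≠ P) : evalFun hz (u.ker haP haY) = (u.val z - u.val a)⁻¹ := by
  have h := value_mul ((u.ker haP haY).2 z hz) (isRegularAt_sub_C (u.isRegularAt hzP) (u.val a))
  change value z ((u.fn - RatFunc.C (u.val a))⁻¹ * _) = _ at h
  rw [inv_mul_cancel₀ (u.isCoord.sub_C_ne_zero _), value_sub_C (u.isRegularAt hzP),
    ← map_one (RatFunc.C (K := ℂ)), value_C] at h
  exact eq_inv_of_mul_eq_one_left h.symm

/-- The resolvent identity 1/(x - a) - 1/(z - a) = -(x - z)/((x - a)(z - a)). It separates the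
variables for these generators, and it is also what produces the poles in the OPE. -/
lemma Coord.diffQuot_ker (u : Coord P) {a : OnePoint ℂ} (haP : a ≠ P) (haY : a ∉ Y) (hz : z ∈ Y)
    (hzP : z ≠ P) :
    u.diffQuot hz hzP (u.ker haP haY) = -(evalFun hz (u.ker haP haY) • u.ker haP haY) := by
  have h1 := u.evalFun_ker haP haY hz hzP
  have h3 : u.val z - u.val a ≠ 0 := fun h =>
    haY (u.val_injective hzP haP (sub_eq_zero.1 h) ▸ hz)
  ext1
  rw [h1]
  change (u.fn - RatFunc.C (u.val z))⁻¹ * ((u.fn - RatFunc.C (u.val a))⁻¹ -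
    RatFunc.C (evalFun hz (u.ker haP haY))) =
      -((u.val z - u.val a)⁻¹ • (u.fn - RatFunc.C (u.val a))⁻¹)
  have n1 := u.isCoord.sub_C_ne_zero (u.val z)
  have n2 := u.isCoord.sub_C_ne_zero (u.val a)
  have n3 : RatFunc.C (u.val z) - RatFunc.C (u.val a) ≠ (0 : RatFunc ℂ) := by
    rw [← map_sub]; exact (map_ne_zero RatFunc.C).2 h3
  rw [h1, RatFunc.smul_eq_C_mul, map_inv₀, map_sub]
  field_simp
  ring

/-- The difference quotient `(f(x) - f(z)) / (u(x) - u(z))` is a finite sum `∑ aᵢ(z) bᵢ(x)`. -/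
lemma Coord.exists_diffQuot_eq (u : Coord P) (hP : P ∉ U) (f : regFun U) :
    ∃ t : regFun U ⊗[ℂ] regFun U, ∀ (z : OnePoint ℂ) (hz : z ∈ U),
      u.diffQuot hz (ne_of_mem_right hz hP) f = evalLeft hz t := by
  -- Regularity on U is carried along in the induction because `diffQuot` only accepts elements of
  -- `regFun U`.
  have key : ∀ g ∈ Algebra.adjoin ℂ ({u.fn} ∪ {g | ∃ a, a ∉ U ∧ a ≠ P ∧
      g = (u.fn - RatFunc.C (u.val a))⁻¹}), ∃ hg : g ∈ regFun U,
      ∃ t : regFun U ⊗[ℂ] regFun U, ∀ (z : OnePoint ℂ) (hz : z ∈ U),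
      u.diffQuot hz (ne_of_mem_right hz hP) ⟨g, hg⟩ = evalLeft hz t := by
    intro g hg
    induction hg using Algebra.adjoin_induction with
    | mem g hg =>
      rcases hg with rfl | ⟨a, haU, haP, rfl⟩
      · refine ⟨(u.reg hP).2, 1, fun z hz => ?_⟩
        rw [map_one]
        ext1
        exact inv_mul_cancel₀ (u.isCoord.sub_C_ne_zero _)
      · refine ⟨(u.ker haP haU).2, -(u.ker haP haU ⊗ₜ u.ker haP haU), fun z hz => ?_⟩
        have hzP := ne_of_mem_right hz hP
        rw [map_neg, evalLeft_tmul]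
        exact u.diffQuot_ker haP haU hz hzP
    | algebraMap c =>
      refine ⟨Subalgebra.algebraMap_mem _ c, 0, fun z hz => ?_⟩
      ext1
      change (u.fn - RatFunc.C (u.val z))⁻¹ * (algebraMap ℂ (RatFunc ℂ) c -
        RatFunc.C (value z (algebraMap ℂ (RatFunc ℂ) c))) = _
      rw [RatFunc.algebraMap_eq_C, value_C, sub_self, mul_zero, map_zero]; rfl
    | add g g' _ _ h h' =>
      obtain ⟨hg, t, ht⟩ := h
      obtain ⟨hg', t', ht'⟩ := h'
      refine ⟨add_mem hg hg', t + t', fun z hz => ?_⟩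
      rw [map_add, ← ht, ← ht', ← map_add]; rfl
    | mul g g' _ _ h h' =>
      obtain ⟨hg, t, ht⟩ := h
      obtain ⟨hg', t', ht'⟩ := h'
      -- The tensor copies the twisted Leibniz rule `diffQuot_mul`: the quotient of g times g', plus
      -- g(z) times the quotient of g'.
      refine ⟨mul_mem hg hg', t * (1 ⊗ₜ ⟨g', hg'⟩) + (⟨g, hg⟩ ⊗ₜ 1) * t', fun z hz => ?_⟩
      rw [map_add, map_mul, map_mul, evalLeft_tmul, evalLeft_tmul, ← ht, ← ht', map_one, one_smul,
        smul_mul_assoc, one_mul, ← u.diffQuot_mul]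
      rfl
  exact (key f.1 (u.mem_adjoin f.2)).2

/-! ### Generators of the vacuum modules and the natural maps between them. -/

variable {𝔤 : Type*} [LieRing 𝔤] [LieAlgebra ℂ 𝔤] {κ : LinearMap.BilinForm ℂ 𝔤}

lemma Env.of_zero {L : Type*} [LieRing L] [LieAlgebra ℂ L] : Env.of (0 : L) = 0 :=
  map_zero (UniversalEnvelopingAlgebra.ι ℂ)

lemma Env.of_neg {L : Type*} [LieRing L] [LieAlgebra ℂ L] (x : L) : Env.of (-x) = -Env.of x :=
  map_neg (UniversalEnvelopingAlgebra.ι ℂ) x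

namespace Cur

lemma tmul_add (f : regFun Y) (x y : 𝔤) : tmul f (x + y) = tmul f x + tmul f y :=
  map_add (mk f) x y
lemma add_tmul (f g : regFun Y) (x : 𝔤) : tmul (f + g) x = tmul f x + tmul g x := by
  simp only [← mk_apply, map_add, LinearMap.add_apply]
lemma smul_tmul (c : ℂ) (f : regFun Y) (x : 𝔤) : tmul (c • f) x = c • tmul f x := by
  simp only [← mk_apply, map_smul, LinearMap.smul_apply]
lemma tmul_smul (c : ℂ) (f : regFun Y) (x : 𝔤) : tmul f (c • x) = c • tmul f x :=
  map_smul (mk f) c x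

lemma map_tmul (φ : regFun Y →ₐ[ℂ] regFun Y') (f : regFun Y) (x : 𝔤) :
    map φ (tmul f x) = tmul (φ f) x := rfl

lemma const_apply (x : 𝔤) : const Y x = tmul 1 x := rfl

lemma eval_const (hz : z ∈ Y) (x : 𝔤) : eval hz (const Y x) = x := by
  rw [const_apply, eval_tmul, map_one, one_smul]

end Cur

namespace Vac

lemma mk_surjective : Function.Surjective (mk : Env (Cur 𝔤 Y) → Vac 𝔤 Y) :=
  Submodule.Quotient.mk_surjective _

/-- The vacuum generates the module and currents are sums of terms f x, so operators defined by the
recursion can be compared one factor f x at a time. -/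
lemma induction {p : Vac 𝔤 Y → Prop} (m : Vac 𝔤 Y) (vac : p vac)
    (add : ∀ m n, p m → p n → p (m + n)) (smul : ∀ (c : ℂ) m, p m → p (c • m))
    (act : ∀ (f : regFun Y) (x : 𝔤) m, p m → p (Env.of (Cur.tmul f x) • m)) : p m := by
  obtain ⟨a, rfl⟩ := mk_surjective m
  induction a using Env.induction with
  | one => exact vac
  | add a b ha hb => rw [map_add]; exact add _ _ ha hb
  | smul c a ha => rw [map_smul]; exact smul c _ ha
  | mul l a ha =>
    rw [← smul_mk]
    induction l using Cur.induction with
    | zero => rw [Env.of_zero, zero_smul, ← zero_smul ℂ (mk a)]; exact smul 0 _ ha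
    | add l l' hl hl' => rw [Env.of_add, add_smul]; exact add _ _ hl hl'
    | tmul f x => exact act f x _ ha

lemma map_smul_of (φ : regFun Y →ₐ[ℂ] regFun Y') (α : Cur 𝔤 Y) (m : Vac 𝔤 Y) :
    map φ (Env.of α • m) = Env.of (Cur.map φ α) • map φ m := by
  obtain ⟨a, rfl⟩ := mk_surjective m
  rw [smul_mk, map_mk, map_mk, smul_mk, map_mul, Env.map_of]

lemma map_vac (φ : regFun Y →ₐ[ℂ] regFun Y') : map φ (vac : Vac 𝔤 Y) = vac := by
  rw [vac, map_mk, map_one]; rfl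

lemma res_smul_of (h : Y' ⊆ Y) (α : Cur 𝔤 Y) (m : Vac 𝔤 Y) :
    res h (Env.of α • m) = Env.of (Cur.map (resFun h) α) • res h m := map_smul_of _ _ _

lemma res_vac (h : Y' ⊆ Y) : res h (vac : Vac 𝔤 Y) = vac := map_vac _

lemma res_res {Y'' : Set (OnePoint ℂ)} (h : Y' ⊆ Y) (h' : Y'' ⊆ Y') (m : Vac 𝔤 Y) :
    res h' (res h m) = res (h'.trans h) m := by
  induction m using induction with
  | vac => simp only [res_vac]
  | add m n hm hn => simp only [map_add, hm, hn]
  | smul c m hm => simp only [map_smul, hm]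
  | act f x m hm => simp only [res_smul_of, hm]; rfl

end Vac

/-! ### Splitting off the constants: bijectivity of the identification (0). -/

section Ident

lemma ident_one (hP : P ∈ Y) : ident (𝔤 := 𝔤) hP 1 = Vac.vac := by
  simp [ident, Vac.vac]

lemma ident_of_mul (hP : P ∈ Y) (α : CurMinus 𝔤 hP) (x : Env (CurMinus 𝔤 hP)) :
    ident hP (Env.of α * x) = Env.of α.1 • ident hP x := by
  simp only [ident, LinearMap.comp_apply, AlgHom.toLinearMap_apply, map_mul, Env.map_of,
    Vac.smul_mk]
  rfl

lemma const_lie_mem (hP : P ∈ Y) (x : 𝔤) (α : CurMinus 𝔤 hP) :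
    ⁅Cur.const Y x, α.1⁆ ∈ CurMinus 𝔤 hP := by
  change Cur.eval hP _ = 0
  rw [LieHom.map_lie, show Cur.eval hP α.1 = 0 from α.2, lie_zero]

/-- Constants act on the maps vanishing at `P`. -/
def constAd (hP : P ∈ Y) : 𝔤 →ₗ[ℂ] CurMinus 𝔤 hP →ₗ[ℂ] CurMinus 𝔤 hP :=
  LinearMap.mk₂ ℂ (fun x α => ⟨⁅Cur.const Y x, α.1⁆, const_lie_mem hP x α⟩)
    (fun _ _ _ => Subtype.ext (by simp)) (fun _ _ _ => Subtype.ext (by simp))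
    (fun _ _ _ => Subtype.ext (by simp)) (fun _ _ _ => Subtype.ext (by simp))

lemma coe_constAd (hP : P ∈ Y) (x : 𝔤) (α : CurMinus 𝔤 hP) :
    (constAd hP x α : Cur 𝔤 Y) = ⁅Cur.const Y x, α.1⁆ := rfl

/-- The action of constants on the maps vanishing at `P` extends to derivations of the enveloping
algebra. -/
lemma exists_constDer (hP : P ∈ Y) :
    ∃ D : 𝔤 →ₗ[ℂ] Env (CurMinus 𝔤 hP) →ₗ[ℂ] Env (CurMinus 𝔤 hP), (∀ x, D x 1 = 0) ∧
      ∀ x α a, D x (Env.of α * a) = Env.of α * D x a + Env.of (constAd hP x α) * a := by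
  -- With zero evaluation, zero pairing and `K = ℂ`, the recursion becomes the Leibniz rule i_v(l m)
  -- = l i_v(m) + δ_v(l) m, and its compatibility condition becomes the Jacobi identity.
  obtain ⟨F, hF⟩ := exists_rec (M := Env (CurMinus 𝔤 hP)) (K := ℂ) (0 : CurMinus 𝔤 hP →ₗ⁅ℂ⁆ 𝔤)
    (constAd hP) 0 1
    (fun v α β => Subtype.ext (by
      simp only [coe_constAd, LieSubalgebra.coe_bracket, LieHom.zero_apply, lie_zero, map_zero,
        LinearMap.zero_apply, sub_zero, add_zero, AddMemClass.coe_add]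
      rw [leibniz_lie, add_comm])) (fun v α β => by simp)
  have h1 : ∀ x n, (F x n).1 = x * n.1 := fun x n => by
    induction x using Env.induction with
    | one => simp
    | add a b ha hb => simp [ha, hb, add_mul]
    | smul c a ha => simp [ha]
    | mul l a ha => simp only [map_mul, Module.End.mul_apply, hF, recStep_fst, ha, mul_assoc,
        smul_eq_mul]
  have hr : ∀ (α : CurMinus 𝔤 hP) (t : Env (CurMinus 𝔤 hP) ⊗[ℂ] ℂ),
      TensorProduct.rid ℂ _ ((act (Env (CurMinus 𝔤 hP)) (Env.of α)).rTensor ℂ t) =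
        Env.of α * TensorProduct.rid ℂ _ t := fun α t => by
    induction t using TensorProduct.induction_on with
    | zero => simp
    | add a b ha hb => simp only [map_add, ha, hb, mul_add]
    | tmul a c => simp [act_apply]
  refine ⟨LinearMap.mk₂ ℂ (fun v x => TensorProduct.rid ℂ _ ((F x (1, 0)).2 v))
    (fun v w x => by rw [map_add, map_add]) (fun c v x => by rw [map_smul, map_smul])
    (fun v x y => by simp) (fun c v x => by simp), ?_, ?_⟩
  · intro v; simp
  · intro v α β
    simp [map_mul, Module.End.mul_apply, hF, recStep_snd, h1, hr]

/-- Projection to the maps vanishing at `P` along the constants. -/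
def minusProj (hP : P ∈ Y) : Cur 𝔤 Y →ₗ[ℂ] CurMinus 𝔤 hP where
  toFun α := ⟨α - Cur.const Y (Cur.eval hP α), by
    change Cur.eval hP _ = 0
    rw [map_sub, Cur.eval_const, sub_self]⟩
  map_add' α β := Subtype.ext (by simp only [map_add, AddMemClass.coe_add]; abel)
  map_smul' c α := Subtype.ext (by simp [smul_sub])

lemma coe_minusProj (hP : P ∈ Y) (α : Cur 𝔤 Y) :
    (minusProj hP α : Cur 𝔤 Y) = α - Cur.const Y (Cur.eval hP α) := rfl

attribute [local instance] LieRing.ofAssociativeRing in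
/-- The `U(𝔤^Y)`-module structure on `U(𝔤^Y_{P,-})` in which constants act by derivations. -/
lemma exists_envAction (hP : P ∈ Y) :
    ∃ F : Env (Cur 𝔤 Y) →ₐ[ℂ] Module.End ℂ (Env (CurMinus 𝔤 hP)),
      (∀ x, F (Env.of (Cur.const Y x)) 1 = 0) ∧
      ∀ (α : CurMinus 𝔤 hP) a, F (Env.of α.1) a = Env.of α * a := by
  obtain ⟨D, hD1, hD⟩ := exists_constDer (𝔤 := 𝔤) hP
  -- A commutator of derivations is a derivation, so it suffices to compare on generators, where
  -- this is the Jacobi identity.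
  have hDD : ∀ x y a, D ⁅x, y⁆ a = D x (D y a) - D y (D x a) := fun x y a => by
    induction a using Env.induction with
    | one => simp [hD1]
    | add a b ha hb => simp only [map_add, ha, hb]; abel
    | smul c a ha => simp only [map_smul, ha, smul_sub]
    | mul α a ha =>
      have : constAd hP ⁅x, y⁆ α =
          constAd hP x (constAd hP y α) - constAd hP y (constAd hP x α) := Subtype.ext (by
        simp only [coe_constAd, LieHom.map_lie, AddSubgroupClass.coe_sub, lie_lie])
      simp only [hD, map_add, ha, this, Env.of_sub, sub_mul, mul_sub]
      abel
  -- Decompose α = (α - α(P)) + α(P): the first summand acts by left multiplication, the constant by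
  -- its derivation.
  let R : Cur 𝔤 Y →ₗ⁅ℂ⁆ Module.End ℂ (Env (CurMinus 𝔤 hP)) :=
    { (LinearMap.mul ℂ (Env (CurMinus 𝔤 hP)) ∘ₗ
        (UniversalEnvelopingAlgebra.ι ℂ : _ →ₗ⁅ℂ⁆ _).toLinearMap ∘ₗ minusProj hP +
        D ∘ₗ (Cur.eval hP).toLinearMap) with
      map_lie' := by
        intro α β
        refine LinearMap.ext fun a => ?_
        have hR : ∀ α a, (LinearMap.mul ℂ (Env (CurMinus 𝔤 hP)) ∘ₗ
          (UniversalEnvelopingAlgebra.ι ℂ : _ →ₗ⁅ℂ⁆ _).toLinearMap ∘ₗ minusProj hP +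
          D ∘ₗ (Cur.eval hP).toLinearMap) α a =
            Env.of (minusProj hP α) * a + D (Cur.eval hP α) a := fun _ _ => rfl
        change (LinearMap.mul ℂ (Env (CurMinus 𝔤 hP)) ∘ₗ
          (UniversalEnvelopingAlgebra.ι ℂ : _ →ₗ⁅ℂ⁆ _).toLinearMap ∘ₗ minusProj hP +
          D ∘ₗ (Cur.eval hP).toLinearMap) ⁅α, β⁆ a = _
        rw [LieRing.of_associative_ring_bracket, LinearMap.sub_apply, Module.End.mul_apply,
          Module.End.mul_apply]
        simp only [AddHom.toFun_eq_coe, LinearMap.coe_toAddHom, hR]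
        -- Constants normalise the maps vanishing at P. In the bracket of α and β the
        -- constant-constant term is the value at P and is removed by the projection, which leaves
        -- the inner bracket and two adjoint terms.
        have e : minusProj hP ⁅α, β⁆ = ⁅minusProj hP α, minusProj hP β⁆ +
            constAd hP (Cur.eval hP α) (minusProj hP β) -
            constAd hP (Cur.eval hP β) (minusProj hP α) := Subtype.ext (by
          simp only [AddSubgroupClass.coe_sub, AddMemClass.coe_add, LieSubalgebra.coe_bracket,
            coe_minusProj, coe_constAd, LieHom.map_lie, lie_sub, sub_lie]
          rw [← lie_skew (Cur.const Y (Cur.eval hP β)) α,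
            ← lie_skew (Cur.const Y (Cur.eval hP β)) (Cur.const Y (Cur.eval hP α))]
          abel)
        rw [e, LieHom.map_lie, hDD]
        simp only [map_add, hD, Env.of_add, Env.of_sub, Env.of_lie, sub_mul, add_mul, mul_add,
          mul_assoc]
        abel }
  have hR : ∀ α a, R α a = Env.of (minusProj hP α) * a + D (Cur.eval hP α) a := fun _ _ => rfl
  refine ⟨UniversalEnvelopingAlgebra.lift ℂ R, fun x => ?_, fun α a => ?_⟩
  · rw [Env.of, UniversalEnvelopingAlgebra.lift_ι_apply, hR, hD1]
    have : minusProj hP (Cur.const Y x) = 0 := Subtype.ext (by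
      rw [coe_minusProj, Cur.eval_const, sub_self]; rfl)
    rw [this, Env.of_zero, zero_mul, zero_add]
  · rw [Env.of, UniversalEnvelopingAlgebra.lift_ι_apply, hR]
    have h0 : Cur.eval hP α.1 = 0 := α.2
    have : minusProj hP α.1 = α := Subtype.ext (by
      rw [coe_minusProj, h0, map_zero, sub_zero])
    rw [this, h0, map_zero, LinearMap.zero_apply, add_zero]

/-- Injectivity: in the action of `exists_envAction`, the ideal kills 1 while the image of x sends 1
to x. Surjectivity: the range contains the vacuum and is stable under maps vanishing at P and under
constants. -/
theorem ident_bijective (hP : P ∈ Y) : Function.Bijective (ident (𝔤 := 𝔤) hP) := by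
  constructor
  · obtain ⟨F, hF0, hF⟩ := exists_envAction (𝔤 := 𝔤) hP
    have h0 : ∀ a ∈ vacIdeal 𝔤 Y, F a 1 = 0 := fun a ha => by
      refine Submodule.span_induction ?_ (by simp) ?_ ?_ ha
      · rintro _ ⟨x, rfl⟩; exact hF0 x
      · intro a b _ _ ha hb; rw [map_add, LinearMap.add_apply, ha, hb, add_zero]
      · intro a b _ hb; rw [smul_eq_mul, map_mul, Module.End.mul_apply, hb, map_zero]
    have h1 : ∀ x y : Env (CurMinus 𝔤 hP), F (Env.map (CurMinus 𝔤 hP).incl x) y = x * y :=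
      fun x y => by
        induction x using Env.induction with
        | one => simp
        | add a b ha hb => simp [ha, hb, add_mul]
        | smul c a ha => simp [ha]
        | mul l a ha =>
          rw [map_mul, map_mul, Module.End.mul_apply, ha, Env.map_of, mul_assoc]
          exact hF l _
    refine (injective_iff_map_eq_zero (ident (𝔤 := 𝔤) hP)).2 fun x hx => ?_
    have h2 : Env.map (CurMinus 𝔤 hP).incl x ∈ vacIdeal 𝔤 Y :=
      (Submodule.Quotient.mk_eq_zero _).1 hx
    simpa [h1] using h0 _ h2
  -- A constant is commuted to the right past each factor, at the cost of a bracket that again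
  -- vanishes at P, until it reaches the vacuum and dies.
  · have hc : ∀ (x : 𝔤) (a : Env (CurMinus 𝔤 hP)), ∃ b, ident hP b =
        Env.of (Cur.const Y x) • ident hP a := fun x a => by
      induction a using Env.induction with
      | one => exact ⟨0, by rw [map_zero, ident_one, Vac.const_smul_vac]⟩
      | add a b ha hb =>
        obtain ⟨a', ha⟩ := ha
        obtain ⟨b', hb⟩ := hb
        exact ⟨a' + b', by rw [map_add, map_add, smul_add, ha, hb]⟩
      | smul c a ha =>
        obtain ⟨a', ha⟩ := ha
        exact ⟨c • a', by rw [map_smul, map_smul, ha, smul_comm]⟩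
      | mul α a ha =>
        obtain ⟨a', ha⟩ := ha
        refine ⟨Env.of (constAd hP x α) * a + Env.of α * a', ?_⟩
        rw [map_add, ident_of_mul, ident_of_mul, ident_of_mul, ha, coe_constAd, Env.of_lie,
          sub_smul, mul_smul, mul_smul, sub_add_cancel]
    intro m
    induction m using Vac.induction with
    | vac => exact ⟨1, ident_one hP⟩
    | add m n hm hn =>
      obtain ⟨a, rfl⟩ := hm
      obtain ⟨b, rfl⟩ := hn
      exact ⟨a + b, map_add _ _ _⟩
    | smul c m hm => obtain ⟨a, rfl⟩ := hm; exact ⟨c • a, map_smul _ _ _⟩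
    | act f x m hm =>
      obtain ⟨a, rfl⟩ := hm
      obtain ⟨b, hb⟩ := hc (Cur.eval hP (Cur.tmul f x)) a
      refine ⟨Env.of (minusProj hP (Cur.tmul f x)) * a + b, ?_⟩
      rw [map_add, ident_of_mul, hb, coe_minusProj, Env.of_sub, sub_smul, sub_add_cancel]

end Ident

/-! ### ε and ι on the vacuum modules, and their agreement with the base-point versions. -/

lemma epsVac_apply (u : Coord P) (hzP : z ≠ P) (hz : z ∉ Y) (v : 𝔤) (m : Vac 𝔤 Y) :
    epsVac u hzP hz v m = (Env.of (Cur.tmul (u.ker hzP hz) v) • m) ⊗ₜ u.d hzP := rfl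

lemma IsIotaVac.apply_smul {u : Coord P} {hz : z ∈ Y} {hzP : z ≠ P}
    {i : 𝔤 →ₗ[ℂ] Vac 𝔤 Y →ₗ[ℂ] Vac 𝔤 Y ⊗[ℂ] Cotan z} (hi : IsIotaVac κ u hz hzP i) (v : 𝔤)
    (α : Cur 𝔤 Y) (m : Vac 𝔤 Y) :
    i v (Env.of α • m) = (act (Vac 𝔤 Y) (Env.of α)).rTensor (Cotan z) (i v m) +
      ((Env.of (kerComm u hz hzP v α) • m) ⊗ₜ u.d hzP - m ⊗ₜ pairD κ hz v α +
        i ⁅v, Cur.eval hz α⁆ m) :=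
  eq_add_of_sub_eq' (hi.comm v α m)

lemma iotaVac_vac (hκ : κ.lieInvariant 𝔤) (u : Coord P) (hz : z ∈ Y) (hzP : z ≠ P) (v : 𝔤) :
    iotaVac hκ u hz hzP v Vac.vac = 0 := (isIotaVac_iotaVac hκ u hz hzP).vac v

lemma iotaVac_smul (hκ : κ.lieInvariant 𝔤) (u : Coord P) (hz : z ∈ Y) (hzP : z ≠ P) (v : 𝔤)
    (α : Cur 𝔤 Y) (m : Vac 𝔤 Y) :
    iotaVac hκ u hz hzP v (Env.of α • m) =
      (act (Vac 𝔤 Y) (Env.of α)).rTensor (Cotan z) (iotaVac hκ u hz hzP v m) +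
      ((Env.of (kerComm u hz hzP v α) • m) ⊗ₜ u.d hzP - m ⊗ₜ pairD κ hz v α +
        iotaVac hκ u hz hzP ⁅v, Cur.eval hz α⁆ m) :=
  (isIotaVac_iotaVac hκ u hz hzP).apply_smul v α m

/-- The vacuum generates, so the recursion leaves no choice. An operator is thus recognised as ι by
checking the recursion alone. -/
lemma IsIotaVac.eq {u : Coord P} {hz : z ∈ Y} {hzP : z ≠ P}
    {i i' : 𝔤 →ₗ[ℂ] Vac 𝔤 Y →ₗ[ℂ] Vac 𝔤 Y ⊗[ℂ] Cotan z} (hi : IsIotaVac κ u hz hzP i)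
    (hi' : IsIotaVac κ u hz hzP i') : i = i' := by
  refine LinearMap.ext fun v => LinearMap.ext fun m => ?_
  -- `v` must vary, because the recursion replaces v by [v, α(z)].
  induction m using Vac.induction generalizing v with
  | vac => rw [hi.vac, hi'.vac]
  | add m n hm hn => rw [map_add, map_add, hm, hn]
  | smul c m hm => rw [map_smul, map_smul, hm]
  | act f x m hm => rw [hi.apply_smul, hi'.apply_smul, hm, hm]

section Base

lemma rTensor_ident_mulLeft (hP : P ∈ Y) (α : CurMinus 𝔤 hP)
    (t : Env (CurMinus 𝔤 hP) ⊗[ℂ] Cotan z) :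
    (ident hP).rTensor (Cotan z) ((LinearMap.mulLeft ℂ (Env.of α)).rTensor (Cotan z) t) =
      (act (Vac 𝔤 Y) (Env.of α.1)).rTensor (Cotan z) ((ident hP).rTensor (Cotan z) t) := by
  induction t using TensorProduct.induction_on with
  | zero => simp
  | add a b ha hb => simp only [map_add, ha, hb]
  | tmul a k => simp only [LinearMap.rTensor_tmul, LinearMap.mulLeft_apply, ident_of_mul, act_apply]

theorem epsVac_ident (u : Coord P) (hP : P ∈ Y) (hz : z ∉ Y) (hzP : z ≠ P) (v : 𝔤)
    (x : Env (CurMinus 𝔤 hP)) :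
    epsVac u hzP hz v (ident hP x) = (ident hP).rTensor (Cotan z) (eps u hP hz v x) := by
  change _ = ident hP (Env.of (kerMinus u hP hz v) * x) ⊗ₜ _
  rw [ident_of_mul]; rfl

/-- For maps α vanishing at P, the recursion on `Vac 𝔤 Y` is literally the one on U(𝔤^Y_{P,-}). -/
theorem iotaVac_ident (hκ : κ.lieInvariant 𝔤) (u : Coord P) (hP : P ∈ Y) (hz : z ∈ Y)
    (hzP : z ≠ P) (v : 𝔤) (x : Env (CurMinus 𝔤 hP)) :
    iotaVac hκ u hz hzP v (ident hP x) =
      (ident hP).rTensor (Cotan z) (iota hκ u hP hz hzP v x) := by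
  induction x using Env.induction generalizing v with
  | one => rw [ident_one, iotaVac_vac, (isIota_iota hκ u hP hz hzP).vac, map_zero]
  | add a b ha hb => simp only [map_add, ha, hb]
  | smul c a ha => simp only [map_smul, ha]
  | mul α a ha =>
    rw [ident_of_mul, iotaVac_smul, eq_add_of_sub_eq' ((isIota_iota hκ u hP hz hzP).comm v α a)]
    simp only [map_add, map_sub, rTensor_ident_mulLeft, ha, LinearMap.rTensor_tmul, ident_of_mul]
    rfl

lemma ident_resMinus (h : Y' ⊆ Y) (hP : P ∈ Y') (x : Env (CurMinus 𝔤 (h hP))) :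
    ident hP (Env.map (resMinus h hP) x) = Vac.res h (ident (h hP) x) := by
  induction x using Env.induction with
  | one => rw [map_one, ident_one, ident_one, Vac.res_vac]
  | add a b ha hb => simp only [map_add, ha, hb]
  | smul c a ha => simp only [map_smul, ha]
  | mul α a ha => rw [map_mul, Env.map_of, ident_of_mul, ident_of_mul, Vac.res_smul_of, ha]; rfl

end Base

/-! ### Naturality of ι under changes of functions. -/

section Functoriality

lemma map_rTensor_act (φ : regFun Y →ₐ[ℂ] regFun Y') (ψ : Cotan z →ₗ[ℂ] Cotan w) (α : Cur 𝔤 Y)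
    (t : Vac 𝔤 Y ⊗[ℂ] Cotan z) :
    TensorProduct.map (Vac.map φ) ψ ((act (Vac 𝔤 Y) (Env.of α)).rTensor (Cotan z) t) =
      (act (Vac 𝔤 Y') (Env.of (Cur.map φ α))).rTensor (Cotan w)
        (TensorProduct.map (Vac.map φ) ψ t) := by
  induction t using TensorProduct.induction_on with
  | zero => simp
  | add a b ha hb => simp only [map_add, ha, hb]
  | tmul a k => simp only [LinearMap.rTensor_tmul, TensorProduct.map_tmul, act_apply,
      Vac.map_smul_of]

/-- The recursion only sees difference quotients, values, differentials and du_z; a map of functions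
that respects these four carries one ι to the other. Restrictions and automorphisms of the line are
both instances. -/
theorem iotaVac_map (hκ : κ.lieInvariant 𝔤) (φ : regFun Y →ₐ[ℂ] regFun Y')
    (ψ : Cotan z →ₗ[ℂ] Cotan w) (u : Coord P) (u' : Coord P') (hz : z ∈ Y) (hw : w ∈ Y')
    (hzP : z ≠ P) (hwP : w ≠ P')
    (hq : ∀ f, u'.diffQuot hw hwP (φ f) = φ (u.diffQuot hz hzP f))
    (he : ∀ f, evalFun hw (φ f) = evalFun hz f) (hd : ∀ f, dFun hw (φ f) = ψ (dFun hz f))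
    (hu : u'.d hwP = ψ (u.d hzP)) (v : 𝔤) (m : Vac 𝔤 Y) :
    iotaVac hκ u' hw hwP v (Vac.map φ m) =
      TensorProduct.map (Vac.map φ) ψ (iotaVac hκ u hz hzP v m) := by
  induction m using Vac.induction generalizing v with
  | vac => rw [Vac.map_vac, iotaVac_vac, iotaVac_vac, map_zero]
  | add m n hm hn => simp only [map_add, hm, hn]
  | smul c m hm => simp only [map_smul, hm]
  | act f x m hm =>
    have h1 : kerComm u' hw hwP v (Cur.map φ (Cur.tmul f x)) =
        Cur.map φ (kerComm u hz hzP v (Cur.tmul f x)) := by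
      rw [Cur.map_tmul, kerComm_tmul, kerComm_tmul, map_neg, Cur.map_tmul, hq]
    have h2 : pairD κ hw v (Cur.map φ (Cur.tmul f x)) = ψ (pairD κ hz v (Cur.tmul f x)) := by
      rw [Cur.map_tmul, pairD_tmul, pairD_tmul, map_smul, hd]
    have h3 : Cur.eval hw (Cur.map φ (Cur.tmul f x)) = Cur.eval hz (Cur.tmul f x) := by
      rw [Cur.map_tmul, Cur.eval_tmul, Cur.eval_tmul, he]
    rw [Vac.map_smul_of, iotaVac_smul, iotaVac_smul, h1, h2, h3]
    simp only [map_add, map_sub, hm, map_rTensor_act, TensorProduct.map_tmul, Vac.map_smul_of, hu]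

theorem iotaVac_res (hκ : κ.lieInvariant 𝔤) (h : Y' ⊆ Y) (u : Coord P) (hz : z ∈ Y')
    (hzP : z ≠ P) (v : 𝔤) (m : Vac 𝔤 Y) :
    iotaVac hκ u hz hzP v (Vac.res h m) =
      (Vac.res h).rTensor (Cotan z) (iotaVac hκ u (h hz) hzP v m) :=
  iotaVac_map hκ (resFun h) LinearMap.id u u (h hz) hz hzP hzP (fun _ => rfl) (fun _ => rfl)
    (fun _ => rfl) rfl v m

lemma epsVac_res (h : Y' ⊆ Y) (u : Coord P) (hz : z ∉ Y) (hzP : z ≠ P) (v : 𝔤) (m : Vac 𝔤 Y) :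
    epsVac u hzP (fun h' => hz (h h')) v (Vac.res h m) =
      (Vac.res h).rTensor (Cotan z) (epsVac u hzP hz v m) := by
  rw [epsVac_apply, epsVac_apply, LinearMap.rTensor_tmul, Vac.res_smul_of]; rfl

end Functoriality

/-! ### Dependence of ε and ι on the coordinate. -/

section ChangeOfCoordinate
variable {u : Coord P} {u' : Coord P'} {b c : ℂ}

/-- The factor b of the kernel is absorbed by du_z = b du'_z; the constant c turns v into a constant
current. -/
theorem epsVac_of_ker_eq (hzP : z ≠ P) (hzP' : z ≠ P') (hz : z ∉ Y)
    (h : (u'.fn - RatFunc.C (u'.val z))⁻¹ =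
      RatFunc.C b * (u.fn - RatFunc.C (u.val z))⁻¹ + RatFunc.C c) (v : 𝔤) (m : Vac 𝔤 Y) :
    epsVac u' hzP' hz v m =
      epsVac u hzP hz v m + (Env.of (Cur.const Y v) • m) ⊗ₜ (c • u'.d hzP') := by
  have h1 : u'.ker hzP' hz = b • u.ker hzP hz + c • 1 := by
    ext1
    simp only [Subalgebra.coe_add, Subalgebra.coe_smul, RatFunc.smul_eq_C_mul, OneMemClass.coe_one,
      mul_one]
    exact h
  rw [epsVac_apply, epsVac_apply, h1, Coord.d_eq_of_ker_eq hzP hzP' h, Cur.const_apply,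
    Cur.add_tmul, Cur.smul_tmul, Cur.smul_tmul, Env.of_add, Env.of_smul, Env.of_smul, add_smul,
    smul_assoc, smul_assoc, TensorProduct.add_tmul, TensorProduct.tmul_smul,
    TensorProduct.tmul_smul, TensorProduct.smul_tmul', TensorProduct.smul_tmul']

/-- The action of constants, tensored with a fixed cotangent vector. -/
def constTmul (Y : Set (OnePoint ℂ)) (ξ : Cotan z) : 𝔤 →ₗ[ℂ] Vac 𝔤 Y →ₗ[ℂ] Vac 𝔤 Y ⊗[ℂ] Cotan z :=
  LinearMap.mk₂ ℂ (fun v m => (Env.of (Cur.const Y v) • m) ⊗ₜ ξ)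
    (fun v w m => by rw [map_add, Env.of_add, add_smul, TensorProduct.add_tmul])
    (fun c v m => by rw [map_smul, Env.of_smul, smul_assoc, TensorProduct.smul_tmul'])
    (fun v m n => by rw [smul_add, TensorProduct.add_tmul])
    (fun c v m => by rw [smul_comm, TensorProduct.smul_tmul'])

lemma constTmul_apply (ξ : Cotan z) (v : 𝔤) (m : Vac 𝔤 Y) :
    constTmul Y ξ v m = (Env.of (Cur.const Y v) • m) ⊗ₜ ξ := rfl

/-- The difference quotient of f changes by c (f - f(z)). Bracketing with v turns this into c times
[v, α] - [v, α(z)]. -/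
lemma kerComm_of_ker_eq (hzP : z ≠ P) (hzP' : z ≠ P') (hz : z ∈ Y)
    (h : (u'.fn - RatFunc.C (u'.val z))⁻¹ =
      RatFunc.C b * (u.fn - RatFunc.C (u.val z))⁻¹ + RatFunc.C c) (v : 𝔤) (α : Cur 𝔤 Y) :
    kerComm u' hz hzP' v α = b • kerComm u hz hzP v α -
      c • (⁅Cur.const Y v, α⁆ - Cur.const Y ⁅v, Cur.eval hz α⁆) := by
  induction α using Cur.induction with
  | zero => simp
  | add α β hα hβ => simp only [map_add, hα, hβ, lie_add, smul_add, smul_sub]; abel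
  | tmul f x =>
    have h1 : u'.diffQuot hz hzP' f =
        b • u.diffQuot hz hzP f + c • (f - evalFun hz f • (1 : regFun Y)) := by
      ext1
      simp only [Subalgebra.coe_add, Subalgebra.coe_smul, AddSubgroupClass.coe_sub,
        RatFunc.smul_eq_C_mul, OneMemClass.coe_one, mul_one]
      change (u'.fn - RatFunc.C (u'.val z))⁻¹ * (f.1 - RatFunc.C (value z f.1)) =
        RatFunc.C b * ((u.fn - RatFunc.C (u.val z))⁻¹ * (f.1 - RatFunc.C (value z f.1))) +
          RatFunc.C c * (f.1 - RatFunc.C (value z f.1))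
      rw [h]; ring
    rw [kerComm_tmul, kerComm_tmul, h1, Cur.const_apply, Cur.const_apply, Cur.lie_tmul, one_mul,
      Cur.eval_tmul, lie_smul, Cur.tmul_smul, Cur.add_tmul, Cur.smul_tmul, Cur.smul_tmul,
      sub_eq_add_neg f, ← neg_smul, Cur.add_tmul, Cur.smul_tmul]
    module

theorem iotaVac_of_ker_eq (hκ : κ.lieInvariant 𝔤) (hzP : z ≠ P) (hzP' : z ≠ P') (hz : z ∈ Y)
    (h : (u'.fn - RatFunc.C (u'.val z))⁻¹ =
      RatFunc.C b * (u.fn - RatFunc.C (u.val z))⁻¹ + RatFunc.C c) (v : 𝔤) (m : Vac 𝔤 Y) :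
    iotaVac hκ u' hz hzP' v m =
      iotaVac hκ u hz hzP v m - (Env.of (Cur.const Y v) • m) ⊗ₜ (c • u'.d hzP') := by
  -- By uniqueness it is enough that the corrected operator satisfies the recursion for `u'`:
  -- constants kill the vacuum, and the commutator of v with α accounts for the change in `kerComm`.
  suffices H : IsIotaVac κ u' hz hzP' (iotaVac hκ u hz hzP - constTmul Y (c • u'.d hzP')) by
    rw [(isIotaVac_iotaVac hκ u' hz hzP').eq H]; rfl
  constructor
  · intro v
    rw [LinearMap.sub_apply, LinearMap.sub_apply, iotaVac_vac, constTmul_apply,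
      Vac.const_smul_vac, TensorProduct.zero_tmul, sub_zero]
  · intro v α m
    simp only [LinearMap.sub_apply, iotaVac_smul, constTmul_apply, kerComm_of_ker_eq hzP hzP' hz h,
      Coord.d_eq_of_ker_eq hzP hzP' h, Env.of_sub, Env.of_smul, Env.of_lie, sub_smul, smul_assoc,
      mul_smul, TensorProduct.sub_tmul, TensorProduct.tmul_smul, TensorProduct.smul_tmul', map_sub,
      LinearMap.rTensor_tmul, act_apply, smul_sub, map_smul]
    abel

end ChangeOfCoordinate

/-- With a = u(z), 1/(1/u - 1/a) = -ua/(u - a) = -a²/(u - a) - a, and a = 1/u'(z). -/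
lemma ker_eq_of_fn_eq_inv {u : Coord P} {u' : Coord P'} (h : u'.fn = u.fn⁻¹) (hzP : z ≠ P)
    (hzP' : z ≠ P') : (u'.fn - RatFunc.C (u'.val z))⁻¹ =
      RatFunc.C (-(u.val z) ^ 2) * (u.fn - RatFunc.C (u.val z))⁻¹ + RatFunc.C (-(u'.val z)⁻¹) := by
  have h1 := value_mul (u.isRegularAt hzP) (u'.isRegularAt hzP')
  rw [h, mul_inv_cancel₀ u.isCoord.ne_zero, ← h, ← map_one (RatFunc.C (K := ℂ)), value_C] at h1
  change 1 = u.val z * u'.val z at h1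
  have h2 : u.val z ≠ 0 := left_ne_zero_of_mul (h1 ▸ one_ne_zero)
  have h3 : u'.val z = (u.val z)⁻¹ := eq_inv_of_mul_eq_one_right h1.symm
  have n0 := u.isCoord.ne_zero
  have n1 := u.isCoord.sub_C_ne_zero (u.val z)
  have n2 : RatFunc.C (u.val z) ≠ 0 := (map_ne_zero RatFunc.C).2 h2
  have n3 := u'.isCoord.sub_C_ne_zero (u'.val z)
  have e : u'.fn - RatFunc.C (u'.val z) =
      -(u.fn - RatFunc.C (u.val z)) / (u.fn * RatFunc.C (u.val z)) := by
    rw [h, h3, map_inv₀]; field_simp; ring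
  rw [e, inv_div, h3, inv_inv, map_neg, map_neg, map_pow]
  field_simp
  ring

/-! ### The current j: independence of choices, existence and uniqueness. -/

section Current

/-- The operator `ε + ι` from `𝒱^Y` to `𝒱^Y' ⊗ K_z`, for `Y' ⊆ Y`, `z ∈ Y`, `z ∉ Y'`. -/
def jVac (hκ : κ.lieInvariant 𝔤) (u : Coord P) (h : Y' ⊆ Y) (hz : z ∈ Y) (hz' : z ∉ Y')
    (hzP : z ≠ P) : 𝔤 →ₗ[ℂ] Vac 𝔤 Y →ₗ[ℂ] Vac 𝔤 Y' ⊗[ℂ] Cotan z :=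
  (epsVac u hzP hz').compl₂ (Vac.res h) +
    (iotaVac hκ u hz hzP).compr₂ ((Vac.res h).rTensor (Cotan z))

lemma jVac_apply (hκ : κ.lieInvariant 𝔤) (u : Coord P) (h : Y' ⊆ Y) (hz : z ∈ Y) (hz' : z ∉ Y')
    (hzP : z ≠ P) (v : 𝔤) (m : Vac 𝔤 Y) : jVac hκ u h hz hz' hzP v m =
      epsVac u hzP hz' v (Vac.res h m) +
        (Vac.res h).rTensor (Cotan z) (iotaVac hκ u hz hzP v m) := rfl

/-- ε and ι acquire opposite multiples of the constant current v, and restriction from Y to Y' fixes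
constants. -/
theorem jVac_eq (hκ : κ.lieInvariant 𝔤) (u : Coord P) (u' : Coord P') (h : Y' ⊆ Y) (hz : z ∈ Y)
    (hz' : z ∉ Y') (hzP : z ≠ P) (hzP' : z ≠ P') :
    jVac (𝔤 := 𝔤) hκ u' h hz hz' hzP' = jVac hκ u h hz hz' hzP := by
  obtain ⟨b, c, -, e⟩ := u.exists_ker_eq u' hzP hzP'
  refine LinearMap.ext fun v => LinearMap.ext fun m => ?_
  rw [jVac_apply, jVac_apply, epsVac_of_ker_eq hzP hzP' hz' e, iotaVac_of_ker_eq hκ hzP hzP' hz e,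
    map_sub, LinearMap.rTensor_tmul, Vac.res_smul_of]
  have : Cur.map (resFun h) (Cur.const Y v) = Cur.const Y' v := by
    rw [Cur.const_apply, Cur.map_tmul, map_one, Cur.const_apply]
  rw [this]
  abel

theorem jVac_ident (hκ : κ.lieInvariant 𝔤) (u : Coord P) (h : Y' ⊆ Y) (hP : P ∈ Y') (hz : z ∈ Y)
    (hz' : z ∉ Y') (hzP : z ≠ P) (v : 𝔤) (x : Env (CurMinus 𝔤 (h hP))) :
    jVac hκ u h hz hz' hzP v (ident (h hP) x) =
      (ident hP).rTensor (Cotan z) (jMinus hκ u h hP hz hz' v x) := by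
  rw [jVac_apply, ← ident_resMinus h hP, epsVac_ident u hP, iotaVac_ident hκ u (h hP)]
  simp only [jMinus, LinearMap.add_apply, LinearMap.compl₂_apply, LinearMap.compr₂_apply, map_add,
    ← LinearMap.rTensor_comp_apply]
  have e : Vac.res h ∘ₗ ident (h hP) =
      ident (𝔤 := 𝔤) hP ∘ₗ (Env.map (resMinus h hP)).toLinearMap :=
    LinearMap.ext fun x => (ident_resMinus h hP x).symm
  rw [e]
  rfl

theorem jVac_res (hκ : κ.lieInvariant 𝔤) (u : Coord P) {Y₁ Y₁' : Set (OnePoint ℂ)} (h : Y' ⊆ Y)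
    (h₁ : Y₁' ⊆ Y₁) (hY : Y₁ ⊆ Y) (hY' : Y₁' ⊆ Y') (hz : z ∈ Y₁) (hz' : z ∉ Y') (hzP : z ≠ P)
    (v : 𝔤) (m : Vac 𝔤 Y) :
    jVac hκ u h₁ hz (fun h => hz' (hY' h)) hzP v (Vac.res hY m) =
      (Vac.res hY').rTensor (Cotan z) (jVac hκ u h (hY hz) hz' hzP v m) := by
  rw [jVac_apply, jVac_apply, map_add, ← epsVac_res hY', iotaVac_res hκ hY, Vac.res_res,
    Vac.res_res, ← LinearMap.rTensor_comp_apply, ← LinearMap.rTensor_comp_apply]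
  have e : Vac.res (𝔤 := 𝔤) h₁ ∘ₗ Vac.res hY = Vac.res hY' ∘ₗ Vac.res h :=
    LinearMap.ext fun m => by simp only [LinearMap.comp_apply, Vac.res_res]
  rw [e]

lemma exists_resFun_eq (f : regFun Y) : ∃ (S : Set (OnePoint ℂ)) (_ : S.Finite) (h : Y ⊆ Sᶜ)
    (f' : regFun Sᶜ), resFun h f' = f :=
  ⟨{z | ¬ IsRegularAt z f.1}, finite_not_isRegularAt f.1, fun z hz h => h (f.2 z hz),
    ⟨f.1, fun _ hz => not_not.1 hz⟩, rfl⟩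

/-- A vector of `𝒱^Y` involves functions with finitely many poles altogether. -/
lemma Vac.exists_res_eq (m : Vac 𝔤 Y) : ∃ (S : Set (OnePoint ℂ)) (_ : S.Finite) (h : Y ⊆ Sᶜ)
    (m' : Vac 𝔤 Sᶜ), Vac.res h m' = m := by
  induction m using Vac.induction with
  | vac => exact ⟨∅, Set.finite_empty, by simp, Vac.vac, Vac.res_vac _⟩
  | add m n hm hn =>
    obtain ⟨S, hS, h, m, rfl⟩ := hm
    obtain ⟨T, hT, k, n, rfl⟩ := hn
    have h1 : (S ∪ T)ᶜ ⊆ Sᶜ := Set.compl_subset_compl.2 Set.subset_union_left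
    have h2 : (S ∪ T)ᶜ ⊆ Tᶜ := Set.compl_subset_compl.2 Set.subset_union_right
    refine ⟨S ∪ T, hS.union hT, by rw [Set.compl_union]; exact Set.subset_inter h k,
      Vac.res h1 m + Vac.res h2 n, ?_⟩
    rw [map_add, Vac.res_res, Vac.res_res]
  | smul c m hm =>
    obtain ⟨S, hS, h, m, rfl⟩ := hm
    exact ⟨S, hS, h, c • m, map_smul _ _ _⟩
  | act f x m hm =>
    obtain ⟨S, hS, h, m, rfl⟩ := hm
    obtain ⟨T, hT, k, f, rfl⟩ := exists_resFun_eq f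
    have h1 : (S ∪ T)ᶜ ⊆ Sᶜ := Set.compl_subset_compl.2 Set.subset_union_left
    have h2 : (S ∪ T)ᶜ ⊆ Tᶜ := Set.compl_subset_compl.2 Set.subset_union_right
    refine ⟨S ∪ T, hS.union hT, by rw [Set.compl_union]; exact Set.subset_inter h k,
      Env.of (Cur.tmul (resFun h2 f) x) • Vac.res h1 m, ?_⟩
    rw [Vac.res_smul_of, Vac.res_res]; rfl

/-- The defining formula only speaks about base points in Y', which may be empty. Adjoining an
auxiliary base point brings any vector within its reach, and compatibility with restriction brings
the result back. -/
theorem IsCurrent.eq_jVac {hκ : κ.lieInvariant 𝔤} {j : CurrentOp 𝔤} (hj : IsCurrent hκ j)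
    (u : Coord P) (h : Y' ⊆ Y) (hz : z ∈ Y) (hz' : z ∉ Y') (hzP : z ≠ P) :
    j h hz hz' = jVac hκ u h hz hz' hzP := by
  refine LinearMap.ext fun v => LinearMap.ext fun m => ?_
  obtain ⟨S, hS, hYS, m, rfl⟩ := Vac.exists_res_eq m
  -- Q must avoid the finitely many poles occurring in m, so that m lifts to a module with Q among
  -- its regular points, and must differ from z, so that z stays outside the enlarged target set.
  obtain ⟨Q, hQ⟩ := (hS.union (Set.finite_singleton z)).infinite_compl.nonempty
  have hQS : Q ∈ Sᶜ := fun h => hQ (Or.inl h)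
  have hQz : z ≠ Q := fun h => hQ (Or.inr h.symm)
  have e1 : insert Q Y ⊆ Sᶜ := Set.insert_subset hQS hYS
  have e2 : Y ⊆ insert Q Y := Set.subset_insert _ _
  have e3 : Y' ⊆ insert Q Y' := Set.subset_insert _ _
  have e4 : insert Q Y' ⊆ insert Q Y := Set.insert_subset_insert h
  have hz1 : z ∉ insert Q Y' := fun h => h.elim hQz hz'
  have hQ' : Q ∈ insert Q Y' := Set.mem_insert _ _
  obtain ⟨x, hx⟩ := (ident_bijective (𝔤 := 𝔤) (e4 hQ')).2 (Vac.res e1 m)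
  let s : Coord Q := ⟨stdCoord Q, isCoord_stdCoord Q⟩
  rw [← Vac.res_res e1 e2, ← hx, hj.res_res e4 h e2 e3 hz hz1, hj.eq_jMinus s e4 hQ' (e2 hz) hz1,
    ← jVac_ident hκ s e4 hQ' (e2 hz) hz1 hQz, jVac_eq hκ s u h hz hz' hQz hzP,
    ← jVac_res hκ s e4 h e2 e3 hz hz1 hQz]

/-- Any choice, for each z, of a coordinate with pole elsewhere defines the family; `jVac_eq` makes
the choice irrelevant. -/
theorem existsUnique_isCurrent (hκ : κ.lieInvariant 𝔤) : ∃! j : CurrentOp 𝔤, IsCurrent hκ j := by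
  let u : ∀ z : OnePoint ℂ, Coord (exists_ne z).choose := fun z => ⟨stdCoord _, isCoord_stdCoord _⟩
  refine ⟨fun z Y Y' h hz hz' => jVac hκ (u z) h hz hz' (exists_ne z).choose_spec.symm, ⟨?_, ?_⟩,
    fun j hj => ?_⟩
  · intro P z Y Y' u₁ h hP hz hz' v x
    have hzP := ne_of_mem_left hP hz'
    change jVac hκ (u z) h hz hz' (exists_ne z).choose_spec.symm v (ident (h hP) x) = _
    rw [← jVac_ident hκ u₁ h hP hz hz' hzP, jVac_eq hκ u₁ (u z)]
  · intro z Y Y' Y₁ Y₁' h h₁ hY hY' hz hz' v m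
    exact jVac_res hκ (u z) h h₁ hY hY' hz hz' _ v m
  · funext z Y Y' h hz hz'
    exact hj.eq_jVac (u z) h hz hz' _

end Current

/-! ### Covariance under automorphisms of the projective line. -/

section Covariance
variable (φ : AutP1)

lemma Vac.map_map {Y'' : Set (OnePoint ℂ)} (f : regFun Y →ₐ[ℂ] regFun Y')
    (g : regFun Y' →ₐ[ℂ] regFun Y'') (m : Vac 𝔤 Y) :
    Vac.map g (Vac.map f m) = Vac.map (g.comp f) m := by
  induction m using Vac.induction with
  | vac => simp only [Vac.map_vac]
  | add m n hm hn => simp only [map_add, hm, hn]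
  | smul c m hm => simp only [map_smul, hm]
  | act f x m hm => simp only [Vac.map_smul_of, hm]; rfl

/-- The pullback of a coordinate. -/
def Coord.pullback (u : Coord P) : Coord (φ.toEquiv.symm P) where
  fn := φ.pullback u.fn
  isCoord :=
    { regular := fun z hz => (φ.isRegularAt_pullback z _).2 (u.isCoord.regular _ fun h =>
        hz (φ.toEquiv.eq_symm_apply.2 h))
      pole := fun h => u.isCoord.pole (by
        have := (φ.isRegularAt_pullback _ _).1 h
        rwa [Equiv.apply_symm_apply] at this)
      simple := fun f hf h0 => by
        -- Every test function at the new pole is itself a pullback, so simplicity is transported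
        -- from P.
        obtain ⟨g, rfl⟩ := φ.pullback.surjective f
        have hg := (φ.isRegularAt_pullback _ _).1 hf
        rw [φ.value_pullback _ _ hg] at h0
        rw [Equiv.apply_symm_apply] at hg h0
        rw [← map_mul, φ.isRegularAt_pullback, Equiv.apply_symm_apply]
        exact u.isCoord.simple g hg h0 }

lemma AutP1.pullback_C (c : ℂ) : φ.pullback (RatFunc.C c) = RatFunc.C c := by
  rw [← RatFunc.algebraMap_eq_C, AlgEquiv.commutes]

lemma Coord.val_pullback (u : Coord P) (hz : φ.toEquiv z ≠ P) :
    (u.pullback φ).val z = u.val (φ.toEquiv z) :=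
  φ.value_pullback z u.fn (u.isRegularAt hz)

lemma AutP1.ne_symm (hz : φ.toEquiv z ≠ P) : z ≠ φ.toEquiv.symm P := fun h =>
  hz (φ.toEquiv.eq_symm_apply.1 h)

lemma AutP1.dFun_pullFun (hz : φ.toEquiv z ∈ Y) (f : regFun Y) :
    dFun (Y := φ.toEquiv ⁻¹' Y) hz (φ.pullFun (Set.mapsTo_preimage _ _) f) =
      φ.pullCotan z (dFun hz f) := by
  change _ = (maxIdeal z).toCotangent _
  change (maxIdeal z).toCotangent _ = _
  congr 1
  ext1
  change _ - _ = φ.pullFun (φ.mapsTo_singleton z) (_ - _)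
  rw [map_sub, AlgHom.commutes]
  exact congrArg₂ (· - ·) rfl
    (congrArg (algebraMap ℂ (regFun {z})) (φ.value_pullback z f.1 (f.2 _ hz)))

/-- Transport of structure: the kernel, the difference quotient and du_z for `u.pullback φ` are the
pullbacks of those for `u`. The coordinate also changes here; its independence is applied
afterwards. -/
theorem jVac_pullVac (hκ : κ.lieInvariant 𝔤) (u : Coord P) (h : Y' ⊆ Y) (hz : φ.toEquiv z ∈ Y)
    (hz' : φ.toEquiv z ∉ Y') (hzP : φ.toEquiv z ≠ P) (v : 𝔤) (m : Vac 𝔤 Y) :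
    jVac (z := z) hκ (u.pullback φ) (Set.preimage_mono h) hz hz' (φ.ne_symm hzP) v
      (φ.pullVac Y m) =
      TensorProduct.map (φ.pullVac Y') (φ.pullCotan z) (jVac hκ u h hz hz' hzP v m) := by
  have hval := u.val_pullback φ hzP
  have hd : (u.pullback φ).d (φ.ne_symm hzP) = φ.pullCotan z (u.d hzP) :=
    φ.dFun_pullFun (Set.mem_singleton _) ⟨u.fn, fun w hw => u.isCoord.regular w (by rwa [hw])⟩
  have hres : ∀ m : Vac 𝔤 Y, Vac.res (Set.preimage_mono h) (φ.pullVac Y m) =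
      φ.pullVac Y' (Vac.res h m) := fun m => by
    simp only [Vac.res, AutP1.pullVac, Vac.map_map]; rfl
  rw [jVac_apply, jVac_apply, map_add, hres]
  congr 1
  · rw [epsVac_apply, epsVac_apply, TensorProduct.map_tmul, hd, AutP1.pullVac, Vac.map_smul_of,
      Cur.map_tmul]
    congr 5
    ext1
    change (φ.pullback u.fn - RatFunc.C _)⁻¹ = φ.pullback (u.fn - RatFunc.C _)⁻¹
    rw [hval, map_inv₀, map_sub, φ.pullback_C]
  · have e := iotaVac_map (𝔤 := 𝔤) hκ (φ.pullFun (Set.mapsTo_preimage φ.toEquiv Y))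
      (φ.pullCotan z) u (u.pullback φ) hz (w := z) hz hzP (φ.ne_symm hzP) (fun f => by
        ext1
        change (φ.pullback u.fn - RatFunc.C _)⁻¹ * (φ.pullback f.1 - _) =
          φ.pullback ((u.fn - RatFunc.C _)⁻¹ * (f.1 - RatFunc.C _))
        rw [hval, map_mul, map_inv₀, map_sub, φ.pullback_C, map_sub, φ.pullback_C]
        congr 3
        exact φ.value_pullback z f.1 (f.2 _ hz))
      (fun f => φ.value_pullback z f.1 (f.2 _ hz)) (φ.dFun_pullFun hz) hd v m
    refine (congrArg _ e).trans ?_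
    generalize iotaVac hκ u hz hzP v m = t
    induction t using TensorProduct.induction_on with
    | zero => simp only [map_zero]
    | add a b ha hb => simp only [map_add, ha, hb]
    | tmul a k =>
      rw [TensorProduct.map_tmul, LinearMap.rTensor_tmul, LinearMap.rTensor_tmul,
        TensorProduct.map_tmul]
      exact congrArg (· ⊗ₜ φ.pullCotan z k) (hres a)

end Covariance

/-! ### Trivialising the cotangent line by du_z. -/

section Coefficient

/-- The linear form on `K_z` that takes the value `1` on `du_z`. -/
def Coord.dual (u : Coord P) (hzP : z ≠ P) : Cotan z →ₗ[ℂ] ℂ := (u.exists_dual hzP).choose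

lemma Coord.dual_d (u : Coord P) (hzP : z ≠ P) : u.dual hzP (u.d hzP) = 1 :=
  (u.exists_dual hzP).choose_spec.1

lemma Coord.dual_smul_d (u : Coord P) (hzP : z ≠ P) (ξ : Cotan z) : u.dual hzP ξ • u.d hzP = ξ :=
  (u.exists_dual hzP).choose_spec.2 ξ

/-- The coefficient of `du_z`. -/
def Coord.coeff (u : Coord P) (hzP : z ≠ P) (M : Type*) [AddCommGroup M] [Module ℂ M] :
    M ⊗[ℂ] Cotan z →ₗ[ℂ] M :=
  (TensorProduct.rid ℂ M).toLinearMap ∘ₗ (u.dual hzP).lTensor M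

lemma Coord.coeff_tmul (u : Coord P) (hzP : z ≠ P) {M : Type*} [AddCommGroup M] [Module ℂ M]
    (m : M) (ξ : Cotan z) : u.coeff hzP M (m ⊗ₜ ξ) = u.dual hzP ξ • m := rfl

lemma Coord.coeff_tmul_d (u : Coord P) (hzP : z ≠ P) {M : Type*} [AddCommGroup M] [Module ℂ M]
    (t : M ⊗[ℂ] Cotan z) : u.coeff hzP M t ⊗ₜ u.d hzP = t := by
  induction t using TensorProduct.induction_on with
  | zero => simp
  | add a b ha hb => rw [map_add, TensorProduct.add_tmul, ha, hb]
  | tmul a k => rw [coeff_tmul, TensorProduct.smul_tmul, dual_smul_d]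

/-- The operator `ι̂^v(z)` on `𝒱^Y`, where `ι^v(z) = ι̂^v(z) du_z`. -/
def iotaHat (hκ : κ.lieInvariant 𝔤) (u : Coord P) (hz : z ∈ Y) (hzP : z ≠ P) :
    𝔤 →ₗ[ℂ] Vac 𝔤 Y →ₗ[ℂ] Vac 𝔤 Y :=
  (iotaVac hκ u hz hzP).compr₂ (u.coeff hzP (Vac 𝔤 Y))

lemma iotaVac_eq_tmul (hκ : κ.lieInvariant 𝔤) (u : Coord P) (hz : z ∈ Y) (hzP : z ≠ P) (v : 𝔤)
    (m : Vac 𝔤 Y) : iotaVac hκ u hz hzP v m = iotaHat hκ u hz hzP v m ⊗ₜ u.d hzP :=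
  (u.coeff_tmul_d hzP _).symm

lemma iotaHat_vac (hκ : κ.lieInvariant 𝔤) (u : Coord P) (hz : z ∈ Y) (hzP : z ≠ P) (v : 𝔤) :
    iotaHat hκ u hz hzP v Vac.vac = 0 := by
  change u.coeff hzP _ _ = 0
  rw [iotaVac_vac, map_zero]

/-- The recursion for ι with du_z stripped off. Its four terms are the whole input to the field
property and to the OPE. -/
lemma iotaHat_smul (hκ : κ.lieInvariant 𝔤) (u : Coord P) (hz : z ∈ Y) (hzP : z ≠ P) (v x : 𝔤)
    (f : regFun Y) (m : Vac 𝔤 Y) :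
    iotaHat hκ u hz hzP v (Env.of (Cur.tmul f x) • m) =
      Env.of (Cur.tmul f x) • iotaHat hκ u hz hzP v m -
        Env.of (Cur.tmul (u.diffQuot hz hzP f) ⁅v, x⁆) • m -
        (κ v x * u.deriv hz hzP f) • m +
        evalFun hz f • iotaHat hκ u hz hzP ⁅v, x⁆ m := by
  change u.coeff hzP _ _ = _
  rw [iotaVac_smul, iotaVac_eq_tmul, iotaVac_eq_tmul, kerComm_tmul, pairD_tmul, Cur.eval_tmul,
    u.dFun_eq_deriv_smul hz hzP]
  simp only [map_add, map_sub, Coord.coeff_tmul, Coord.dual_d, LinearMap.rTensor_tmul, one_smul,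
    act_apply, lie_smul, map_smul, LinearMap.smul_apply, Env.of_neg, neg_smul, smul_eq_mul, mul_one]
  abel

lemma iotaHat_res (hκ : κ.lieInvariant 𝔤) (h : Y' ⊆ Y) (u : Coord P) (hz : z ∈ Y')
    (hzP : z ≠ P) (v : 𝔤) (m : Vac 𝔤 Y) :
    iotaHat hκ u hz hzP v (Vac.res h m) = Vac.res h (iotaHat hκ u (h hz) hzP v m) := by
  change u.coeff hzP _ _ = _
  rw [iotaVac_res hκ h, iotaVac_eq_tmul, LinearMap.rTensor_tmul, Coord.coeff_tmul, Coord.dual_d,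
    one_smul]

lemma jVac_eq_tmul (hκ : κ.lieInvariant 𝔤) (u : Coord P) (h : Y' ⊆ Y) (hz : z ∈ Y) (hz' : z ∉ Y')
    (hzP : z ≠ P) (v : 𝔤) (m : Vac 𝔤 Y) : jVac hκ u h hz hz' hzP v m =
      (Env.of (Cur.tmul (u.ker hzP hz') v) • Vac.res h m +
        Vac.res h (iotaHat hκ u hz hzP v m)) ⊗ₜ u.d hzP := by
  rw [jVac_apply, epsVac_apply, iotaVac_eq_tmul, LinearMap.rTensor_tmul, TensorProduct.add_tmul]

end Coefficient

/-! ### Algebraic dependence on parameters. -/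

section RegularFamilies
variable {T : Type*} {pts : Set (T → U)}

lemma value_mem_scalarFam {q : T → U} (hq : q ∈ pts) (a : regFun U) :
    (fun t => evalFun (q t).2 a) ∈ scalarFam U pts :=
  Algebra.subset_adjoin ⟨q, hq, a, rfl⟩

lemma evalLeft_mem_scalarFam {q q' : T → U} (hq : q ∈ pts) (hq' : q' ∈ pts)
    (t : regFun U ⊗[ℂ] regFun U) :
    (fun s => evalFun (q' s).2 (evalLeft (q s).2 t)) ∈ scalarFam U pts := by
  induction t using TensorProduct.induction_on with
  | zero => simp only [map_zero]; exact Subalgebra.zero_mem _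
  | add a b ha hb => simp only [map_add]; exact Subalgebra.add_mem _ ha hb
  | tmul a b =>
    simp only [evalLeft_tmul, map_smul, smul_eq_mul]
    exact Subalgebra.mul_mem _ (value_mem_scalarFam hq a) (value_mem_scalarFam hq' b)

lemma scalarFam_comp {q : T → U} (hq : q ∈ pts) {s : U → ℂ} (hs : s ∈ scalarFam U {id}) :
    s ∘ q ∈ scalarFam U pts := by
  induction hs using Algebra.adjoin_induction with
  | mem s hs =>
    obtain ⟨_, rfl, a, rfl⟩ := hs
    exact value_mem_scalarFam hq a
  | algebraMap c => exact Subalgebra.algebraMap_mem _ c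
  | add s s' _ _ h h' => exact Subalgebra.add_mem _ h h'
  | mul s s' _ _ h h' => exact Subalgebra.mul_mem _ h h'

/-- Families of vectors of `𝒱^U` that depend on parameters through finitely many coefficients. -/
def regFam (𝔤 : Type*) [LieRing 𝔤] [LieAlgebra ℂ 𝔤] (U : Set (OnePoint ℂ)) (pts : Set (T → U)) :
    Submodule ℂ (T → Vac 𝔤 U) :=
  Submodule.span ℂ {w | ∃ s ∈ scalarFam U pts, ∃ m, w = fun t => s t • m}

lemma smul_mem_regFam {s : T → ℂ} (hs : s ∈ scalarFam U pts) {w : T → Vac 𝔤 U}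
    (hw : w ∈ regFam 𝔤 U pts) : (fun t => s t • w t) ∈ regFam 𝔤 U pts := by
  induction hw using Submodule.span_induction with
  | mem w hw =>
    obtain ⟨s', hs', m, rfl⟩ := hw
    refine Submodule.subset_span ⟨s * s', Subalgebra.mul_mem _ hs hs', m, ?_⟩
    funext t; exact (mul_smul _ _ _).symm
  | zero => simp only [Pi.zero_apply, smul_zero]; exact Submodule.zero_mem _
  | add a b _ _ ha hb => simp only [Pi.add_apply, smul_add]; exact Submodule.add_mem _ ha hb
  | smul c a _ ha =>
    simp only [Pi.smul_apply, smul_comm _ c]; exact Submodule.smul_mem _ c ha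

lemma const_mem_regFam (m : Vac 𝔤 U) : (fun _ => m) ∈ regFam 𝔤 U pts :=
  Submodule.subset_span ⟨1, Subalgebra.one_mem _, m, by simp⟩

/-- The parameter sits only in scalar coefficients, so a fixed operator acts coefficientwise. This
is why ι̂ is studied in 𝒱^U, before restriction to 𝒱, where functions with moving poles appear. -/
lemma map_mem_regFam (L : Vac 𝔤 U →ₗ[ℂ] Vac 𝔤 U) {w : T → Vac 𝔤 U} (hw : w ∈ regFam 𝔤 U pts) :
    (fun t => L (w t)) ∈ regFam 𝔤 U pts := by
  induction hw using Submodule.span_induction with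
  | mem w hw =>
    obtain ⟨s', hs', m, rfl⟩ := hw
    simp only [map_smul]
    exact Submodule.subset_span ⟨s', hs', L m, rfl⟩
  | zero => simp only [Pi.zero_apply, map_zero]; exact Submodule.zero_mem _
  | add a b _ _ ha hb => simp only [Pi.add_apply, map_add]; exact Submodule.add_mem _ ha hb
  | smul c a _ ha => simp only [Pi.smul_apply, map_smul]; exact Submodule.smul_mem _ c ha

lemma regFam_comp {q : T → U} (hq : q ∈ pts) {w : U → Vac 𝔤 U} (hw : w ∈ regFam 𝔤 U {id}) :
    w ∘ q ∈ regFam 𝔤 U pts := by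
  induction hw using Submodule.span_induction with
  | mem w hw =>
    obtain ⟨s, hs, m, rfl⟩ := hw
    exact Submodule.subset_span ⟨s ∘ q, scalarFam_comp hq hs, m, rfl⟩
  | zero => exact Submodule.zero_mem _
  | add a b _ _ ha hb => exact Submodule.add_mem _ ha hb
  | smul c a _ ha => exact Submodule.smul_mem _ c ha

/-- For a pure tensor a ⊗ b the family is a(q(s)) times the fixed vector (b x) m. -/
lemma evalLeft_smul_mem_regFam {q : T → U} (hq : q ∈ pts) (t : regFun U ⊗[ℂ] regFun U) (x : 𝔤)
    (m : Vac 𝔤 U) :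
    (fun s => Env.of (Cur.tmul (evalLeft (q s).2 t) x) • m) ∈ regFam 𝔤 U pts := by
  induction t using TensorProduct.induction_on with
  | zero =>
    simp only [map_zero, ← Cur.mk_apply, LinearMap.zero_apply, Env.of_zero, zero_smul]
    exact Submodule.zero_mem _
  | add a b ha hb =>
    simp only [map_add, Cur.add_tmul, Env.of_add, add_smul]; exact Submodule.add_mem _ ha hb
  | tmul a b =>
    simp only [evalLeft_tmul, Cur.smul_tmul, Env.of_smul, smul_assoc]
    exact smul_mem_regFam (value_mem_scalarFam hq a) (const_mem_regFam _)

theorem iotaHat_mem_regFam (hκ : κ.lieInvariant 𝔤) (u : Coord P) (hP : P ∉ U) (v : 𝔤)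
    (m : Vac 𝔤 U) : (fun z : U => iotaHat hκ u z.2 (ne_of_mem_right z.2 hP) v m) ∈
      regFam 𝔤 U {id} := by
  induction m using Vac.induction generalizing v with
  | vac => simp only [iotaHat_vac]; exact Submodule.zero_mem _
  | add m n hm hn => simp only [map_add]; exact Submodule.add_mem _ (hm v) (hn v)
  | smul c m hm => simp only [map_smul]; exact Submodule.smul_mem _ c (hm v)
  | act f x m hm =>
    -- One tensor t serves for all z at once; both the difference quotient and its value at z then
    -- have the required form.
    obtain ⟨t, ht⟩ := u.exists_diffQuot_eq hP f
    have hid : (id : U → U) ∈ ({id} : Set (U → U)) := rfl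
    simp only [iotaHat_smul, Coord.deriv_apply, ht, mul_smul]
    refine Submodule.add_mem _ (Submodule.sub_mem _ (Submodule.sub_mem _ ?_ ?_) ?_) ?_
    · exact map_mem_regFam (act _ (Env.of (Cur.tmul f x))) (hm v)
    · exact evalLeft_smul_mem_regFam hid t _ m
    · exact Submodule.smul_mem _ _
        (smul_mem_regFam (evalLeft_mem_scalarFam hid hid t) (const_mem_regFam m))
    · exact smul_mem_regFam (value_mem_scalarFam hid f) (hm _)

/-- The inner family is a sum of s(z₁) m with fixed m, so the outer operator acts on fixed vectors
and no pole appears at z₂ = z₁. -/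
theorem iotaHat_iotaHat_mem_regFam (hκ : κ.lieInvariant 𝔤) (u : Coord P) (hP : P ∉ U) (v₂ v₁ : 𝔤)
    (m : Vac 𝔤 U) : (fun p : U × U => iotaHat hκ u p.1.2 (ne_of_mem_right p.1.2 hP) v₂
      (iotaHat hκ u p.2.2 (ne_of_mem_right p.2.2 hP) v₁ m)) ∈
      regFam 𝔤 U {Prod.fst, Prod.snd} := by
  have key : ∀ w ∈ regFam 𝔤 U {(id : U → U)},
      (fun p : U × U => iotaHat hκ u p.1.2 (ne_of_mem_right p.1.2 hP) v₂ (w p.2)) ∈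
        regFam 𝔤 U {Prod.fst, Prod.snd} := by
    intro w hw
    induction hw using Submodule.span_induction with
    | mem w hw =>
      obtain ⟨s, hs, m, rfl⟩ := hw
      simp only [map_smul]
      exact smul_mem_regFam (scalarFam_comp (Or.inr rfl) hs)
        (regFam_comp (q := Prod.fst) (Or.inl rfl) (iotaHat_mem_regFam hκ u hP v₂ m))
    | zero => simp only [Pi.zero_apply, map_zero]; exact Submodule.zero_mem _
    | add a b _ _ ha hb => simp only [Pi.add_apply, map_add]; exact Submodule.add_mem _ ha hb
    | smul c a _ ha => simp only [Pi.smul_apply, map_smul]; exact Submodule.smul_mem _ c ha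
  exact key _ (iotaHat_mem_regFam hκ u hP v₁ m)

/-- For a generator the quotient is the separated tensor evaluated at z₁ and z₂; sums and products
follow from the discrete Leibniz rule. -/
lemma exists_diffQuot_scalarFam (u : Coord P) (hP : P ∉ U) {s : U → ℂ}
    (hs : s ∈ scalarFam U {id}) : ∃ q ∈ scalarFam U {Prod.fst, Prod.snd},
      ∀ z₂ z₁ : U, s z₂ - s z₁ = (u.val z₂ - u.val z₁) * q (z₂, z₁) := by
  induction hs using Algebra.adjoin_induction with
  | mem s hs =>
    obtain ⟨_, rfl, a, rfl⟩ := hs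
    obtain ⟨t, ht⟩ := u.exists_diffQuot_eq hP a
    refine ⟨fun p => evalFun p.1.2 (evalLeft p.2.2 t),
      evalLeft_mem_scalarFam (q := Prod.snd) (q' := Prod.fst) (Or.inr rfl) (Or.inl rfl) t,
      fun z₂ z₁ => ?_⟩
    have h1 := ne_of_mem_right z₁.2 hP
    have h2 := ne_of_mem_right z₂.2 hP
    have n := u.isCoord.sub_C_ne_zero (u.val z₁)
    have h3 := value_mul (isRegularAt_sub_C (u.isRegularAt h2) (u.val z₁))
      ((u.diffQuot z₁.2 h1 a).2 z₂ z₂.2)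
    have h4 : (u.fn - RatFunc.C (u.val z₁)) * (u.diffQuot z₁.2 h1 a : RatFunc ℂ) =
        a.1 - RatFunc.C (value z₁ a.1) := mul_inv_cancel_left₀ n _
    rw [h4, value_sub_C (u.isRegularAt h2), value_sub_C (a.2 z₂ z₂.2), ht] at h3
    exact h3
  | algebraMap c => exact ⟨0, Subalgebra.zero_mem _, fun _ _ => by simp⟩
  | add s s' _ _ h h' =>
    obtain ⟨q, hq, e⟩ := h
    obtain ⟨q', hq', e'⟩ := h'
    refine ⟨q + q', Subalgebra.add_mem _ hq hq', fun z₂ z₁ => ?_⟩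
    simp only [Pi.add_apply]
    linear_combination e z₂ z₁ + e' z₂ z₁
  | mul s s' hs hs' h h' =>
    obtain ⟨q, hq, e⟩ := h
    obtain ⟨q', hq', e'⟩ := h'
    refine ⟨q * (s' ∘ Prod.fst) + (s ∘ Prod.snd) * q',
      Subalgebra.add_mem _ (Subalgebra.mul_mem _ hq (scalarFam_comp (Or.inl rfl) hs'))
        (Subalgebra.mul_mem _ (scalarFam_comp (Or.inr rfl) hs) hq'), fun z₂ z₁ => ?_⟩
    simp only [Pi.add_apply, Pi.mul_apply, Function.comp_apply]
    linear_combination s' z₂ * e z₂ z₁ + s z₁ * e' z₂ z₁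

/-- Applied to ι̂ in the OPE: q extends the difference quotient across the diagonal, and its
diagonal restriction is the derivative in u. -/
lemma exists_diffQuot_regFam (u : Coord P) (hP : P ∉ U) {w : U → Vac 𝔤 U}
    (hw : w ∈ regFam 𝔤 U {id}) : ∃ q ∈ regFam 𝔤 U {Prod.fst, Prod.snd},
      ∀ z₂ z₁ : U, w z₂ - w z₁ = (u.val z₂ - u.val z₁) • q (z₂, z₁) := by
  induction hw using Submodule.span_induction with
  | mem w hw =>
    obtain ⟨s, hs, m, rfl⟩ := hw
    obtain ⟨q, hq, e⟩ := exists_diffQuot_scalarFam u hP hs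
    refine ⟨fun p => q p • m, Submodule.subset_span ⟨q, hq, m, rfl⟩, fun z₂ z₁ => ?_⟩
    rw [← sub_smul, e, mul_smul]
  | zero => exact ⟨0, Submodule.zero_mem _, fun _ _ => by simp⟩
  | add a b _ _ ha hb =>
    obtain ⟨q, hq, e⟩ := ha
    obtain ⟨q', hq', e'⟩ := hb
    refine ⟨q + q', Submodule.add_mem _ hq hq', fun z₂ z₁ => ?_⟩
    rw [Pi.add_apply, Pi.add_apply, Pi.add_apply, smul_add, ← e, ← e']; abel
  | smul c a _ ha =>
    obtain ⟨q, hq, e⟩ := ha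
    refine ⟨c • q, Submodule.smul_mem _ c hq, fun z₂ z₁ => ?_⟩
    rw [Pi.smul_apply, Pi.smul_apply, Pi.smul_apply, smul_comm _ c, ← e, smul_sub]

lemma isAlgFam_const (m : Vac 𝔤 U) :
    IsAlgFam U pts fun _ => Vac.res (Set.empty_subset U) m := by
  induction m using Vac.induction with
  | vac => simp only [Vac.res_vac]; exact .vac
  | add m n hm hn => simp only [map_add]; exact hm.add hn
  | smul c m hm =>
    simp only [map_smul]
    exact hm.smul (s := fun _ => c) (Subalgebra.algebraMap_mem _ c)
  | act f x m hm =>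
    simp only [Vac.res_smul_of]
    exact hm.act (F := fun _ => f.1) x (Algebra.subset_adjoin (Or.inl (Or.inl ⟨f, rfl⟩)))

lemma isAlgFam_res {w : T → Vac 𝔤 U} (hw : w ∈ regFam 𝔤 U pts) :
    IsAlgFam U pts fun t => Vac.res (Set.empty_subset U) (w t) := by
  induction hw using Submodule.span_induction with
  | mem w hw =>
    obtain ⟨s, hs, m, rfl⟩ := hw
    simp only [map_smul]
    exact (isAlgFam_const m).smul hs
  | zero =>
    simp only [Pi.zero_apply]
    exact isAlgFam_const 0
  | add a b _ _ ha hb => simp only [Pi.add_apply, map_add]; exact ha.add hb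
  | smul c a _ ha =>
    simp only [Pi.smul_apply, map_smul]
    exact ha.smul (s := fun _ => c) (Subalgebra.algebraMap_mem _ c)

/-- Multiplication by `x / (u - u(q(t)))` preserves algebraic families. -/
lemma IsAlgFam.ker_smul (u : Coord P) (hP : P ∉ U) {q : T → U} (hq : q ∈ pts) (x : 𝔤)
    {w : T → Vac 𝔤 ∅} (hw : IsAlgFam U pts w) :
    IsAlgFam U pts fun t => Env.of (Cur.tmul
      (u.ker (ne_of_mem_right (q t).2 hP) (Set.notMem_empty (q t).1)) x) • w t :=
  hw.act (F := fun t => (u.fn - RatFunc.C (value (q t) u.fn))⁻¹) x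
    (Algebra.subset_adjoin (Or.inr ⟨P, u, hP, q, hq, rfl⟩))

end RegularFamilies

/-- For ν = f x the value f(z) comes out as a scalar; the rest is a kernel with an allowed moving
pole plus a restricted regular family. -/
theorem isAlgSection_jVac (hκ : κ.lieInvariant 𝔤) (u : Coord P) (hP : P ∉ U) (m : Vac 𝔤 U)
    (ν : Cur 𝔤 U) : IsAlgSection u hP fun z : U =>
      jVac hκ u (Set.empty_subset U) z.2 (Set.notMem_empty z.1) (ne_of_mem_right z.2 hP)
        (Cur.eval z.2 ν) m := by
  have hid : (id : U → U) ∈ ({id} : Set (U → U)) := rfl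
  refine ⟨_, ?_, fun z => jVac_eq_tmul hκ u _ z.2 _ _ _ m⟩
  induction ν using Cur.induction with
  | zero =>
    simp only [map_zero, ← Cur.mk_apply, Env.of_zero, zero_smul, LinearMap.zero_apply, add_zero]
    simpa using isAlgFam_const (pts := {(id : U → U)}) (0 : Vac 𝔤 U)
  | add α β hα hβ =>
    convert hα.add hβ using 2
    simp only [map_add, Cur.tmul_add, Env.of_add, add_smul, LinearMap.add_apply]
    abel
  | tmul f x =>
    simp only [Cur.eval_tmul, map_smul, Cur.tmul_smul, Env.of_smul, smul_assoc,
      LinearMap.smul_apply, ← smul_add]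
    exact (((isAlgFam_const m).ker_smul u hP hid x).add
      (isAlgFam_res (iotaHat_mem_regFam hκ u hP x m))).smul (value_mem_scalarFam hid f)

/-! ### The operator product expansion. -/

section OPE

/-- The operator `ε̂^v(z)` on `𝒱`, where `ε^v(z) = ε̂^v(z) du_z`. -/
def epsHat (u : Coord P) (hP : P ∉ U) (v : 𝔤) (z : U) : Vac 𝔤 ∅ →ₗ[ℂ] Vac 𝔤 ∅ :=
  act _ (Env.of (Cur.tmul (u.ker (ne_of_mem_right z.2 hP) (Set.notMem_empty z.1)) v))

lemma epsField_apply (u : Coord P) (hP : P ∉ U) (v : 𝔤) (z : U) (m : Vac 𝔤 ∅) :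
    epsField u hP v z m = epsHat u hP v z m ⊗ₜ u.d (ne_of_mem_right z.2 hP) := rfl

lemma iotaField_apply (hκ : κ.lieInvariant 𝔤) (u : Coord P) (hP : P ∉ U) (v : 𝔤) (m : Vac 𝔤 U)
    (z : U) : iotaField hκ u hP v m z =
      Vac.res (Set.empty_subset U) (iotaHat hκ u z.2 (ne_of_mem_right z.2 hP) v m) ⊗ₜ
        u.d (ne_of_mem_right z.2 hP) := by
  rw [iotaField, iotaVac_eq_tmul, LinearMap.rTensor_tmul]

/-- The coefficient of the product `j^{v₂}(z₂) j^{v₁}(z₁)` for `z₂ ≠ z₁`. -/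
theorem jHat_jHat (hκ : κ.lieInvariant 𝔤) (u : Coord P) (hP : P ∉ U) (v₂ v₁ : 𝔤) (m : Vac 𝔤 U)
    (z₂ z₁ : U) (h : z₁.1 ∉ ({z₂.1} : Set (OnePoint ℂ))) :
    let hz₁ := ne_of_mem_right z₁.2 hP
    let hz₂ := ne_of_mem_right z₂.2 hP
    let A : Vac 𝔤 {z₂.1} := Env.of (Cur.tmul (u.ker hz₁ h) v₁) •
        Vac.res (Set.singleton_subset_iff.2 z₂.2) m +
      Vac.res (Set.singleton_subset_iff.2 z₂.2) (iotaHat hκ u z₁.2 hz₁ v₁ m)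
    let ρ : Vac 𝔤 U →ₗ[ℂ] Vac 𝔤 ∅ := Vac.res (Set.empty_subset U)
    let c := (u.val z₂ - u.val z₁)⁻¹
    Env.of (Cur.tmul (u.ker hz₂ (Set.notMem_empty z₂.1)) v₂) •
        Vac.res (Set.empty_subset _) A +
      Vac.res (Set.empty_subset _) (iotaHat hκ u (Set.mem_singleton z₂.1) hz₂ v₂ A) =
    epsHat u hP v₂ z₂ (epsHat u hP v₁ z₁ (ρ m)) +
      epsHat u hP v₂ z₂ (ρ (iotaHat hκ u z₁.2 hz₁ v₁ m)) +
      epsHat u hP v₁ z₁ (ρ (iotaHat hκ u z₂.2 hz₂ v₂ m)) +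
      ρ (iotaHat hκ u z₂.2 hz₂ v₂ (iotaHat hκ u z₁.2 hz₁ v₁ m)) +
      (κ v₂ v₁ * c ^ 2) • ρ m + c • epsHat u hP ⁅v₂, v₁⁆ z₁ (ρ m) +
      c • ρ (iotaHat hκ u z₂.2 hz₂ ⁅v₂, v₁⁆ m) := by
  intro hz₁ hz₂ A ρ c
  have hz := Set.mem_singleton z₂.1
  -- Let K = 1/(u - u(z₁)). At z₂ its value is c, its difference quotient is -cK and its derivative
  -- is -c². In the commutator of ι(z₂) with v₁K these give, respectively, c ι(z₂), c ε(z₁) and the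
  -- double pole.
  have h1 : evalFun hz (u.ker hz₁ h) = c := u.evalFun_ker hz₁ h hz hz₂
  have h2 : u.diffQuot hz hz₂ (u.ker hz₁ h) = -(c • u.ker hz₁ h) := by
    rw [u.diffQuot_ker, h1]
  have h3 : u.deriv hz hz₂ (u.ker hz₁ h) = -c ^ 2 := by
    rw [Coord.deriv_apply, h2, map_neg, map_smul, h1, smul_eq_mul, pow_two]
  have h4 : ∀ v : 𝔤, Cur.map (resFun (Set.empty_subset _)) (Cur.tmul (u.ker hz₁ h) v) =
      Cur.tmul (u.ker hz₁ (Set.notMem_empty z₁.1)) v := fun _ => rfl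
  simp only [A, map_add, smul_add, iotaHat_smul, iotaHat_res, h1, h2, h3, Vac.res_smul_of, map_sub,
    map_smul, Vac.res_res, ← neg_smul c, Cur.smul_tmul, Env.of_smul, smul_assoc, h4]
  simp only [epsHat, ρ, ← act_apply]
  module

/-- By `jHat_jHat`, subtracting the double pole and c j(z₁) for [v₂,v₁] leaves terms regular at z₂ =
z₁ and c (ι̂(z₂) - ι̂(z₁)), with c = 1/(u(z₂) - u(z₁)), which extends across the diagonal. The
products of two ε need no reordering: each pole stays at its own point and the two may coincide. -/
theorem satisfiesOPE_of_eq (hsymm : κ.IsSymm) (hκ : κ.lieInvariant 𝔤) {j : CurrentOp 𝔤}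
    (hj : IsCurrent hκ j) : SatisfiesOPE hκ j := by
  intro P U u hP _ m v₁ v₂
  obtain ⟨q, hq, e⟩ := exists_diffQuot_regFam u hP (iotaHat_mem_regFam hκ u hP ⁅v₂, v₁⁆ m)
  let ρ : Vac 𝔤 U →ₗ[ℂ] Vac 𝔤 ∅ := Vac.res (Set.empty_subset U)
  have hfst : (Prod.fst : U × U → U) ∈ ({Prod.fst, Prod.snd} : Set (U × U → U)) := Or.inl rfl
  have hsnd : (Prod.snd : U × U → U) ∈ ({Prod.fst, Prod.snd} : Set (U × U → U)) := Or.inr rfl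
  have hz : ∀ z : U, z.1 ≠ P := fun z => ne_of_mem_right z.2 hP
  -- D is the diagonal value of the extended difference quotient q of ι̂ for [v₂,v₁]. The second
  -- witness is the regular part of the product with ρ q added, defined on the diagonal as well.
  refine ⟨fun z => (ρ (q (z, z)) ⊗ₜ u.d (hz z)) ⊗ₜ u.d (hz z),
    ⟨_, isAlgFam_res (iotaHat_mem_regFam hκ u hP ⁅v₂, v₁⁆ m), iotaField_apply hκ u hP _ m,
      fun p => ρ (q p), isAlgFam_res hq, fun z₂ z₁ => ?_, fun _ => rfl⟩,
    fun p => epsHat u hP v₂ p.1 (epsHat u hP v₁ p.2 (ρ m)) +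
      epsHat u hP v₂ p.1 (ρ (iotaHat hκ u p.2.2 (hz p.2) v₁ m)) +
      epsHat u hP v₁ p.2 (ρ (iotaHat hκ u p.1.2 (hz p.1) v₂ m)) +
      ρ (iotaHat hκ u p.1.2 (hz p.1) v₂ (iotaHat hκ u p.2.2 (hz p.2) v₁ m)) + ρ (q p),
    ?_, fun z₂ z₁ h => ?_, fun z => ?_⟩
  · rw [← map_sub, e, map_smul]
  · refine (((IsAlgFam.add ?_ ?_).add ?_).add ?_).add (isAlgFam_res hq)
    · exact ((isAlgFam_const m).ker_smul u hP hsnd v₁).ker_smul u hP hfst v₂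
    · exact (isAlgFam_res (regFam_comp hsnd (iotaHat_mem_regFam hκ u hP v₁ m))).ker_smul u hP hfst v₂
    · exact (isAlgFam_res (regFam_comp hfst (iotaHat_mem_regFam hκ u hP v₂ m))).ker_smul u hP hsnd v₁
    · exact isAlgFam_res (iotaHat_iotaHat_mem_regFam hκ u hP v₂ v₁ m)
  · have hne : u.val z₂ - u.val z₁ ≠ 0 := fun h' =>
      h (Subtype.ext (u.val_injective (hz z₂) (hz z₁) (sub_eq_zero.1 h')))
    -- Off the diagonal the factor u(z₂) - u(z₁) is invertible because `u` is injective away from P,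
    -- so q is the actual quotient.
    have eq : ρ (q (z₂, z₁)) = (u.val z₂ - u.val z₁)⁻¹ •
        (ρ (iotaHat hκ u z₂.2 (hz z₂) ⁅v₂, v₁⁆ m) - ρ (iotaHat hκ u z₁.2 (hz z₁) ⁅v₂, v₁⁆ m)) := by
      rw [← map_sub, e z₂ z₁, map_smul, inv_smul_smul₀ hne]
    rw [opeLeft, hj.eq_jVac u _ _ _ (hz z₁), hj.eq_jVac u _ _ _ (hz z₂),
      hj.eq_jVac u _ _ _ (hz z₁), jVac_eq_tmul, jVac_eq_tmul, LinearMap.rTensor_tmul, jVac_eq_tmul,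
      LinearMap.rTensor_tmul, jHat_jHat hκ u hP v₂ v₁ m z₂ z₁]
    dsimp only
    rw [eq]
    -- Symmetry of the form matches the two orders of v₁ and v₂; the sign of the difference
    -- disappears in the square.
    have e1 : κ v₁ v₂ / (u.val z₁ - u.val z₂) ^ 2 = κ v₂ v₁ * (u.val z₂ - u.val z₁)⁻¹ ^ 2 := by
      rw [show κ v₂ v₁ = κ v₁ v₂ from hsymm.eq v₂ v₁, ← neg_sub (u.val z₂), neg_sq, inv_pow, div_eq_mul_inv]
    rw [e1, one_div]
    change (_ ⊗ₜ[ℂ] _) ⊗ₜ[ℂ] _ - _ - _ • (_ ⊗ₜ[ℂ] _) ⊗ₜ[ℂ] _ = _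
    simp only [TensorProduct.smul_tmul', ← TensorProduct.sub_tmul]
    congr 2
    change _ - _ - (u.val z₂ - u.val z₁)⁻¹ • (epsHat u hP ⁅v₂, v₁⁆ z₁ (ρ m) + ρ _) = _
    rw [smul_add, smul_sub]
    abel
  · simp only [opeRegular, iotaVac_eq_tmul, iotaField_apply, epsField_apply, LinearMap.rTensor_tmul,
      ← TensorProduct.add_tmul]
    congr 2
    change _ + _ + epsHat u hP v₂ z (ρ _) + epsHat u hP v₁ z (ρ _) + ρ _ = _
    abel

end OPE
end CurrentAlgebra
end

/-! ### Assembly of the theorem. -/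

open CurrentAlgebra
theorem mainTheorem2 {𝔤 : Type*} [LieRing 𝔤] [LieAlgebra ℂ 𝔤] (κ : LinearMap.BilinForm ℂ 𝔤)
    (hsymm : κ.IsSymm) (hinv : κ.lieInvariant 𝔤) (hnd : κ.Nondegenerate) :
    (∀ {P : OnePoint ℂ} {Y : Set (OnePoint ℂ)} (hP : P ∈ Y),
      Function.Bijective (ident (𝔤 := 𝔤) hP)) ∧
    (∀ {P P' z : OnePoint ℂ} (u : Coord P) (u' : Coord P'), u'.fn = u.fn⁻¹ → P ≠ P' →
      ∀ (hzP : z ≠ P) (hzP' : z ≠ P') (ν : Cur 𝔤 {z}),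
      let v := Cur.eval (Set.mem_singleton z) ν
      (∀ {Y : Set (OnePoint ℂ)} (hP : P ∈ Y) (hP' : P' ∈ Y) (hz : z ∉ Y)
        (x : Env (CurMinus 𝔤 hP)) (x' : Env (CurMinus 𝔤 hP')), ident hP' x' = ident hP x →
        (ident hP').rTensor (Cotan z) (eps u' hP' hz v x') =
          (ident hP).rTensor (Cotan z) (eps u hP hz v x) -
            (Env.of (Cur.const Y v) • ident hP x) ⊗ₜ ((u'.val z)⁻¹ • u'.d hzP')) ∧
      (∀ {Y : Set (OnePoint ℂ)} (hP : P ∈ Y) (hP' : P' ∈ Y) (hz : z ∈ Y)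
        (x : Env (CurMinus 𝔤 hP)) (x' : Env (CurMinus 𝔤 hP')), ident hP' x' = ident hP x →
        (ident hP').rTensor (Cotan z) (iota hinv u' hP' hz hzP' v x') =
          (ident hP).rTensor (Cotan z) (iota hinv u hP hz hzP v x) +
            (Env.of (Cur.const Y v) • ident hP x) ⊗ₜ ((u'.val z)⁻¹ • u'.d hzP')) ∧
      (∀ {Y Y' : Set (OnePoint ℂ)} (h : Y' ⊆ Y) (hP : P ∈ Y') (hP' : P' ∈ Y') (hz : z ∈ Y)
        (hz' : z ∉ Y') (x : Env (CurMinus 𝔤 (h hP))) (x' : Env (CurMinus 𝔤 (h hP'))),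
        ident (h hP') x' = ident (h hP) x →
        (ident hP').rTensor (Cotan z) (jMinus hinv u' h hP' hz hz' v x') =
          (ident hP).rTensor (Cotan z) (jMinus hinv u h hP hz hz' v x))) ∧
    (∀ {P z : OnePoint ℂ} {Y : Set (OnePoint ℂ)} (u : Coord P) (hP : P ∈ Y) (v : 𝔤)
      (x : Env (CurMinus 𝔤 hP)),
      (∀ (hz : z ∉ Y) (hzP : z ≠ P),
        epsVac u hzP hz v (ident hP x) = (ident hP).rTensor (Cotan z) (eps u hP hz v x)) ∧
      (∀ (hz : z ∈ Y) (hzP : z ≠ P), iotaVac hinv u hz hzP v (ident hP x) =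
        (ident hP).rTensor (Cotan z) (iota hinv u hP hz hzP v x))) ∧
    (∃! j : CurrentOp 𝔤, IsCurrent hinv j) ∧
    (∀ j : CurrentOp 𝔤, IsCurrent hinv j →
      (∀ {P z : OnePoint ℂ} {Y Y' : Set (OnePoint ℂ)} (u : Coord P) (h : Y' ⊆ Y) (hz : z ∈ Y)
        (hz' : z ∉ Y') (hzP : z ≠ P) (v : 𝔤) (m : Vac 𝔤 Y),
        j h hz hz' v m = epsVac u hzP hz' v (Vac.res h m) +
          (Vac.res h).rTensor (Cotan z) (iotaVac hinv u hz hzP v m)) ∧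
      IsCovariant j ∧
      (∀ {P : OnePoint ℂ} {U : Set (OnePoint ℂ)} (u : Coord P) (hP : P ∉ U), Uᶜ.Finite →
        ∀ (m : Vac 𝔤 U) (ν : Cur 𝔤 U), IsAlgSection u hP fun z : U =>
          j (Set.empty_subset U) z.2 (Set.notMem_empty z.1) (Cur.eval z.2 ν) m) ∧
      SatisfiesOPE hinv j) ∧
    (∀ {z P : OnePoint ℂ} (_ : z ≠ P) (m : Vac 𝔤 {z}), ∃ (U : Set (OnePoint ℂ)) (hz : z ∈ U),
      Uᶜ.Finite ∧ P ∉ U ∧ ∃ mU : Vac 𝔤 U, Vac.res (Set.singleton_subset_iff.2 hz) mU = m) := by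
  refine ⟨ident_bijective, ?_, ?_, existsUnique_isCurrent hinv, fun j hj => ⟨?_, ?_, ?_,
    satisfiesOPE_of_eq hsymm hinv hj⟩, ?_⟩
  · intro P P' z u u' hu hPP hzP hzP' ν v
    have hk := ker_eq_of_fn_eq_inv hu hzP hzP'
    refine ⟨fun hP hP' hz x x' e => ?_, fun hP hP' hz x x' e => ?_,
      fun h hP hP' hz hz' x x' e => ?_⟩
    · rw [← epsVac_ident u' hP' hz hzP', ← epsVac_ident u hP hz hzP, e,
        epsVac_of_ker_eq hzP hzP' hz hk, neg_smul, TensorProduct.tmul_neg, sub_eq_add_neg]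
    · rw [← iotaVac_ident hinv u' hP' hz hzP', ← iotaVac_ident hinv u hP hz hzP, e,
        iotaVac_of_ker_eq hinv hzP hzP' hz hk, neg_smul, TensorProduct.tmul_neg, sub_neg_eq_add]
    · rw [← jVac_ident hinv u' h hP' hz hz' hzP', ← jVac_ident hinv u h hP hz hz' hzP, e,
        jVac_eq hinv u u']
  · exact fun u hP v x => ⟨fun hz hzP => epsVac_ident u hP hz hzP v x,
      fun hz hzP => iotaVac_ident hinv u hP hz hzP v x⟩
  · intro P z Y Y' u h hz hz' hzP v m
    rw [hj.eq_jVac u h hz hz' hzP, jVac_apply]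
  · intro φ z Y Y' h hz hz' v m
    -- Any coordinate with pole away from φ(z) computes j there, and its pullback computes j at z.
    obtain ⟨P, hP'⟩ := exists_ne (φ.toEquiv z)
    have hP := hP'.symm
    let u : Coord P := ⟨stdCoord P, isCoord_stdCoord P⟩
    rw [hj.eq_jVac u h hz hz' hP, ← jVac_pullVac φ hinv u h hz hz' hP,
      hj.eq_jVac (z := z) (u.pullback φ) (Set.preimage_mono h) hz hz' (φ.ne_symm hP)]
  · intro P U u hP _ m ν
    have := isAlgSection_jVac hinv u hP m ν
    convert this using 3 with z
    rw [hj.eq_jVac u _ _ _ (ne_of_mem_right z.2 hP)]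
  · intro z P hzP m
    obtain ⟨S, hS, h, m, rfl⟩ := Vac.exists_res_eq m
    -- P is added to the finite set of excluded points; z survives because z ≠ P.
    have hsub : (S ∪ {P})ᶜ ⊆ Sᶜ := Set.compl_subset_compl.2 Set.subset_union_left
    refine ⟨(S ∪ {P})ᶜ, fun h' => h'.elim (h rfl) hzP, ?_, fun h => h (Or.inr rfl),
      Vac.res hsub m, Vac.res_res _ _ _⟩
    rw [compl_compl]
    exact hS.union (Set.finite_singleton P)
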